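/- **Theorem 2.2 (Curvature pinching estimate).** Let $M$ be a closed (compact, without boundary) smooth manifold of dimension $m\ge 3$, let $T\in(0,+\infty]$, and let $(g(t),\phi(t))_{t\in[0,T)}$ be a smooth solution of the Ricci-harmonic flow $$\partial_t g(t)=-2\,\mathrm{Ric}_{g(t)}+2\alpha(t)\,\nabla\phi(t)\otimes\nabla\phi(t),\qquad \partial_t\phi(t)=\Delta_{g(t)}\phi(t),$$ where $g(t)$ are Riemannian metrics on $M$, $\phi(t)$ are real-valued functions on $M$, and $\alpha:[0,T)\to\mathbb R$ is a differentiable function with $\alpha(t)\ge 0$ and $\dot\alpha(t)\le 0$. Put $$\mathrm{Sic}=\mathrm{Ric}-\alpha\,\nabla\phi\otimes\nabla\phi,\qquad S=\mathrm{tr}_g\,\mathrm{Sic}=R-\alpha|\nabla\phi|^2,\qquad \mathrm{Sin}=\mathrm{Sic}-\frac{S}{m}\,g,$$ and let $W$ be the Weyl tensor of $g$. Then there are constants $C,C_1,C_2$, depending only on $m$, $g(0)$, $\phi(0)$ and $\alpha(0)$ (in particular not on $T$, on $t$, or on the values of $\alpha$ at positive times), such that on $M$, for every $t\in[0,T)$,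 $$S_{g(t)}+C>0,\qquad \frac{|\mathrm{Sin}_{g(t)}|_{g(t)}}{S_{g(t)}+C}\;\le\; C_1+C_2\,\max_{M\times[0,t]}\sqrt{\frac{|W_{g(s)}|_{g(s)}+|\nabla^2_{g(s)}\phi(s)|^2_{g(s)}}{S_{g(s)}+C}}\,,$$ where the maximum is over all $(x,s)\in M\times[0,t]$. -/

import Mathlib

open scoped Manifold ContDiff Bundle
open Set

noncomputable section

namespace RicciHarmonic

/-! Tensor calculus in one coordinate system. Here `G u` is the matrix `(g_ij)` of a metric and
`F u` is the value of a function at the point with coordinates `u`. -/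

section Coordinates

variable {m : ℕ}

/-- The partial derivative `∂_i f` at `u`. -/
def pd (i : Fin m) (f : EuclideanSpace ℝ (Fin m) → ℝ) (u : EuclideanSpace ℝ (Fin m)) : ℝ :=
  fderiv ℝ f u (EuclideanSpace.single i 1)

variable (G : EuclideanSpace ℝ (Fin m) → Matrix (Fin m) (Fin m) ℝ)
  (F : EuclideanSpace ℝ (Fin m) → ℝ) (a : ℝ) (u : EuclideanSpace ℝ (Fin m))

/-- Christoffel symbols of the Levi-Civita connection,
`Γ^k_ij = ½ g^{kl} (∂_i g_jl + ∂_j g_il - ∂_l g_ij)`. -/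
def christoffel (k i j : Fin m) : ℝ :=
  (1 / 2) * ∑ l, (G u)⁻¹ k l *
    (pd i (fun v => G v j l) u + pd j (fun v => G v i l) u - pd l (fun v => G v i j) u)

/-- The (1,3) curvature tensor
`R_{ijk}^l = ∂_i Γ^l_jk - ∂_j Γ^l_ik + Γ^p_jk Γ^l_ip - Γ^p_ik Γ^l_jp`. -/
def riemUp (i j k l : Fin m) : ℝ :=
  pd i (fun v => christoffel G v l j k) u - pd j (fun v => christoffel G v l i k) u
    + ∑ p, (christoffel G u p j k * christoffel G u l i p
        - christoffel G u p i k * christoffel G u l j p)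

/-- The (0,4) Riemann tensor `R_ijkl = g_lp R_{ijk}^p`; on the round unit sphere it is
`g_il g_jk - g_ik g_jl`. -/
def riem (i j k l : Fin m) : ℝ := ∑ p, G u l p * riemUp G u i j k p

/-- The Ricci tensor `R_ij = g^{kl} R_kijl`. -/
def ricci (i j : Fin m) : ℝ := ∑ k, ∑ l, (G u)⁻¹ k l * riem G u k i j l

/-- The trace `g^{ij} A_ij` of a two-tensor. -/
def trace2 (A : Fin m → Fin m → ℝ) : ℝ := ∑ i, ∑ j, (G u)⁻¹ i j * A i j

/-- The norm `|A| = (g^{ik} g^{jl} A_ij A_kl)^{1/2}` of a two-tensor. -/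
def norm2 (A : Fin m → Fin m → ℝ) : ℝ :=
  Real.sqrt (∑ i, ∑ j, ∑ k, ∑ l, (G u)⁻¹ i k * (G u)⁻¹ j l * A i j * A k l)

/-- The norm `|A| = (g^{ip} g^{jq} g^{kr} g^{ls} A_ijkl A_pqrs)^{1/2}` of a four-tensor. -/
def norm4 (A : Fin m → Fin m → Fin m → Fin m → ℝ) : ℝ :=
  Real.sqrt (∑ i, ∑ j, ∑ k, ∑ l, ∑ p, ∑ q, ∑ r, ∑ s,
    (G u)⁻¹ i p * (G u)⁻¹ j q * (G u)⁻¹ k r * (G u)⁻¹ l s * A i j k l * A p q r s)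

/-- The scalar curvature. -/
def scal : ℝ := trace2 G u (ricci G u)

/-- The Weyl tensor, i.e. the part of `R_ijkl` left after subtracting the Ricci and
scalar curvature parts (dimension at least three). -/
def weyl (i j k l : Fin m) : ℝ :=
  riem G u i j k l
    - 1 / ((m : ℝ) - 2) * (ricci G u i l * G u j k + ricci G u j k * G u i l
        - ricci G u i k * G u j l - ricci G u j l * G u i k)
    + scal G u / (((m : ℝ) - 1) * ((m : ℝ) - 2)) * (G u i l * G u j k - G u i k * G u j l)

/-- The Hessian `∇_i ∇_j φ = ∂_i ∂_j φ - Γ^k_ij ∂_k φ`. -/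
def hess (i j : Fin m) : ℝ :=
  pd i (fun v => pd j F v) u - ∑ k, christoffel G u k i j * pd k F u

/-- The Laplacian `Δ φ = g^{ij} ∇_i ∇_j φ`. -/
def lap : ℝ := trace2 G u (hess G F u)

/-- `Sic = Ric - a ∇φ ⊗ ∇φ`. -/
def sic (i j : Fin m) : ℝ := ricci G u i j - a * (pd i F u * pd j F u)

/-- `S = tr Sic = R - a |∇φ|²`. -/
def sicTrace : ℝ := trace2 G u (sic G F a u)

/-- The trace-free part `Sin = Sic - (S / m) g` of `Sic`. -/
def sin (i j : Fin m) : ℝ := sic G F a u i j - sicTrace G F a u / m * G u i j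

end Coordinates

section Manifold

variable {m : ℕ} {M : Type*} [TopologicalSpace M] [ChartedSpace (EuclideanSpace ℝ (Fin m)) M]
  [IsManifold (𝓡 m) ∞ M]

variable (m M) in
/-- Smooth Riemannian metrics on `M`. -/
abbrev Metric : Type _ :=
  Bundle.ContMDiffRiemannianMetric (𝓡 m) ∞ (EuclideanSpace ℝ (Fin m))
    (TangentSpace (𝓡 m) : M → Type _)

/-- The coordinate matrix `g_ij = g(∂_i, ∂_j)` in the chart around `x₀`, at the point with
coordinates `u`. -/
def gram (g : Metric m M) (x₀ : M) (u : EuclideanSpace ℝ (Fin m)) : Matrix (Fin m) (Fin m) ℝ :=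
  fun i j => g.inner ((extChartAt (𝓡 m) x₀).symm u)
    (mfderiv 𝓘(ℝ, EuclideanSpace ℝ (Fin m)) (𝓡 m) (extChartAt (𝓡 m) x₀).symm u
      (EuclideanSpace.single i 1))
    (mfderiv 𝓘(ℝ, EuclideanSpace ℝ (Fin m)) (𝓡 m) (extChartAt (𝓡 m) x₀).symm u
      (EuclideanSpace.single j 1))

/-- A function read in the chart around `x₀`. -/
def inChart (m : ℕ) {M : Type*} [TopologicalSpace M]
    [ChartedSpace (EuclideanSpace ℝ (Fin m)) M] (f : M → ℝ) (x₀ : M)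
    (u : EuclideanSpace ℝ (Fin m)) : ℝ :=
  f ((extChartAt (𝓡 m) x₀).symm u)

/-- The function `S = R - a |∇φ|²` on `M`. -/
def S (g : Metric m M) (f : M → ℝ) (a : ℝ) (x : M) : ℝ :=
  sicTrace (gram g x) (inChart m f x) a (extChartAt (𝓡 m) x x)

/-- The pointwise norm `|Sin|` on `M`. -/
def normSin (g : Metric m M) (f : M → ℝ) (a : ℝ) (x : M) : ℝ :=
  norm2 (gram g x) (extChartAt (𝓡 m) x x)
    (sin (gram g x) (inChart m f x) a (extChartAt (𝓡 m) x x))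

/-- The pointwise norm `|W|` of the Weyl tensor on `M`. -/
def normWeyl (g : Metric m M) (x : M) : ℝ :=
  norm4 (gram g x) (extChartAt (𝓡 m) x x) (weyl (gram g x) (extChartAt (𝓡 m) x x))

/-- The pointwise norm `|∇²φ|` of the Hessian on `M`. -/
def normHess (g : Metric m M) (f : M → ℝ) (x : M) : ℝ :=
  norm2 (gram g x) (extChartAt (𝓡 m) x x)
    (hess (gram g x) (inChart m f x) (extChartAt (𝓡 m) x x))

/-- The time interval `[0, T)`, where `T = ⊤` is allowed. -/
def timeInterval (T : EReal) : Set ℝ := {t : ℝ | 0 ≤ t ∧ (t : EReal) < T}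

/-- `(g(t), φ(t))`, `t ∈ [0, T)`, is a smooth solution of the Ricci-harmonic flow
`∂_t g = -2 Ric + 2 α ∇φ ⊗ ∇φ`, `∂_t φ = Δ φ`, with coupling function `α`. Both equations are
written in local coordinates; at `t = 0` the time derivative is one-sided. -/
structure IsRicciHarmonicFlow (T : EReal) (α : ℝ → ℝ) (g : ℝ → Metric m M) (φ : ℝ → M → ℝ) :
    Prop where
  pos : 0 < T
  smooth_metric : ContMDiffOn ((𝓡 m).prod 𝓘(ℝ, ℝ))
    ((𝓡 m).prod 𝓘(ℝ, EuclideanSpace ℝ (Fin m) →L[ℝ] EuclideanSpace ℝ (Fin m) →L[ℝ] ℝ)) ∞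
    (fun p : M × ℝ => Bundle.TotalSpace.mk'
      (E := fun x : M => TangentSpace (𝓡 m) x →L[ℝ] TangentSpace (𝓡 m) x →L[ℝ] ℝ)
      (EuclideanSpace ℝ (Fin m) →L[ℝ] EuclideanSpace ℝ (Fin m) →L[ℝ] ℝ) p.1 ((g p.2).inner p.1))
    (univ ×ˢ timeInterval T)
  smooth_map : ContMDiffOn ((𝓡 m).prod 𝓘(ℝ, ℝ)) 𝓘(ℝ, ℝ) ∞ (fun p : M × ℝ => φ p.2 p.1)
    (univ ×ˢ timeInterval T)
  metric_eq : ∀ x₀ : M, ∀ u ∈ (extChartAt (𝓡 m) x₀).target, ∀ t ∈ timeInterval T, ∀ i j : Fin m,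
    HasDerivWithinAt (fun s => gram (g s) x₀ u i j)
      (-2 * ricci (gram (g t) x₀) u i j
        + 2 * α t * (pd i (inChart m (φ t) x₀) u * pd j (inChart m (φ t) x₀) u))
      (timeInterval T) t
  map_eq : ∀ x₀ : M, ∀ u ∈ (extChartAt (𝓡 m) x₀).target, ∀ t ∈ timeInterval T,
    HasDerivWithinAt (fun s => inChart m (φ s) x₀ u)
      (lap (gram (g t) x₀) (inChart m (φ t) x₀) u) (timeInterval T) t

end Manifold

end RicciHarmonic

end

open RicciHarmonic

namespace RicciHarmonic

/-! ### Calculus of partial derivatives -/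

section Calculus

variable {m : ℕ}

/-! Write X = S + C, P = |Sic|² and f = (P − S²/m)/X² = (|Sin|/X)². The estimate is the parabolic
maximum principle for f, prepared by two simpler applications of it.

Along the flow ∂ₜS = ΔS + 2|Sic|² + 2α(Δφ)² − α̇|∇φ|², so min S does not decrease, and ∂ₜ|∇φ|² =
Δ|∇φ|² − 2|∇²φ|² − 2α|∇φ|⁴, so max |∇φ|² does not increase (`IsRicciHarmonicFlow.le_S`,
`IsRicciHarmonicFlow.normGradSq_le`). If S ≥ −s₀ initially, then C = 1 + s₀ keeps X ≥ 1 for all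
time; also α ≤ α(0). Hence every constant below is fixed by the initial data.

At a spatial maximum of f with value b², ∇f = 0 and the second derivative test give ∇P = 2(S/m +
b²X)∇S and ΔP ≤ 2(S/m + b²X)ΔS + 2(1/m + b²)|∇S|². In X²∂ₜf the gradient terms are then nonpositive
by a refined Kato inequality, (1/m + b²)|∇S|² ≤ |∇Sic|² (`kato_of_critical`). The α̇ terms are
nonpositive once b ≥ 1, so no bound on α̇ enters. With z = bX = |Sin|, what remains contains
−4b²X|Sic|² ≤ −4b²Xz² = −4bz³, while the bad terms are at most cz³ + c'K²Xz² as soon as |W| + |∇²φ|²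
≤ K²X. Since z³ = bXz², the good term wins when b is at least an affine function of K
(`cubic_absorption`, `reaction_nonpos`). Thus f cannot grow at its maxima above the square of that
level, and `le_of_hasDerivAt_nonpos` concludes.

The evolution equations are computed at one point and one time, in coordinates that are orthonormal
there with vanishing Christoffel symbols (`MetricOn.exists_normal`). Two facts carry the
computation. The contracted Bianchi identity div Sic = ½dS − αΔφ dφ (`MetricOn.bianchi`) is
differentiated once more. Second partials of components differ from covariant ones by terms in ∂∂g,
which combine into Ricci after contraction with a symmetric tensor (`NormalAt.sum_corr`). Everything
returns to arbitrary coordinates, and to the manifold, by tensoriality. -/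

/-- Smoothness of an entire matrix-valued function on a set, entry by entry. -/
def MSmooth {X ι κ : Type*} [NormedAddCommGroup X] [NormedSpace ℝ X]
    (s : Set X) (A : X → Matrix ι κ ℝ) : Prop :=
  ∀ i j, ContDiffOn ℝ ∞ (fun x => A x i j) s

/-- Joint smoothness on `U × I` of a time-dependent function. -/
def JSmooth (U : Set (EuclideanSpace ℝ (Fin m))) (I : Set ℝ)
    (f : ℝ → EuclideanSpace ℝ (Fin m) → ℝ) : Prop :=
  ContDiffOn ℝ ∞ (fun p : EuclideanSpace ℝ (Fin m) × ℝ => f p.2 p.1) (U ×ˢ I)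

theorem two_le_infty : (2 : WithTop ℕ∞) ≤ ∞ :=
  WithTop.coe_le_coe.2 (OrderTop.le_top (2 : ℕ∞))

theorem differentiableAt_of_smooth {X : Type*} [NormedAddCommGroup X] [NormedSpace ℝ X]
    {f : X → ℝ} {U : Set X} (hU : IsOpen U)
    (hf : ContDiffOn ℝ ∞ f U) {u : X} (hu : u ∈ U) : DifferentiableAt ℝ f u :=
  (hf.contDiffAt (hU.mem_nhds hu)).differentiableAt (by simp)

/-! ### Pointwise rules for a partial derivative. -/

section PointRules

variable {f g : EuclideanSpace ℝ (Fin m) → ℝ} {u : EuclideanSpace ℝ (Fin m)} (i : Fin m)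

theorem pd_const (c : ℝ) : pd i (fun _ => c) u = 0 := by simp [pd]

theorem pd_add (hf : DifferentiableAt ℝ f u) (hg : DifferentiableAt ℝ g u) :
    pd i (fun v => f v + g v) u = pd i f u + pd i g u := by
  simp only [pd]; rw [fderiv_fun_add hf hg]; rfl

theorem pd_sub (hf : DifferentiableAt ℝ f u) (hg : DifferentiableAt ℝ g u) :
    pd i (fun v => f v - g v) u = pd i f u - pd i g u := by
  simp only [pd]; rw [fderiv_fun_sub hf hg]; rfl

theorem pd_neg : pd i (fun v => - f v) u = - pd i f u := by
  simp only [pd]; rw [fderiv_fun_neg]; rfl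

theorem pd_mul (hf : DifferentiableAt ℝ f u) (hg : DifferentiableAt ℝ g u) :
    pd i (fun v => f v * g v) u = pd i f u * g u + f u * pd i g u := by
  simp only [pd]; rw [fderiv_fun_mul hf hg]; simp; ring

theorem pd_const_mul (c : ℝ) (hf : DifferentiableAt ℝ f u) :
    pd i (fun v => c * f v) u = c * pd i f u := by
  rw [pd_mul i (differentiableAt_const c) hf, pd_const]; ring

theorem pd_sum {ι : Type*} (s : Finset ι) {f : ι → EuclideanSpace ℝ (Fin m) → ℝ}
    (hf : ∀ a ∈ s, DifferentiableAt ℝ (f a) u) :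
    pd i (fun v => ∑ a ∈ s, f a v) u = ∑ a ∈ s, pd i (f a) u := by
  simp only [pd]; rw [fderiv_fun_sum hf]; simp

theorem pd_congr {U : Set (EuclideanSpace ℝ (Fin m))} (hU : IsOpen U) (hu : u ∈ U)
    (h : ∀ v ∈ U, f v = g v) : pd i f u = pd i g u := by
  simp only [pd]
  rw [Filter.EventuallyEq.fderiv_eq (Filter.eventuallyEq_of_mem (hU.mem_nhds hu) h)]

theorem fderiv_eq_sum_pd (w : EuclideanSpace ℝ (Fin m)) :
    fderiv ℝ f u w = ∑ i, w i * pd i f u := by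
  conv_lhs => rw [← (EuclideanSpace.basisFun (Fin m) ℝ).sum_repr w]
  simp [pd]

end PointRules

/-! ### Smoothness on open sets and in space-time; symmetry of second derivatives. -/

section SetRules

variable {U : Set (EuclideanSpace ℝ (Fin m))} {I : Set ℝ}

theorem smooth_pd (hU : IsOpen U) {f : EuclideanSpace ℝ (Fin m) → ℝ} (hf : ContDiffOn ℝ ∞ f U)
    (i : Fin m) : ContDiffOn ℝ ∞ (fun v => pd i f v) U :=
  (hf.fderiv_of_isOpen hU (by simp)).clm_apply contDiffOn_const

theorem pd_comm (hU : IsOpen U) {f : EuclideanSpace ℝ (Fin m) → ℝ} (hf : ContDiffOn ℝ ∞ f U)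
    {u : EuclideanSpace ℝ (Fin m)} (hu : u ∈ U) (i j : Fin m) :
    pd i (fun v => pd j f v) u = pd j (fun v => pd i f v) u := by
  have h1 : ContDiffAt ℝ ∞ f u := hf.contDiffAt (hU.mem_nhds hu)
  have h2 : DifferentiableAt ℝ (fderiv ℝ f) u :=
    ((hf.fderiv_of_isOpen hU (m := ∞) (by simp)).contDiffAt (hU.mem_nhds hu)).differentiableAt
      (by simp)
  have h3 := h1.isSymmSndFDerivAt (by simp; exact two_le_infty)
  simp only [pd]
  rw [fderiv_clm_apply h2 (differentiableAt_const _), fderiv_clm_apply h2 (differentiableAt_const _)]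
  simpa using h3.eq _ _

theorem JSmooth.slice {f : ℝ → EuclideanSpace ℝ (Fin m) → ℝ} (hf : JSmooth U I f) {t : ℝ}
    (ht : t ∈ I) : ContDiffOn ℝ ∞ (f t) U :=
  ContDiffOn.comp (g := fun p : EuclideanSpace ℝ (Fin m) × ℝ => f p.2 p.1) hf
    (contDiffOn_id.prodMk contDiffOn_const) fun _ hv => ⟨hv, ht⟩

theorem JSmooth.of_slice {f : EuclideanSpace ℝ (Fin m) → ℝ} (hf : ContDiffOn ℝ ∞ f U) :
    JSmooth U univ (fun _ => f) :=
  ContDiffOn.comp (g := f) hf contDiffOn_fst fun _ hp => hp.1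

theorem JSmooth.add {f g : ℝ → EuclideanSpace ℝ (Fin m) → ℝ} (hf : JSmooth U I f)
    (hg : JSmooth U I g) : JSmooth U I (fun t v => f t v + g t v) := ContDiffOn.add hf hg

theorem JSmooth.sub {f g : ℝ → EuclideanSpace ℝ (Fin m) → ℝ} (hf : JSmooth U I f)
    (hg : JSmooth U I g) : JSmooth U I (fun t v => f t v - g t v) := ContDiffOn.sub hf hg

theorem JSmooth.mul {f g : ℝ → EuclideanSpace ℝ (Fin m) → ℝ} (hf : JSmooth U I f)
    (hg : JSmooth U I g) : JSmooth U I (fun t v => f t v * g t v) := ContDiffOn.mul hf hg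

theorem JSmooth.const (c : ℝ) : JSmooth U I (fun _ _ => c) := contDiffOn_const

theorem JSmooth.sum {ι : Type*} {s : Finset ι} {f : ι → ℝ → EuclideanSpace ℝ (Fin m) → ℝ}
    (hf : ∀ a ∈ s, JSmooth U I (f a)) : JSmooth U I (fun t v => ∑ a ∈ s, f a t v) :=
  ContDiffOn.sum hf

theorem JSmooth.hasFDerivAt_slice (hU : IsOpen U)
    {f : ℝ → EuclideanSpace ℝ (Fin m) → ℝ} (hf : JSmooth U I f)
    {p : EuclideanSpace ℝ (Fin m) × ℝ} (hp : p ∈ U ×ˢ I) :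
    HasFDerivAt (f p.2) ((fderivWithin ℝ (fun q : EuclideanSpace ℝ (Fin m) × ℝ => f q.2 q.1)
      (U ×ˢ I) p).comp (ContinuousLinearMap.inl ℝ _ _)) p.1 := by
  have h1 := ((hf p hp).differentiableWithinAt (by simp)).hasFDerivWithinAt
  have h2 : HasFDerivWithinAt (fun v : EuclideanSpace ℝ (Fin m) => (v, p.2))
      (ContinuousLinearMap.inl ℝ (EuclideanSpace ℝ (Fin m)) ℝ) U p.1 :=
    (hasFDerivAt_prodMk_left p.1 p.2).hasFDerivWithinAt
  exact (HasFDerivWithinAt.comp (g := fun q : EuclideanSpace ℝ (Fin m) × ℝ => f q.2 q.1)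
    p.1 h1 h2 (t := U ×ˢ I) (fun v hv => ⟨hv, hp.2⟩)).hasFDerivAt (hU.mem_nhds hp.1)

/-- The derivative of a slice is the total derivative within `U ×ˢ I` in the direction (eᵢ, 0). This
needs `U` open but only unique differentiability of `I`, so the closed end t = 0 of the time
interval is allowed. -/
theorem JSmooth.pd (hU : IsOpen U) (hI : UniqueDiffOn ℝ I)
    {f : ℝ → EuclideanSpace ℝ (Fin m) → ℝ} (hf : JSmooth U I f) (i : Fin m) :
    JSmooth U I (fun t v => pd i (f t) v) := by
  have h1 : ContDiffOn ℝ ∞ (fun p => fderivWithin ℝ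
      (fun q : EuclideanSpace ℝ (Fin m) × ℝ => f q.2 q.1) (U ×ˢ I) p
        (EuclideanSpace.single i 1, (0 : ℝ))) (U ×ˢ I) :=
    (ContDiffOn.fderivWithin hf (hU.uniqueDiffOn.prod hI) (by simp)).clm_apply contDiffOn_const
  refine h1.congr fun p hp => ?_
  simp only [RicciHarmonic.pd]
  rw [(hf.hasFDerivAt_slice hU hp).fderiv]
  simp

/-- Time and space derivatives commute. -/
theorem hasDerivAt_pd (hU : IsOpen U) (hI : IsOpen I)
    {f : ℝ → EuclideanSpace ℝ (Fin m) → ℝ} (hf : JSmooth U I f)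
    {h : EuclideanSpace ℝ (Fin m) → ℝ} {t : ℝ} (ht : t ∈ I)
    (hd : ∀ v ∈ U, HasDerivAt (fun s => f s v) (h v) t) (i : Fin m)
    {u : EuclideanSpace ℝ (Fin m)} (hu : u ∈ U) :
    HasDerivAt (fun s => RicciHarmonic.pd i (f s) u) (RicciHarmonic.pd i h u) t := by
  -- Both derivatives are second derivatives of one space-time function, so the claim is the
  -- symmetry of its second derivative at (u, t).
  set F := fun q : EuclideanSpace ℝ (Fin m) × ℝ => f q.2 q.1 with hF
  have hW : IsOpen (U ×ˢ I) := hU.prod hI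
  have hup : (u, t) ∈ U ×ˢ I := ⟨hu, ht⟩
  have hFd : ∀ p ∈ U ×ˢ I, DifferentiableAt ℝ F p := fun p hp =>
    ((hf p hp).contDiffAt (hW.mem_nhds hp)).differentiableAt (by simp)
  have h2 : DifferentiableAt ℝ (fderiv ℝ F) (u, t) :=
    ((ContDiffOn.fderiv_of_isOpen hf hW (m := ∞) (by simp)).contDiffAt
      (hW.mem_nhds hup)).differentiableAt (by simp)
  have hsym := (ContDiffOn.contDiffAt hf (hW.mem_nhds hup)).isSymmSndFDerivAt (by simp; exact two_le_infty)
  have hsl : ∀ p ∈ U ×ˢ I, RicciHarmonic.pd i (f p.2) p.1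
      = fderiv ℝ F p (EuclideanSpace.single i 1, 0) := by
    intro p hp
    simp only [RicciHarmonic.pd]
    rw [(hf.hasFDerivAt_slice hU hp).fderiv, fderivWithin_of_isOpen hW hp]
    simp [F]
  have ht' : ∀ v ∈ U, h v = fderiv ℝ F (v, t) (0, 1) := by
    intro v hv
    have h3 : HasDerivAt (fun s : ℝ => (v, s)) ((0 : EuclideanSpace ℝ (Fin m)), (1 : ℝ)) t :=
      (hasDerivAt_const t v).prodMk (hasDerivAt_id t)
    exact (hd v hv).unique
      ((hFd (v, t) ⟨hv, ht⟩).hasFDerivAt.comp_hasDerivAt t h3)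
  have e1 : RicciHarmonic.pd i h u
      = fderiv ℝ (fderiv ℝ F) (u, t) (EuclideanSpace.single i 1, 0) (0, 1) := by
    rw [pd_congr i hU hu ht']
    simp only [RicciHarmonic.pd]
    have h4 : HasFDerivAt (fun v : EuclideanSpace ℝ (Fin m) => fderiv ℝ F (v, t))
        ((fderiv ℝ (fderiv ℝ F) (u, t)).comp (ContinuousLinearMap.inl ℝ _ _)) u :=
      HasFDerivAt.comp (g := fderiv ℝ F) u h2.hasFDerivAt (hasFDerivAt_prodMk_left u t)
    rw [(h4.clm_apply (hasFDerivAt_const ((0 : EuclideanSpace ℝ (Fin m)), (1 : ℝ)) u)).fderiv]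
    simp
  rw [e1, hsym.eq]
  have h3 : HasDerivAt (fun s : ℝ => (u, s)) ((0 : EuclideanSpace ℝ (Fin m)), (1 : ℝ)) t :=
    (hasDerivAt_const t u).prodMk (hasDerivAt_id t)
  have h5 : HasDerivAt (fun s => fderiv ℝ F (u, s) (EuclideanSpace.single i 1, 0))
      (fderiv ℝ (fderiv ℝ F) (u, t) (0, 1) (EuclideanSpace.single i 1, 0)) t := by
    have := (h2.hasFDerivAt.comp_hasDerivAt t h3).clm_apply
      (hasDerivAt_const t ((EuclideanSpace.single i 1 : EuclideanSpace ℝ (Fin m)), (0 : ℝ)))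
    simpa using this
  refine h5.congr_of_eventuallyEq ?_
  filter_upwards [hI.mem_nhds ht] with s hs
  exact hsl (u, s) ⟨hu, hs⟩

theorem JSmooth.differentiableAt_time (hU : IsOpen U) (hI : IsOpen I)
    {f : ℝ → EuclideanSpace ℝ (Fin m) → ℝ} (hf : JSmooth U I f)
    {t : ℝ} (ht : t ∈ I) {u : EuclideanSpace ℝ (Fin m)} (hu : u ∈ U) :
    DifferentiableAt ℝ (fun s => f s u) t := by
  have h1 : DifferentiableAt ℝ (fun q : EuclideanSpace ℝ (Fin m) × ℝ => f q.2 q.1) (u, t) :=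
    differentiableAt_of_smooth (hU.prod hI) hf ⟨hu, ht⟩
  exact h1.comp t ((differentiableAt_const u).prodMk differentiableAt_id)

end SetRules

/-! ### Smoothness of products, determinants and inverses of matrices. -/

section MatrixRules

theorem MSmooth.transpose {X ι κ : Type*} [NormedAddCommGroup X] [NormedSpace ℝ X] {s : Set X}
    {A : X → Matrix ι κ ℝ} (hA : MSmooth s A) :
    MSmooth s (fun x => (A x).transpose) := fun i j => hA j i

variable {X : Type*} [NormedAddCommGroup X] [NormedSpace ℝ X] {s : Set X}
  {ι κ μ : Type*} [Fintype κ]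

theorem MSmooth.mul {A : X → Matrix ι κ ℝ} {B : X → Matrix κ μ ℝ} (hA : MSmooth s A)
    (hB : MSmooth s B) : MSmooth s (fun x => A x * B x) := fun i j => by
  simp only [Matrix.mul_apply]
  exact ContDiffOn.sum fun k _ => (hA i k).mul (hB k j)

theorem MSmooth.det [DecidableEq κ] {A : X → Matrix κ κ ℝ} (hA : MSmooth s A) :
    ContDiffOn ℝ ∞ (fun x => (A x).det) s := by
  simp only [Matrix.det_apply]
  exact ContDiffOn.sum fun σ _ => ContDiffOn.const_smul _
    (contDiffOn_prod fun i _ => hA _ _)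

/-- Cramer's rule: the entries of the inverse are determinants divided by a nonvanishing
determinant. -/
theorem MSmooth.inv [DecidableEq κ] {A : X → Matrix κ κ ℝ} (hA : MSmooth s A)
    (hd : ∀ x ∈ s, (A x).det ≠ 0) : MSmooth s (fun x => (A x)⁻¹) := by
  intro i j
  simp only [Matrix.inv_def, Matrix.smul_apply, Ring.inverse_eq_inv, smul_eq_mul]
  refine (hA.det.inv hd).mul ?_
  simp only [Matrix.adjugate_apply]
  refine MSmooth.det (A := fun x => (A x).updateRow j (Pi.single i 1)) fun a b => ?_
  by_cases h : a = j
  · simp only [h, Matrix.updateRow_self]; exact contDiffOn_const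
  · simp only [Matrix.updateRow_ne h]; exact hA a b

end MatrixRules

/-- Entrywise partial derivative of a matrix-valued function. -/
noncomputable def mpd {ι κ : Type*} (i : Fin m) (A : EuclideanSpace ℝ (Fin m) → Matrix ι κ ℝ)
    (u : EuclideanSpace ℝ (Fin m)) : Matrix ι κ ℝ :=
  Matrix.of fun a b => pd i (fun v => A v a b) u

/-! ### Leibniz rules for matrix-valued maps. -/

section MatrixDerivative

variable {ι κ μ : Type*} {U : Set (EuclideanSpace ℝ (Fin m))} {u : EuclideanSpace ℝ (Fin m)}
  (i : Fin m)

theorem mpd_apply (A : EuclideanSpace ℝ (Fin m) → Matrix ι κ ℝ) (a : ι) (b : κ) :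
    mpd i A u a b = pd i (fun v => A v a b) u := rfl

theorem MSmooth.mpd (hU : IsOpen U) {A : EuclideanSpace ℝ (Fin m) → Matrix ι κ ℝ}
    (hA : MSmooth U A) : MSmooth U (fun v => mpd i A v) := fun a b => smooth_pd hU (hA a b) i

theorem mpd_mul [Fintype κ] (hU : IsOpen U) (hu : u ∈ U)
    {A : EuclideanSpace ℝ (Fin m) → Matrix ι κ ℝ}
    {B : EuclideanSpace ℝ (Fin m) → Matrix κ μ ℝ} (hA : MSmooth U A) (hB : MSmooth U B) :
    mpd i (fun v => A v * B v) u = mpd i A u * B u + A u * mpd i B u := by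
  ext a b
  have dA := fun a b => differentiableAt_of_smooth hU (hA a b) hu
  have dB := fun a b => differentiableAt_of_smooth hU (hB a b) hu
  simp only [mpd_apply, Matrix.mul_apply, Matrix.add_apply]
  rw [pd_sum i _ (f := fun k v => A v a k * B v k b) fun k _ => (dA a k).mul (dB k b), ← Finset.sum_add_distrib]
  exact Finset.sum_congr rfl fun k _ => pd_mul i (dA a k) (dB k b)

theorem mpd_add (hU : IsOpen U) (hu : u ∈ U)
    {A B : EuclideanSpace ℝ (Fin m) → Matrix ι κ ℝ} (hA : MSmooth U A) (hB : MSmooth U B) :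
    mpd i (fun v => A v + B v) u = mpd i A u + mpd i B u := by
  ext a b
  exact pd_add i (differentiableAt_of_smooth hU (hA a b) hu)
    (differentiableAt_of_smooth hU (hB a b) hu)

theorem mpd_transpose (A : EuclideanSpace ℝ (Fin m) → Matrix ι κ ℝ) :
    mpd i (fun v => (A v).transpose) u = (mpd i A u).transpose := rfl

theorem mpd_congr (hU : IsOpen U) (hu : u ∈ U) {A B : EuclideanSpace ℝ (Fin m) → Matrix ι κ ℝ}
    (h : ∀ v ∈ U, A v = B v) : mpd i A u = mpd i B u := by
  ext a b
  exact pd_congr i hU hu fun v hv => by rw [h v hv]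

theorem mpd_comm (hU : IsOpen U) (hu : u ∈ U) {A : EuclideanSpace ℝ (Fin m) → Matrix ι κ ℝ}
    (hA : MSmooth U A) (j : Fin m) : mpd i (fun v => mpd j A v) u = mpd j (fun v => mpd i A v) u := by
  ext a b
  exact pd_comm hU (hA a b) hu i j

end MatrixDerivative

end Calculus

/-! ### The Levi-Civita connection in coordinates -/

section LeviCivita

variable {m : ℕ}

/-- `G` is a smooth Riemannian metric on the open set `U`. -/
structure MetricOn (U : Set (EuclideanSpace ℝ (Fin m)))
    (G : EuclideanSpace ℝ (Fin m) → Matrix (Fin m) (Fin m) ℝ) : Prop where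
  isOpen : IsOpen U
  smooth : MSmooth U G
  posDef : ∀ u ∈ U, (G u).PosDef

/-- `G` is a jointly smooth family of Riemannian metrics on the open set `U`. -/
structure MetricFamily (U : Set (EuclideanSpace ℝ (Fin m))) (I : Set ℝ)
    (G : ℝ → EuclideanSpace ℝ (Fin m) → Matrix (Fin m) (Fin m) ℝ) : Prop where
  isOpen : IsOpen U
  uniq : UniqueDiffOn ℝ I
  smooth : ∀ i j, JSmooth U I (fun t v => G t v i j)
  posDef : ∀ t ∈ I, ∀ u ∈ U, (G t u).PosDef

/-- The matrix `k, j ↦ Γ^k_ij`. -/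
noncomputable def chr (G : EuclideanSpace ℝ (Fin m) → Matrix (Fin m) (Fin m) ℝ) (i : Fin m)
    (u : EuclideanSpace ℝ (Fin m)) : Matrix (Fin m) (Fin m) ℝ :=
  Matrix.of fun k j => christoffel G u k i j

/-- The matrix `l, k ↦ R_{ijk}^l`. -/
noncomputable def curv (G : EuclideanSpace ℝ (Fin m) → Matrix (Fin m) (Fin m) ℝ) (i j : Fin m)
    (u : EuclideanSpace ℝ (Fin m)) : Matrix (Fin m) (Fin m) ℝ :=
  Matrix.of fun l k => riemUp G u i j k l

/-- The matrix `k, j ↦ ∂_i g_jk + ∂_j g_ik - ∂_k g_ij`. -/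
noncomputable def koszul (G : EuclideanSpace ℝ (Fin m) → Matrix (Fin m) (Fin m) ℝ) (i : Fin m)
    (u : EuclideanSpace ℝ (Fin m)) : Matrix (Fin m) (Fin m) ℝ :=
  Matrix.of fun k j =>
    pd i (fun v => G v j k) u + pd j (fun v => G v i k) u - pd k (fun v => G v i j) u

variable {U V : Set (EuclideanSpace ℝ (Fin m))} {I : Set ℝ}
  {G G' : EuclideanSpace ℝ (Fin m) → Matrix (Fin m) (Fin m) ℝ} {u : EuclideanSpace ℝ (Fin m)}

theorem MetricOn.symm (h : MetricOn U G) (hu : u ∈ U) : (G u).transpose = G u := by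
  have := (h.posDef u hu).isHermitian
  simpa [Matrix.IsHermitian, Matrix.conjTranspose_eq_transpose_of_trivial] using this

theorem MetricOn.symm_apply (h : MetricOn U G) (hu : u ∈ U) (i j : Fin m) : G u i j = G u j i := by
  conv_lhs => rw [← h.symm hu]
  rfl

theorem MetricOn.det_ne (h : MetricOn U G) (hu : u ∈ U) : (G u).det ≠ 0 :=
  (h.posDef u hu).det_pos.ne'

theorem MetricOn.mul_inv (h : MetricOn U G) (hu : u ∈ U) : G u * (G u)⁻¹ = 1 :=
  Matrix.mul_nonsing_inv _ (h.det_ne hu).isUnit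

theorem MetricOn.inv_mul (h : MetricOn U G) (hu : u ∈ U) : (G u)⁻¹ * G u = 1 :=
  Matrix.nonsing_inv_mul _ (h.det_ne hu).isUnit

theorem MetricOn.pd_symm (h : MetricOn U G) (hu : u ∈ U) (k i j : Fin m) :
    pd k (fun v => G v i j) u = pd k (fun v => G v j i) u :=
  pd_congr k h.isOpen hu fun _ hv => h.symm_apply hv i j

theorem chr_eq (G : EuclideanSpace ℝ (Fin m) → Matrix (Fin m) (Fin m) ℝ) (i : Fin m)
    (u : EuclideanSpace ℝ (Fin m)) : chr G i u = (1 / 2 : ℝ) • ((G u)⁻¹ * koszul G i u) := by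
  ext k j
  simp [chr, christoffel, koszul, Matrix.mul_apply]

theorem MetricOn.mul_chr (h : MetricOn U G) (hu : u ∈ U) (i : Fin m) :
    G u * chr G i u = (1 / 2 : ℝ) • koszul G i u := by
  rw [chr_eq, Matrix.mul_smul, ← Matrix.mul_assoc, h.mul_inv hu, Matrix.one_mul]

theorem MetricOn.chr_symm (h : MetricOn U G) (hu : u ∈ U) (k i j : Fin m) :
    chr G i u k j = chr G j u k i := by
  simp only [chr, christoffel, Matrix.of_apply]
  congr 1
  refine Finset.sum_congr rfl fun l _ => ?_
  rw [h.pd_symm hu l i j]; ring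

/-- This is ∇g = 0. The Koszul matrix equals 2gΓ, and its symmetric part is the derivative of the
metric. -/
theorem MetricOn.compat (h : MetricOn U G) (hu : u ∈ U) (k : Fin m) :
    mpd k G u = (chr G k u).transpose * G u + G u * chr G k u := by
  have h1 := h.mul_chr hu k
  have h2 : (chr G k u).transpose * G u = (1 / 2 : ℝ) • (koszul G k u).transpose := by
    rw [← Matrix.transpose_smul, ← h1, Matrix.transpose_mul, h.symm hu]
  rw [h1, h2]
  ext i j
  simp only [mpd_apply, koszul, Matrix.add_apply, Matrix.smul_apply, Matrix.transpose_apply,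
    Matrix.of_apply, smul_eq_mul]
  rw [h.pd_symm hu k j i]
  ring

/-- The fundamental theorem of Riemannian geometry at one point: cyclic permutation of the
compatibility equations determines a torsion-free `B`. It lets the transformation law of Γ be
verified rather than computed. -/
theorem MetricOn.chr_unique (h : MetricOn U G) (hu : u ∈ U)
    (B : Fin m → Matrix (Fin m) (Fin m) ℝ) (hB : ∀ k i j, B i k j = B j k i)
    (hc : ∀ k, mpd k G u = (B k).transpose * G u + G u * B k) (i : Fin m) :
    chr G i u = B i := by
  have key : G u * chr G i u = G u * B i := by
    rw [h.mul_chr hu]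
    have hs : ∀ i j k, (G u * B i) k j = (G u * B j) k i := fun i j k => by
      simp only [Matrix.mul_apply, hB _ i j]
    have hk : ∀ k i j, pd k (fun v => G v i j) u = (G u * B k) j i + (G u * B k) i j := by
      intro k i j
      have := congrFun (congrFun (hc k) i) j
      rw [mpd_apply] at this
      rw [this, Matrix.add_apply]
      congr 1
      conv_lhs => rw [← h.symm hu, ← Matrix.transpose_mul]
      rfl
    ext k j
    simp only [koszul, Matrix.smul_apply, Matrix.of_apply, smul_eq_mul, hk]
    rw [hs k i j, hs j i k, hs k j i]
    ring
  have := congrArg (fun M => (G u)⁻¹ * M) key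
  simpa only [← Matrix.mul_assoc, h.inv_mul hu, Matrix.one_mul] using this

theorem MetricFamily.slice {G : ℝ → EuclideanSpace ℝ (Fin m) → Matrix (Fin m) (Fin m) ℝ}
    (h : MetricFamily U I G) {t : ℝ} (ht : t ∈ I) : MetricOn U (G t) where
  isOpen := h.isOpen
  smooth i j := (h.smooth i j).slice ht
  posDef := h.posDef t ht

/-- A constant family; through it the smoothness results for time-dependent metrics also serve a
fixed metric. -/
theorem MetricOn.family (h : MetricOn U G) : MetricFamily U univ (fun _ => G) where
  isOpen := h.isOpen
  uniq := uniqueDiffOn_univ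
  smooth i j := JSmooth.of_slice (h.smooth i j)
  posDef _ _ := h.posDef

theorem curv_eq (G : EuclideanSpace ℝ (Fin m) → Matrix (Fin m) (Fin m) ℝ)
    (u : EuclideanSpace ℝ (Fin m)) (i j : Fin m) :
    curv G i j u = mpd i (chr G j) u - mpd j (chr G i) u
      + (chr G i u * chr G j u - chr G j u * chr G i u) := by
  ext l k
  simp only [curv, riemUp, chr, mpd_apply, Matrix.of_apply, Matrix.add_apply, Matrix.sub_apply,
    Matrix.mul_apply, Finset.sum_sub_distrib]
  congr 2 <;> exact Finset.sum_congr rfl fun p _ => by ring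

theorem riem_eq (G : EuclideanSpace ℝ (Fin m) → Matrix (Fin m) (Fin m) ℝ)
    (u : EuclideanSpace ℝ (Fin m)) (i j k l : Fin m) :
    riem G u i j k l = (G u * curv G i j u) l k := by
  simp [riem, curv, Matrix.mul_apply]

theorem MetricOn.ricci_eq (h : MetricOn U G) (hu : u ∈ U) (i j : Fin m) :
    ricci G u i j = ∑ k, curv G k i u k j := by
  have : ∀ k, ∑ l, (G u)⁻¹ k l * riem G u k i j l = curv G k i u k j := by
    intro k
    simp only [riem_eq]
    rw [← Matrix.mul_apply, ← Matrix.mul_assoc, h.inv_mul hu, Matrix.one_mul]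
  simp only [ricci, this]

/-! Smoothness of the tensors of a family of metrics. -/

section Smoothness

variable {G : ℝ → EuclideanSpace ℝ (Fin m) → Matrix (Fin m) (Fin m) ℝ}
  {F : ℝ → EuclideanSpace ℝ (Fin m) → ℝ}

theorem MetricFamily.smooth_inv (h : MetricFamily U I G) (i j : Fin m) :
    JSmooth U I (fun t v => (G t v)⁻¹ i j) := by
  have h1 : MSmooth (U ×ˢ I) (fun p : EuclideanSpace ℝ (Fin m) × ℝ => G p.2 p.1) := h.smooth
  exact h1.inv (fun p hp => (h.slice hp.2).det_ne hp.1) i j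

theorem MetricFamily.smooth_christoffel (h : MetricFamily U I G) (k i j : Fin m) :
    JSmooth U I (fun t v => christoffel (G t) v k i j) := by
  simp only [christoffel]
  have hp := fun k i j => (h.smooth i j).pd h.isOpen h.uniq k
  exact (JSmooth.const _).mul (JSmooth.sum fun l _ => (h.smooth_inv k l).mul
    (((hp i j l).add (hp j i l)).sub (hp l i j)))

theorem MetricFamily.smooth_riemUp (h : MetricFamily U I G) (i j k l : Fin m) :
    JSmooth U I (fun t v => riemUp (G t) v i j k l) := by
  simp only [riemUp]
  have hc := h.smooth_christoffel
  have hp := fun a k i j => (hc k i j).pd h.isOpen h.uniq a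
  exact ((hp i l j k).sub (hp j l i k)).add (JSmooth.sum fun p _ =>
    ((hc _ _ _).mul (hc _ _ _)).sub ((hc _ _ _).mul (hc _ _ _)))

theorem MetricFamily.smooth_riem (h : MetricFamily U I G) (i j k l : Fin m) :
    JSmooth U I (fun t v => riem (G t) v i j k l) :=
  JSmooth.sum fun p _ => (h.smooth l p).mul (h.smooth_riemUp i j k p)

theorem MetricFamily.smooth_ricci (h : MetricFamily U I G) (i j : Fin m) :
    JSmooth U I (fun t v => ricci (G t) v i j) :=
  JSmooth.sum fun k _ => JSmooth.sum fun l _ => (h.smooth_inv k l).mul (h.smooth_riem k i j l)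

theorem MetricFamily.smooth_trace2 (h : MetricFamily U I G)
    {A : ℝ → EuclideanSpace ℝ (Fin m) → Fin m → Fin m → ℝ}
    (hA : ∀ i j, JSmooth U I (fun t v => A t v i j)) :
    JSmooth U I (fun t v => trace2 (G t) v (A t v)) :=
  JSmooth.sum fun k _ => JSmooth.sum fun l _ => (h.smooth_inv k l).mul (hA k l)

theorem MetricFamily.smooth_scal (h : MetricFamily U I G) :
    JSmooth U I (fun t v => scal (G t) v) := h.smooth_trace2 h.smooth_ricci

theorem MetricFamily.smooth_weyl (h : MetricFamily U I G) (i j k l : Fin m) :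
    JSmooth U I (fun t v => weyl (G t) v i j k l) := by
  simp only [weyl]
  have hr := h.smooth_ricci
  have hg := h.smooth
  simp only [div_eq_mul_inv]
  exact ((h.smooth_riem i j k l).sub ((JSmooth.const _).mul
    (((((hr i l).mul (hg j k)).add ((hr j k).mul (hg i l))).sub ((hr i k).mul (hg j l))).sub
      ((hr j l).mul (hg i k))))).add ((h.smooth_scal.mul (JSmooth.const _)).mul
      (((hg i l).mul (hg j k)).sub ((hg i k).mul (hg j l))))

theorem MetricFamily.smooth_hess (h : MetricFamily U I G) (hF : JSmooth U I F) (i j : Fin m) :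
    JSmooth U I (fun t v => hess (G t) (F t) v i j) := by
  simp only [hess]
  have hp := fun i => hF.pd h.isOpen h.uniq i
  exact ((hp j).pd h.isOpen h.uniq i).sub
    (JSmooth.sum fun k _ => (h.smooth_christoffel k i j).mul (hp k))

theorem MetricFamily.smooth_lap (h : MetricFamily U I G) (hF : JSmooth U I F) :
    JSmooth U I (fun t v => lap (G t) (F t) v) := h.smooth_trace2 (h.smooth_hess hF)

/-- The squared gradient `|∇φ|²`. -/
noncomputable def gradSq (G : EuclideanSpace ℝ (Fin m) → Matrix (Fin m) (Fin m) ℝ)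
    (F : EuclideanSpace ℝ (Fin m) → ℝ) (u : EuclideanSpace ℝ (Fin m)) : ℝ :=
  trace2 G u (fun i j => pd i F u * pd j F u)

theorem MetricFamily.smooth_gradSq (h : MetricFamily U I G) (hF : JSmooth U I F) :
    JSmooth U I (fun t v => gradSq (G t) (F t) v) :=
  h.smooth_trace2 fun i j => (hF.pd h.isOpen h.uniq i).mul (hF.pd h.isOpen h.uniq j)

end Smoothness

end LeviCivita

/-! ### Change of coordinates -/

section Pullback

variable {m : ℕ}

/-- The Jacobian matrix `∂_i ψ^a`. -/
noncomputable def jac (ψ : EuclideanSpace ℝ (Fin m) → EuclideanSpace ℝ (Fin m))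
    (v : EuclideanSpace ℝ (Fin m)) : Matrix (Fin m) (Fin m) ℝ :=
  Matrix.of fun a i => pd i (fun w => ψ w a) v

/-- `ψ` is a smooth map from `V` to `U` with invertible differential. -/
structure CoordChange (V U : Set (EuclideanSpace ℝ (Fin m)))
    (ψ : EuclideanSpace ℝ (Fin m) → EuclideanSpace ℝ (Fin m)) : Prop where
  isOpen : IsOpen V
  smooth : ContDiffOn ℝ ∞ ψ V
  mapsTo : MapsTo ψ V U
  det_ne : ∀ v ∈ V, (jac ψ v).det ≠ 0

variable {U V : Set (EuclideanSpace ℝ (Fin m))} {I : Set ℝ}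
  {ψ : EuclideanSpace ℝ (Fin m) → EuclideanSpace ℝ (Fin m)}
  {G G' : EuclideanSpace ℝ (Fin m) → Matrix (Fin m) (Fin m) ℝ}
  {F F' : EuclideanSpace ℝ (Fin m) → ℝ} {v : EuclideanSpace ℝ (Fin m)}

theorem CoordChange.smooth_apply (hψ : CoordChange V U ψ) (a : Fin m) :
    ContDiffOn ℝ ∞ (fun v => ψ v a) V := (contDiffOn_euclidean.1 hψ.smooth) a

theorem CoordChange.smooth_jac (hψ : CoordChange V U ψ) : MSmooth V (jac ψ) := fun a i =>
  smooth_pd hψ.isOpen (hψ.smooth_apply a) i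

theorem CoordChange.smooth_comp (hψ : CoordChange V U ψ) {f : EuclideanSpace ℝ (Fin m) → ℝ}
    (hf : ContDiffOn ℝ ∞ f U) : ContDiffOn ℝ ∞ (fun v => f (ψ v)) V :=
  hf.comp hψ.smooth hψ.mapsTo

theorem CoordChange.jsmooth_comp (hψ : CoordChange V U ψ)
    {f : ℝ → EuclideanSpace ℝ (Fin m) → ℝ} (hf : JSmooth U I f) :
    JSmooth V I (fun t v => f t (ψ v)) :=
  ContDiffOn.comp (g := fun p : EuclideanSpace ℝ (Fin m) × ℝ => f p.2 p.1) hf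
    ((hψ.smooth.comp contDiffOn_fst fun _ hp => hp.1).prodMk contDiffOn_snd)
    fun _ hp => ⟨hψ.mapsTo hp.1, hp.2⟩

theorem CoordChange.msmooth_comp (hψ : CoordChange V U ψ) {ι κ : Type*}
    {A : EuclideanSpace ℝ (Fin m) → Matrix ι κ ℝ}
    (hA : MSmooth U A) : MSmooth V (fun v => A (ψ v)) := fun a b => hψ.smooth_comp (hA a b)

theorem CoordChange.differentiableAt (hψ : CoordChange V U ψ) (hv : v ∈ V) :
    DifferentiableAt ℝ ψ v :=
  (hψ.smooth.contDiffAt (hψ.isOpen.mem_nhds hv)).differentiableAt (by simp)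

theorem jac_apply (hψ : DifferentiableAt ℝ ψ v) (a i : Fin m) :
    jac ψ v a i = fderiv ℝ ψ v (EuclideanSpace.single i 1) a := by
  have h1 : HasFDerivAt (fun w => ψ w a) ((EuclideanSpace.proj a).comp (fderiv ℝ ψ v)) v :=
    (EuclideanSpace.proj (𝕜 := ℝ) a).hasFDerivAt.comp v hψ.hasFDerivAt
  simp only [jac, Matrix.of_apply, pd]
  rw [h1.fderiv]
  rfl

theorem CoordChange.pd_comp (hψ : CoordChange V U ψ) (hU : IsOpen U) (hv : v ∈ V)
    {f : EuclideanSpace ℝ (Fin m) → ℝ} (hf : ContDiffOn ℝ ∞ f U) (i : Fin m) :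
    pd i (fun v => f (ψ v)) v = ∑ a, jac ψ v a i * pd a f (ψ v) := by
  have h1 := (differentiableAt_of_smooth hU hf (hψ.mapsTo hv)).hasFDerivAt.comp v
    (hψ.differentiableAt hv).hasFDerivAt
  have h2 : pd i (fun v => f (ψ v)) v
      = fderiv ℝ f (ψ v) (fderiv ℝ ψ v (EuclideanSpace.single i 1)) := by
    have h3 : HasFDerivAt (fun v => f (ψ v)) _ v := h1
    simp only [pd]
    rw [h3.fderiv]; rfl
  rw [h2, fderiv_eq_sum_pd]
  simp only [jac_apply (hψ.differentiableAt hv)]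

theorem CoordChange.mpd_comp (hψ : CoordChange V U ψ) (hU : IsOpen U) (hv : v ∈ V)
    {ι κ : Type*} {A : EuclideanSpace ℝ (Fin m) → Matrix ι κ ℝ} (hA : MSmooth U A) (i : Fin m) :
    mpd i (fun v => A (ψ v)) v = ∑ a, jac ψ v a i • mpd a A (ψ v) := by
  ext a b
  simp only [Matrix.sum_apply, Matrix.smul_apply, mpd_apply, smul_eq_mul]
  exact hψ.pd_comp hU hv (hA a b) i

theorem CoordChange.mpd_jac_symm (hψ : CoordChange V U ψ) (hv : v ∈ V) (i j a : Fin m) :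
    mpd i (jac ψ) v a j = mpd j (jac ψ) v a i :=
  pd_comm hψ.isOpen (hψ.smooth_apply a) hv i j

theorem CoordChange.mul_inv (hψ : CoordChange V U ψ) (hv : v ∈ V) :
    jac ψ v * (jac ψ v)⁻¹ = 1 := Matrix.mul_nonsing_inv _ (hψ.det_ne v hv).isUnit

theorem CoordChange.inv_mul (hψ : CoordChange V U ψ) (hv : v ∈ V) :
    (jac ψ v)⁻¹ * jac ψ v = 1 := Matrix.nonsing_inv_mul _ (hψ.det_ne v hv).isUnit

/-- The pullback of a metric. -/
noncomputable def pullMetric (ψ : EuclideanSpace ℝ (Fin m) → EuclideanSpace ℝ (Fin m))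
    (G' : EuclideanSpace ℝ (Fin m) → Matrix (Fin m) (Fin m) ℝ)
    (v : EuclideanSpace ℝ (Fin m)) : Matrix (Fin m) (Fin m) ℝ :=
  (jac ψ v).transpose * G' (ψ v) * jac ψ v

theorem CoordChange.metricOn (hψ : CoordChange V U ψ) (h : MetricOn U G')
    (hG : ∀ v ∈ V, G v = pullMetric ψ G' v) : MetricOn V G where
  isOpen := hψ.isOpen
  smooth i j := ((hψ.smooth_jac.transpose.mul (hψ.msmooth_comp h.smooth)).mul
    hψ.smooth_jac i j).congr fun v hv => by rw [hG v hv]; rfl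
  posDef v hv := by
    rw [hG v hv, pullMetric, ← Matrix.conjTranspose_eq_transpose_of_trivial]
    exact (h.posDef _ (hψ.mapsTo hv)).conjTranspose_mul_mul_same
      (Matrix.mulVec_injective_of_isUnit
        ((Matrix.isUnit_iff_isUnit_det _).2 (hψ.det_ne v hv).isUnit))

theorem CoordChange.metricFamily {G G' : ℝ → EuclideanSpace ℝ (Fin m) → Matrix (Fin m) (Fin m) ℝ}
    (hψ : CoordChange V U ψ) (h : MetricFamily U I G')
    (hG : ∀ t ∈ I, ∀ v ∈ V, G t v = pullMetric ψ (G' t) v) : MetricFamily V I G where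
  isOpen := hψ.isOpen
  uniq := h.uniq
  smooth i j := by
    have hJ : MSmooth (V ×ˢ I) (fun p : EuclideanSpace ℝ (Fin m) × ℝ => jac ψ p.1) :=
      fun a b => (hψ.smooth_jac a b).comp contDiffOn_fst fun p hp => hp.1
    have hG' : MSmooth (V ×ˢ I) (fun p : EuclideanSpace ℝ (Fin m) × ℝ => G' p.2 (ψ p.1)) :=
      fun a b => hψ.jsmooth_comp (h.smooth a b)
    exact ((hJ.transpose.mul hG').mul hJ i j).congr fun p hp =>
      congrFun (congrFun (hG _ hp.2 _ hp.1) i) j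
  posDef t ht := (hψ.metricOn (h.slice ht) (hG t ht)).posDef

/-- The pullback of the connection matrices. -/
noncomputable def pullChr (ψ : EuclideanSpace ℝ (Fin m) → EuclideanSpace ℝ (Fin m))
    (G' : EuclideanSpace ℝ (Fin m) → Matrix (Fin m) (Fin m) ℝ) (i : Fin m)
    (v : EuclideanSpace ℝ (Fin m)) : Matrix (Fin m) (Fin m) ℝ :=
  ∑ a, jac ψ v a i • chr G' a (ψ v)

theorem MetricOn.smooth_chr (h : MetricOn U G) (i : Fin m) : MSmooth U (chr G i) := fun k j =>
  (h.family.smooth_christoffel k i j).slice (mem_univ 0)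

theorem CoordChange.smooth_pullChr (hψ : CoordChange V U ψ) (h : MetricOn U G') (i : Fin m) :
    MSmooth V (pullChr ψ G' i) := fun k j => by
  simp only [pullChr, Matrix.sum_apply, Matrix.smul_apply, smul_eq_mul]
  exact ContDiffOn.sum fun a _ => (hψ.smooth_jac a i).mul (hψ.smooth_comp (h.smooth_chr a k j))

/-- The transformation law of the Christoffel symbols. -/
theorem CoordChange.jac_mul_chr (hψ : CoordChange V U ψ) (h : MetricOn U G')
    (hG : ∀ v ∈ V, G v = pullMetric ψ G' v) (hv : v ∈ V) (i : Fin m) :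
    jac ψ v * chr G i v = pullChr ψ G' i v * jac ψ v + mpd i (jac ψ) v := by
  set J := jac ψ v with hJ
  have hJJ : J * J⁻¹ = 1 := hψ.mul_inv hv
  have hGon := hψ.metricOn h hG
  -- `J⁻¹ * D i` is the expected connection. By uniqueness it suffices that it is symmetric in its
  -- lower indices and compatible with the pulled-back metric.
  let D : Fin m → Matrix (Fin m) (Fin m) ℝ := fun i => pullChr ψ G' i v * J + mpd i (jac ψ) v
  have hJB : ∀ i, J * (J⁻¹ * D i) = D i := fun i => by rw [← Matrix.mul_assoc, hJJ, Matrix.one_mul]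
  have hDs : ∀ a i j, D i a j = D j a i := by
    intro a i j
    simp only [D, Matrix.add_apply]
    rw [hψ.mpd_jac_symm hv i j a]
    congr 1
    simp only [pullChr, Matrix.sum_apply, Matrix.smul_apply,
      smul_eq_mul, Matrix.mul_apply, Finset.sum_mul]
    rw [Finset.sum_comm]
    refine Finset.sum_congr rfl fun b _ => Finset.sum_congr rfl fun c _ => ?_
    rw [h.chr_symm (hψ.mapsTo hv) a c b, ← hJ]; ring
  rw [hGon.chr_unique hv (fun i => J⁻¹ * D i) ?_ ?_ i]
  · exact hJB i
  · intro k i j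
    simp only [Matrix.mul_apply, hDs _ i j]
  · intro k
    have hGv : G v = J.transpose * G' (ψ v) * J := hG v hv
    have hsym := h.symm (hψ.mapsTo hv)
    have h1 : G v * (J⁻¹ * D k) = J.transpose * G' (ψ v) * D k := by
      rw [hGv, Matrix.mul_assoc, hJB]
    have h2 : (J⁻¹ * D k).transpose * G v = (D k).transpose * G' (ψ v) * J := by
      have : (G v * (J⁻¹ * D k)).transpose = (J⁻¹ * D k).transpose * G v := by
        rw [Matrix.transpose_mul, hGon.symm hv]
      rw [← this, h1, Matrix.transpose_mul, Matrix.transpose_mul, hsym, Matrix.transpose_transpose,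
        Matrix.mul_assoc]
    rw [h1, h2, mpd_congr k hψ.isOpen hv hG]
    have hGs := hψ.msmooth_comp h.smooth
    have hJs := hψ.smooth_jac
    have e1 : mpd k (pullMetric ψ G') v = (mpd k (jac ψ) v).transpose * G' (ψ v) * J
        + J.transpose * (mpd k (fun v => G' (ψ v)) v) * J
        + J.transpose * G' (ψ v) * mpd k (jac ψ) v := by
      change mpd k (fun v => (jac ψ v).transpose * G' (ψ v) * jac ψ v) v = _
      rw [mpd_mul k hψ.isOpen hv (hJs.transpose.mul hGs) hJs,
        mpd_mul k hψ.isOpen hv hJs.transpose hGs, mpd_transpose, Matrix.add_mul]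
    have e2 : mpd k (fun v => G' (ψ v)) v
        = (pullChr ψ G' k v).transpose * G' (ψ v) + G' (ψ v) * pullChr ψ G' k v := by
      rw [hψ.mpd_comp h.isOpen hv h.smooth]
      simp only [h.compat (hψ.mapsTo hv), pullChr, Matrix.transpose_sum, Matrix.sum_mul,
        Matrix.mul_sum, Matrix.transpose_smul, Matrix.smul_mul, Matrix.mul_smul, smul_add,
        Finset.sum_add_distrib]
    rw [e1, e2]
    simp only [D, Matrix.transpose_add, Matrix.transpose_mul]
    noncomm_ring

/-- The transformation law of the curvature. -/
theorem CoordChange.jac_mul_curv (hψ : CoordChange V U ψ) (h : MetricOn U G')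
    (hG : ∀ v ∈ V, G v = pullMetric ψ G' v) (hv : v ∈ V) (i j : Fin m) :
    jac ψ v * curv G i j v
      = (∑ a, ∑ b, (jac ψ v a i * jac ψ v b j) • curv G' a b (ψ v)) * jac ψ v := by
  have hGon := hψ.metricOn h hG
  have hg := fun i => hψ.jac_mul_chr h hG hv i
  have hJs := hψ.smooth_jac
  have hA := hψ.smooth_pullChr h
  -- The derivative of the transformation law of Γ. The second derivatives of the Jacobian that it
  -- produces are symmetric in `i` and `j`, so they cancel in the commutator that defines the
  -- curvature.
  have hd : ∀ i j, mpd j (jac ψ) v * chr G i v + jac ψ v * mpd j (chr G i) v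
      = mpd j (pullChr ψ G' i) v * jac ψ v + pullChr ψ G' i v * mpd j (jac ψ) v
        + mpd j (fun v => mpd i (jac ψ) v) v := by
    intro i j
    rw [← mpd_mul j hψ.isOpen hv hJs (hGon.smooth_chr i),
      ← mpd_mul j hψ.isOpen hv (hA i) hJs,
      ← mpd_add j hψ.isOpen hv ((hA i).mul hJs) (hJs.mpd i hψ.isOpen)]
    exact mpd_congr j hψ.isOpen hv fun w hw => hψ.jac_mul_chr h hG hw i
  have hdA : ∀ i j, mpd j (pullChr ψ G' i) v = ∑ a, mpd j (jac ψ) v a i • chr G' a (ψ v)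
      + ∑ a, ∑ b, (jac ψ v a i * jac ψ v b j) • mpd b (chr G' a) (ψ v) := by
    intro i j
    have : ∀ a, mpd j (fun v => jac ψ v a i • chr G' a (ψ v)) v
        = mpd j (jac ψ) v a i • chr G' a (ψ v)
          + ∑ b, (jac ψ v a i * jac ψ v b j) • mpd b (chr G' a) (ψ v) := by
      intro a
      ext k l
      have e1 := congrFun (congrFun (hψ.mpd_comp h.isOpen hv (h.smooth_chr a) j) k) l
      simp only [mpd_apply, Matrix.smul_apply, smul_eq_mul, Matrix.add_apply,
        Matrix.sum_apply] at e1 ⊢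
      rw [pd_mul j (differentiableAt_of_smooth hψ.isOpen (hJs a i) hv)
        (differentiableAt_of_smooth hψ.isOpen (hψ.smooth_comp (h.smooth_chr a k l)) hv), e1,
        Finset.mul_sum]
      simp only [mul_assoc]
    rw [← Finset.sum_add_distrib, ← Finset.sum_congr rfl fun a _ => this a]
    ext k l
    simp only [mpd_apply, pullChr, Matrix.sum_apply]
    exact pd_sum j _ fun a _ => differentiableAt_of_smooth hψ.isOpen
      ((hJs a i).mul (hψ.smooth_comp (h.smooth_chr a k l))) hv
  -- Curvature commutes with pulling back the connection: the terms in which a derivative falls on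
  -- the Jacobian cancel because second derivatives of `ψ` are symmetric.
  have hF : ∑ a, ∑ b, (jac ψ v a i * jac ψ v b j) • curv G' a b (ψ v)
      = mpd i (pullChr ψ G' j) v - mpd j (pullChr ψ G' i) v
        + (pullChr ψ G' i v * pullChr ψ G' j v - pullChr ψ G' j v * pullChr ψ G' i v) := by
    have e1 : ∑ a, mpd i (jac ψ) v a j • chr G' a (ψ v)
        = ∑ a, mpd j (jac ψ) v a i • chr G' a (ψ v) :=
      Finset.sum_congr rfl fun a _ => by rw [hψ.mpd_jac_symm hv]
    have e2 : ∑ a, ∑ b, (jac ψ v a j * jac ψ v b i) • mpd b (chr G' a) (ψ v)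
        = ∑ a, ∑ b, (jac ψ v a i * jac ψ v b j) • mpd a (chr G' b) (ψ v) := by
      rw [Finset.sum_comm]
      simp only [mul_comm]
    have e3 : ∀ i j, pullChr ψ G' i v * pullChr ψ G' j v
        = ∑ a, ∑ b, (jac ψ v a i * jac ψ v b j) • (chr G' a (ψ v) * chr G' b (ψ v)) := by
      intro i j
      simp only [pullChr, Matrix.sum_mul, Matrix.mul_sum, Matrix.smul_mul, Matrix.mul_smul,
        Finset.smul_sum, smul_smul]
      rw [Finset.sum_comm]
      simp only [mul_comm]
    have e4 : pullChr ψ G' j v * pullChr ψ G' i v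
        = ∑ a, ∑ b, (jac ψ v a i * jac ψ v b j) • (chr G' b (ψ v) * chr G' a (ψ v)) := by
      rw [e3, Finset.sum_comm]
      simp only [mul_comm]
    rw [hdA, hdA, e1, e2, e3 i j, e4]
    simp only [curv_eq, smul_add, smul_sub, Finset.sum_add_distrib, Finset.sum_sub_distrib]
    abel
  have hc := mpd_comm i hψ.isOpen hv hJs j
  rw [hF, curv_eq]
  have a1 := hd j i
  have a2 := hd i j
  have b1 : jac ψ v * mpd i (chr G j) v = mpd i (pullChr ψ G' j) v * jac ψ v
      + pullChr ψ G' j v * mpd i (jac ψ) v + mpd i (fun v => mpd j (jac ψ) v) v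
      - mpd i (jac ψ) v * chr G j v := by rw [← a1]; abel
  have b2 : jac ψ v * mpd j (chr G i) v = mpd j (pullChr ψ G' i) v * jac ψ v
      + pullChr ψ G' i v * mpd j (jac ψ) v + mpd j (fun v => mpd i (jac ψ) v) v
      - mpd j (jac ψ) v * chr G i v := by rw [← a2]; abel
  have c1 : ∀ i j, jac ψ v * (chr G i v * chr G j v) = pullChr ψ G' i v * (pullChr ψ G' j v * jac ψ v)
      + pullChr ψ G' i v * mpd j (jac ψ) v + mpd i (jac ψ) v * chr G j v := by
    intro i j
    rw [← Matrix.mul_assoc, hg i, Matrix.add_mul, Matrix.mul_assoc, hg j, Matrix.mul_add]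
  rw [Matrix.mul_add, Matrix.mul_sub, Matrix.mul_sub, b1, b2, c1, c1, hc]
  noncomm_ring

end Pullback

/-! ### Transformation of tensors and invariance of scalars -/

section Tensors

variable {m : ℕ}

/-- The covector-covector pullback `Jᵀ A J`. -/
noncomputable def pull2 {ι : Type*} [Fintype ι] (J A : Matrix ι ι ℝ) : Matrix ι ι ℝ :=
  J.transpose * A * J

/-- The pullback of a covariant four-tensor. -/
noncomputable def pull4 (J : Matrix (Fin m) (Fin m) ℝ) (A : Fin m → Fin m → Fin m → Fin m → ℝ)
    (i j k l : Fin m) : ℝ :=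
  ∑ a, ∑ b, ∑ c, ∑ d, J a i * J b j * J c k * J d l * A a b c d

/-- The quadratic form `tr (H A Hᵀ Aᵀ)`. -/
noncomputable def quadForm {ι : Type*} [Fintype ι] (H A : Matrix ι ι ℝ) : ℝ :=
  (H * A * H.transpose * A.transpose).trace

/-- A four-tensor as a matrix indexed by pairs. -/
def pairMatrix (A : Fin m → Fin m → Fin m → Fin m → ℝ) :
    Matrix (Fin m × Fin m) (Fin m × Fin m) ℝ :=
  Matrix.of fun p q => A p.1 p.2 q.1 q.2

theorem pull2_apply {ι : Type*} [Fintype ι] (J A : Matrix ι ι ℝ) (i j : ι) :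
    pull2 J A i j = ∑ a, ∑ b, J a i * J b j * A a b := by
  simp only [pull2, Matrix.mul_apply, Matrix.transpose_apply, Finset.sum_mul]
  rw [Finset.sum_comm]
  exact Finset.sum_congr rfl fun _ _ => Finset.sum_congr rfl fun _ _ => by ring

theorem pull4_add (J : Matrix (Fin m) (Fin m) ℝ) (A B : Fin m → Fin m → Fin m → Fin m → ℝ)
    (i j k l : Fin m) : pull4 J (fun i j k l => A i j k l + B i j k l) i j k l
      = pull4 J A i j k l + pull4 J B i j k l := by
  simp only [pull4, mul_add, Finset.sum_add_distrib]

theorem pull4_sub (J : Matrix (Fin m) (Fin m) ℝ) (A B : Fin m → Fin m → Fin m → Fin m → ℝ)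
    (i j k l : Fin m) : pull4 J (fun i j k l => A i j k l - B i j k l) i j k l
      = pull4 J A i j k l - pull4 J B i j k l := by
  simp only [pull4, mul_sub, Finset.sum_sub_distrib]

theorem pull4_smul (J : Matrix (Fin m) (Fin m) ℝ) (c : ℝ) (A : Fin m → Fin m → Fin m → Fin m → ℝ)
    (i j k l : Fin m) : pull4 J (fun i j k l => c * A i j k l) i j k l
      = c * pull4 J A i j k l := by
  simp only [pull4, Finset.mul_sum]
  exact Finset.sum_congr rfl fun _ _ => Finset.sum_congr rfl fun _ _ =>
    Finset.sum_congr rfl fun _ _ => Finset.sum_congr rfl fun _ _ => by ring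

theorem pull4_outer (J A B : Matrix (Fin m) (Fin m) ℝ) (i j k l : Fin m) :
    pull4 J (fun i j k l => A i l * B j k) i j k l = pull2 J A i l * pull2 J B j k := by
  rw [mul_comm (pull2 J A _ _)]
  simp only [pull2_apply, pull4, Finset.sum_mul, Finset.mul_sum]
  refine Finset.sum_congr rfl fun a _ => ?_
  rw [Finset.sum_congr rfl fun b _ => Finset.sum_comm, Finset.sum_comm]
  exact Finset.sum_congr rfl fun _ _ => Finset.sum_congr rfl fun _ _ =>
    Finset.sum_congr rfl fun _ _ => by ring

theorem pull4_inter (J A B : Matrix (Fin m) (Fin m) ℝ) (i j k l : Fin m) :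
    pull4 J (fun i j k l => A i k * B j l) i j k l = pull2 J A i k * pull2 J B j l := by
  rw [mul_comm (pull2 J A _ _)]
  simp only [pull2_apply, pull4, Finset.sum_mul, Finset.mul_sum]
  refine Finset.sum_congr rfl fun a _ => ?_
  rw [Finset.sum_comm]
  exact Finset.sum_congr rfl fun _ _ => Finset.sum_congr rfl fun _ _ =>
    Finset.sum_congr rfl fun _ _ => by ring

/-- Grouping the indices in pairs turns the pullback of a four-tensor into a congruence by the
Kronecker square of the Jacobian, so one invariance argument covers both norms. -/
theorem pairMatrix_pull4 (J : Matrix (Fin m) (Fin m) ℝ)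
    (A : Fin m → Fin m → Fin m → Fin m → ℝ) :
    pairMatrix (pull4 J A) = pull2 (Matrix.kroneckerMap (· * ·) J J) (pairMatrix A) := by
  ext ⟨i, j⟩ ⟨k, l⟩
  simp only [pairMatrix, pull2_apply, pull4, Matrix.of_apply, Matrix.kroneckerMap_apply,
    Fintype.sum_prod_type]
  exact Finset.sum_congr rfl fun _ _ => Finset.sum_congr rfl fun _ _ =>
    Finset.sum_congr rfl fun _ _ => Finset.sum_congr rfl fun _ _ => by ring

theorem quadForm_apply {ι : Type*} [Fintype ι] (H A : Matrix ι ι ℝ) :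
    quadForm H A = ∑ i, ∑ j, ∑ k, ∑ l, H i k * H j l * A i j * A k l := by
  simp only [quadForm, Matrix.trace, Matrix.diag_apply, Matrix.mul_apply, Matrix.transpose_apply,
    Finset.sum_mul]
  refine Finset.sum_congr rfl fun i _ => Finset.sum_congr rfl fun j _ => ?_
  rw [Finset.sum_comm]
  exact Finset.sum_congr rfl fun k _ => Finset.sum_congr rfl fun l _ => by ring

/-- Cyclicity of the trace carries the outer factors of the congruence around until each copy of `H`
is enclosed by `J` and its transpose. -/
theorem quadForm_pull2 {ι : Type*} [Fintype ι] [DecidableEq ι] {J A H H' : Matrix ι ι ℝ}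
    (hJ : J * H * J.transpose = H') : quadForm H (pull2 J A) = quadForm H' A := by
  subst hJ
  simp only [quadForm, pull2, Matrix.transpose_mul, Matrix.transpose_transpose]
  rw [Matrix.trace_mul_cycle]
  simp only [Matrix.mul_assoc]
  rw [Matrix.trace_mul_comm]
  simp only [Matrix.mul_assoc]
  rw [Matrix.trace_mul_comm]
  simp only [Matrix.mul_assoc]

theorem norm2_eq (G : EuclideanSpace ℝ (Fin m) → Matrix (Fin m) (Fin m) ℝ)
    (u : EuclideanSpace ℝ (Fin m)) (A : Fin m → Fin m → ℝ) :
    norm2 G u A = Real.sqrt (quadForm (G u)⁻¹ (Matrix.of A)) := by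
  rw [quadForm_apply]; rfl

theorem norm4_eq (G : EuclideanSpace ℝ (Fin m) → Matrix (Fin m) (Fin m) ℝ)
    (u : EuclideanSpace ℝ (Fin m)) (A : Fin m → Fin m → Fin m → Fin m → ℝ) :
    norm4 G u A = Real.sqrt (quadForm (Matrix.kroneckerMap (· * ·) (G u)⁻¹ (G u)⁻¹)
      (pairMatrix A)) := by
  rw [quadForm_apply, norm4]
  congr 1
  simp only [Fintype.sum_prod_type, Matrix.kroneckerMap_apply, pairMatrix, Matrix.of_apply]
  refine Finset.sum_congr rfl fun i _ => Finset.sum_congr rfl fun j _ =>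
    Finset.sum_congr rfl fun k _ => Finset.sum_congr rfl fun l _ =>
    Finset.sum_congr rfl fun p _ => Finset.sum_congr rfl fun q _ =>
    Finset.sum_congr rfl fun r _ => Finset.sum_congr rfl fun s _ => by ring

theorem trace2_eq (G : EuclideanSpace ℝ (Fin m) → Matrix (Fin m) (Fin m) ℝ)
    (u : EuclideanSpace ℝ (Fin m)) (A : Fin m → Fin m → ℝ) :
    trace2 G u A = ((G u)⁻¹ * (Matrix.of A).transpose).trace := by
  simp [trace2, Matrix.trace, Matrix.mul_apply]

variable {U V : Set (EuclideanSpace ℝ (Fin m))}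
  {ψ : EuclideanSpace ℝ (Fin m) → EuclideanSpace ℝ (Fin m)}
  {G G' : EuclideanSpace ℝ (Fin m) → Matrix (Fin m) (Fin m) ℝ}
  {F F' : EuclideanSpace ℝ (Fin m) → ℝ} {v : EuclideanSpace ℝ (Fin m)}

theorem CoordChange.jac_mul_inv_mul (hψ : CoordChange V U ψ)
    (hG : ∀ v ∈ V, G v = pullMetric ψ G' v) (hv : v ∈ V) :
    jac ψ v * (G v)⁻¹ * (jac ψ v).transpose = (G' (ψ v))⁻¹ := by
  have hu : IsUnit (jac ψ v).det := (hψ.det_ne v hv).isUnit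
  have hu' : IsUnit (jac ψ v).transpose.det := by rwa [Matrix.det_transpose]
  rw [hG v hv, pullMetric, Matrix.mul_inv_rev, Matrix.mul_inv_rev, ← Matrix.mul_assoc,
    Matrix.mul_nonsing_inv _ hu, Matrix.one_mul, Matrix.mul_assoc, Matrix.nonsing_inv_mul _ hu',
    Matrix.mul_one]

theorem CoordChange.trace2_eq (hψ : CoordChange V U ψ)
    (hG : ∀ v ∈ V, G v = pullMetric ψ G' v) (hv : v ∈ V) {A A' : Fin m → Fin m → ℝ}
    (hA : Matrix.of A = pull2 (jac ψ v) (Matrix.of A')) :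
    trace2 G v A = trace2 G' (ψ v) A' := by
  rw [RicciHarmonic.trace2_eq, RicciHarmonic.trace2_eq, hA, ← hψ.jac_mul_inv_mul hG hv, pull2,
    Matrix.transpose_mul, Matrix.transpose_mul, Matrix.transpose_transpose, ← Matrix.mul_assoc,
    ← Matrix.mul_assoc, Matrix.trace_mul_comm]
  simp only [Matrix.mul_assoc]

theorem CoordChange.norm2_eq (hψ : CoordChange V U ψ)
    (hG : ∀ v ∈ V, G v = pullMetric ψ G' v) (hv : v ∈ V) {A A' : Fin m → Fin m → ℝ}
    (hA : Matrix.of A = pull2 (jac ψ v) (Matrix.of A')) :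
    norm2 G v A = norm2 G' (ψ v) A' := by
  rw [RicciHarmonic.norm2_eq, RicciHarmonic.norm2_eq, hA,
    quadForm_pull2 (hψ.jac_mul_inv_mul hG hv)]

theorem CoordChange.norm4_eq (hψ : CoordChange V U ψ)
    (hG : ∀ v ∈ V, G v = pullMetric ψ G' v) (hv : v ∈ V)
    {A A' : Fin m → Fin m → Fin m → Fin m → ℝ} (hA : A = pull4 (jac ψ v) A') :
    norm4 G v A = norm4 G' (ψ v) A' := by
  rw [RicciHarmonic.norm4_eq, RicciHarmonic.norm4_eq, hA, pairMatrix_pull4, quadForm_pull2]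
  rw [← hψ.jac_mul_inv_mul hG hv]
  simp only [Matrix.mul_kronecker_mul, Matrix.kroneckerMap_transpose]

/-- Each `M k` is an endomorphism with an extra covector index `k`. Contracting `k` with the upper
index cancels a Jacobian against its inverse and leaves a covector. Both the Ricci tensor and the
divergence are such contractions. -/
theorem CoordChange.contract (hψ : CoordChange V U ψ) (hv : v ∈ V)
    {M N : Fin m → Matrix (Fin m) (Fin m) ℝ}
    (hM : ∀ k, jac ψ v * M k = (∑ b, jac ψ v b k • N b) * jac ψ v) (j : Fin m) :
    ∑ k, M k k j = ∑ d, (∑ b, N b b d) * jac ψ v d j := by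
  set J := jac ψ v with hJ
  have h1 : ∀ k, M k = ∑ b, J b k • (J⁻¹ * (N b * J)) := by
    intro k
    have : M k = J⁻¹ * (J * M k) := by
      rw [← Matrix.mul_assoc, hψ.inv_mul hv, Matrix.one_mul]
    rw [this, hM k]
    simp only [Matrix.sum_mul, Matrix.mul_sum, Matrix.smul_mul, Matrix.mul_smul]
  have h2 : ∀ b, ∑ k, J b k * (J⁻¹ * (N b * J)) k j = (N b * J) b j := by
    intro b
    rw [← Matrix.mul_apply, ← Matrix.mul_assoc, hψ.mul_inv hv, Matrix.one_mul]
  calc ∑ k, M k k j = ∑ k, ∑ b, J b k * (J⁻¹ * (N b * J)) k j := by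
        refine Finset.sum_congr rfl fun k _ => ?_
        rw [h1 k]; simp only [Matrix.sum_apply, Matrix.smul_apply, smul_eq_mul]
    _ = ∑ b, (N b * J) b j := by rw [Finset.sum_comm]; exact Finset.sum_congr rfl fun b _ => h2 b
    _ = _ := by
        simp only [Matrix.mul_apply, Finset.sum_mul]
        rw [Finset.sum_comm]

theorem CoordChange.ricci_eq (hψ : CoordChange V U ψ) (h : MetricOn U G')
    (hG : ∀ v ∈ V, G v = pullMetric ψ G' v) (hv : v ∈ V) :
    Matrix.of (ricci G v) = pull2 (jac ψ v) (Matrix.of (ricci G' (ψ v))) := by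
  ext i j
  rw [Matrix.of_apply, (hψ.metricOn h hG).ricci_eq hv, hψ.contract hv (M := fun k => curv G k i v)
    (N := fun a => ∑ b, jac ψ v b i • curv G' a b (ψ v)), pull2_apply, Finset.sum_comm]
  · refine Finset.sum_congr rfl fun d _ => ?_
    rw [Finset.sum_mul]
    simp only [Matrix.of_apply, h.ricci_eq (hψ.mapsTo hv), Matrix.sum_apply, Matrix.smul_apply,
      smul_eq_mul, Finset.sum_mul, Finset.mul_sum]
    rw [Finset.sum_comm]
    exact Finset.sum_congr rfl fun _ _ => Finset.sum_congr rfl fun _ _ => by ring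
  · intro k
    rw [hψ.jac_mul_curv h hG hv]
    simp only [Finset.smul_sum, smul_smul]

theorem CoordChange.riem_eq (hψ : CoordChange V U ψ) (h : MetricOn U G')
    (hG : ∀ v ∈ V, G v = pullMetric ψ G' v) (hv : v ∈ V) :
    riem G v = pull4 (jac ψ v) (riem G' (ψ v)) := by
  funext i j k l
  rw [RicciHarmonic.riem_eq]
  have e : G v * curv G i j v = ∑ a, ∑ b, (jac ψ v a i * jac ψ v b j) •
      pull2 (jac ψ v) (G' (ψ v) * curv G' a b (ψ v)) := by
    rw [hG v hv, pullMetric, Matrix.mul_assoc, hψ.jac_mul_curv h hG hv]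
    simp only [pull2, Matrix.sum_mul, Matrix.mul_sum, Matrix.smul_mul, Matrix.mul_smul,
      Matrix.mul_assoc]
  rw [e]
  simp only [pull4, Matrix.sum_apply, Matrix.smul_apply, smul_eq_mul, pull2_apply,
    RicciHarmonic.riem_eq, Finset.mul_sum]
  refine Finset.sum_congr rfl fun a _ => Finset.sum_congr rfl fun b _ => ?_
  rw [Finset.sum_comm]
  exact Finset.sum_congr rfl fun _ _ => Finset.sum_congr rfl fun _ _ => by ring

theorem CoordChange.scal_eq (hψ : CoordChange V U ψ) (h : MetricOn U G')
    (hG : ∀ v ∈ V, G v = pullMetric ψ G' v) (hv : v ∈ V) : scal G v = scal G' (ψ v) :=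
  hψ.trace2_eq hG hv (hψ.ricci_eq h hG hv)

theorem CoordChange.weyl_eq (hψ : CoordChange V U ψ) (h : MetricOn U G')
    (hG : ∀ v ∈ V, G v = pullMetric ψ G' v) (hv : v ∈ V) :
    weyl G v = pull4 (jac ψ v) (weyl G' (ψ v)) := by
  funext i j k l
  have hr : ∀ i j, ricci G v i j = pull2 (jac ψ v) (Matrix.of (ricci G' (ψ v))) i j :=
    fun i j => congrFun (congrFun (hψ.ricci_eq h hG hv) i) j
  have hg : ∀ i j, G v i j = pull2 (jac ψ v) (G' (ψ v)) i j :=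
    fun i j => congrFun (congrFun (hG v hv) i) j
  have hw : weyl G' (ψ v) = fun i j k l => (riem G' (ψ v) i j k l
      - 1 / ((m : ℝ) - 2) * (Matrix.of (ricci G' (ψ v)) i l * G' (ψ v) j k
        + G' (ψ v) i l * Matrix.of (ricci G' (ψ v)) j k
        - Matrix.of (ricci G' (ψ v)) i k * G' (ψ v) j l
        - G' (ψ v) i k * Matrix.of (ricci G' (ψ v)) j l))
      + scal G' (ψ v) / (((m : ℝ) - 1) * ((m : ℝ) - 2)) * (G' (ψ v) i l * G' (ψ v) j k
        - G' (ψ v) i k * G' (ψ v) j l) := by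
    funext i j k l
    simp only [weyl, Matrix.of_apply]; ring
  rw [hw, pull4_add, pull4_sub, pull4_smul, pull4_smul, pull4_sub, pull4_sub, pull4_sub, pull4_add,
    pull4_outer, pull4_outer, pull4_outer, pull4_inter, pull4_inter, pull4_inter,
    ← hψ.riem_eq h hG hv, weyl, hψ.scal_eq h hG hv]
  simp only [hr, hg]
  ring

theorem CoordChange.pd_scalar (hψ : CoordChange V U ψ) (hU : IsOpen U)
    (hF' : ContDiffOn ℝ ∞ F' U) (hF : ∀ v ∈ V, F v = F' (ψ v)) (hv : v ∈ V) (i : Fin m) :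
    pd i F v = ∑ a, jac ψ v a i * pd a F' (ψ v) := by
  rw [pd_congr i hψ.isOpen hv hF, hψ.pd_comp hU hv hF']

theorem CoordChange.hess_eq (hψ : CoordChange V U ψ) (h : MetricOn U G')
    (hG : ∀ v ∈ V, G v = pullMetric ψ G' v) (hF' : ContDiffOn ℝ ∞ F' U)
    (hF : ∀ v ∈ V, F v = F' (ψ v)) (hv : v ∈ V) :
    Matrix.of (hess G F v) = pull2 (jac ψ v) (Matrix.of (hess G' F' (ψ v))) := by
  ext i j
  have hp := fun a => smooth_pd h.isOpen hF' a
  have e1 : pd i (fun w => pd j F w) v = ∑ a, (mpd i (jac ψ) v a j * pd a F' (ψ v)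
      + jac ψ v a j * ∑ b, jac ψ v b i * pd b (fun w => pd a F' w) (ψ v)) := by
    rw [pd_congr i hψ.isOpen hv fun w hw => hψ.pd_scalar h.isOpen hF' hF hw j,
      pd_sum i _ (f := fun a w => jac ψ w a j * pd a F' (ψ w)) fun a _ =>
      differentiableAt_of_smooth hψ.isOpen ((hψ.smooth_jac a j).mul (hψ.smooth_comp (hp a))) hv]
    refine Finset.sum_congr rfl fun a _ => ?_
    rw [pd_mul i (differentiableAt_of_smooth hψ.isOpen (hψ.smooth_jac a j) hv)
      (differentiableAt_of_smooth hψ.isOpen (hψ.smooth_comp (hp a)) hv),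
      hψ.pd_comp h.isOpen hv (hp a)]
    rfl
  have e2 : ∑ k, christoffel G v k i j * pd k F v
      = ∑ a, (jac ψ v * chr G i v) a j * pd a F' (ψ v) := by
    simp only [hψ.pd_scalar h.isOpen hF' hF hv, Matrix.mul_apply, chr, Matrix.of_apply,
      Finset.mul_sum, Finset.sum_mul]
    rw [Finset.sum_comm]
    exact Finset.sum_congr rfl fun _ _ => Finset.sum_congr rfl fun _ _ => by ring
  have e3 : ∑ a, (pullChr ψ G' i v * jac ψ v) a j * pd a F' (ψ v)
      = ∑ b, ∑ c, jac ψ v b i * jac ψ v c j * ∑ a, christoffel G' (ψ v) a b c * pd a F' (ψ v) := by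
    simp only [pullChr, Matrix.sum_apply, Matrix.smul_apply,
      smul_eq_mul, Matrix.mul_apply, chr, Matrix.of_apply, Finset.mul_sum, Finset.sum_mul]
    rw [Finset.sum_congr rfl fun a _ => Finset.sum_comm, Finset.sum_comm]
    refine Finset.sum_congr rfl fun b _ => ?_
    rw [Finset.sum_comm]
    exact Finset.sum_congr rfl fun _ _ => Finset.sum_congr rfl fun _ _ => by ring
  rw [Matrix.of_apply, hess, e1, e2, hψ.jac_mul_chr h hG hv]
  simp only [Matrix.add_apply, add_mul, Finset.sum_add_distrib]
  rw [e3, pull2_apply]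
  simp only [Matrix.of_apply, hess, mul_sub, Finset.sum_sub_distrib]
  have e4 : ∑ a, jac ψ v a j * ∑ b, jac ψ v b i * pd b (fun w => pd a F' w) (ψ v)
      = ∑ b, ∑ a, jac ψ v b i * jac ψ v a j * pd b (fun w => pd a F' w) (ψ v) := by
    simp only [Finset.mul_sum]
    rw [Finset.sum_comm]
    exact Finset.sum_congr rfl fun _ _ => Finset.sum_congr rfl fun _ _ => by ring
  rw [e4]; ring

theorem CoordChange.lap_eq (hψ : CoordChange V U ψ) (h : MetricOn U G')
    (hG : ∀ v ∈ V, G v = pullMetric ψ G' v) (hF' : ContDiffOn ℝ ∞ F' U)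
    (hF : ∀ v ∈ V, F v = F' (ψ v)) (hv : v ∈ V) : lap G F v = lap G' F' (ψ v) :=
  hψ.trace2_eq hG hv (hψ.hess_eq h hG hF' hF hv)

theorem CoordChange.grad_outer_eq (hψ : CoordChange V U ψ) (hU : IsOpen U)
    (hF' : ContDiffOn ℝ ∞ F' U) (hF : ∀ v ∈ V, F v = F' (ψ v)) (hv : v ∈ V) :
    (Matrix.of fun i j => pd i F v * pd j F v)
      = pull2 (jac ψ v) (Matrix.of fun i j => pd i F' (ψ v) * pd j F' (ψ v)) := by
  ext i j
  simp only [pull2_apply, Matrix.of_apply, hψ.pd_scalar hU hF' hF hv, Finset.sum_mul_sum]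
  exact Finset.sum_congr rfl fun _ _ => Finset.sum_congr rfl fun _ _ => by ring

theorem CoordChange.gradSq_eq (hψ : CoordChange V U ψ) (h : MetricOn U G')
    (hG : ∀ v ∈ V, G v = pullMetric ψ G' v) (hF' : ContDiffOn ℝ ∞ F' U)
    (hF : ∀ v ∈ V, F v = F' (ψ v)) (hv : v ∈ V) : gradSq G F v = gradSq G' F' (ψ v) :=
  hψ.trace2_eq hG hv (hψ.grad_outer_eq h.isOpen hF' hF hv)

theorem CoordChange.sic_eq (hψ : CoordChange V U ψ) (h : MetricOn U G')
    (hG : ∀ v ∈ V, G v = pullMetric ψ G' v) (hF' : ContDiffOn ℝ ∞ F' U)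
    (hF : ∀ v ∈ V, F v = F' (ψ v)) (hv : v ∈ V) (a : ℝ) :
    Matrix.of (sic G F a v) = pull2 (jac ψ v) (Matrix.of (sic G' F' a (ψ v))) := by
  have e : ∀ (G : EuclideanSpace ℝ (Fin m) → Matrix (Fin m) (Fin m) ℝ) F v,
      Matrix.of (sic G F a v)
        = Matrix.of (ricci G v) - a • Matrix.of fun i j => pd i F v * pd j F v := by
    intro G F v; ext i j; rfl
  rw [e, e, hψ.ricci_eq h hG hv, hψ.grad_outer_eq h.isOpen hF' hF hv]
  simp only [pull2, Matrix.mul_sub, Matrix.sub_mul, Matrix.mul_smul, Matrix.smul_mul]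

theorem CoordChange.sicTrace_eq (hψ : CoordChange V U ψ) (h : MetricOn U G')
    (hG : ∀ v ∈ V, G v = pullMetric ψ G' v) (hF' : ContDiffOn ℝ ∞ F' U)
    (hF : ∀ v ∈ V, F v = F' (ψ v)) (hv : v ∈ V) (a : ℝ) :
    sicTrace G F a v = sicTrace G' F' a (ψ v) :=
  hψ.trace2_eq hG hv (hψ.sic_eq h hG hF' hF hv a)

theorem CoordChange.sin_eq (hψ : CoordChange V U ψ) (h : MetricOn U G')
    (hG : ∀ v ∈ V, G v = pullMetric ψ G' v) (hF' : ContDiffOn ℝ ∞ F' U)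
    (hF : ∀ v ∈ V, F v = F' (ψ v)) (hv : v ∈ V) (a : ℝ) :
    Matrix.of (sin G F a v) = pull2 (jac ψ v) (Matrix.of (sin G' F' a (ψ v))) := by
  have e : ∀ (G : EuclideanSpace ℝ (Fin m) → Matrix (Fin m) (Fin m) ℝ) F v,
      Matrix.of (sin G F a v) = Matrix.of (sic G F a v) - (sicTrace G F a v / m) • G v := by
    intro G F v; ext i j; rfl
  rw [e, e, hψ.sic_eq h hG hF' hF hv, hψ.sicTrace_eq h hG hF' hF hv, hG v hv]
  simp only [pull2, pullMetric, Matrix.mul_sub, Matrix.sub_mul, Matrix.mul_smul, Matrix.smul_mul]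

/-- The covariant derivative of an endomorphism field. -/
noncomputable def nabla (G : EuclideanSpace ℝ (Fin m) → Matrix (Fin m) (Fin m) ℝ)
    (A : EuclideanSpace ℝ (Fin m) → Matrix (Fin m) (Fin m) ℝ) (k : Fin m)
    (u : EuclideanSpace ℝ (Fin m)) : Matrix (Fin m) (Fin m) ℝ :=
  mpd k A u + (chr G k u * A u - A u * chr G k u)

/-- The derivative of the Jacobian that appears when the law for `A` is differentiated cancels the
inhomogeneous part of the law for Γ. So ∇A is tensorial, and its contraction is a covector. -/
theorem CoordChange.div_eq (hψ : CoordChange V U ψ) (h : MetricOn U G')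
    (hG : ∀ v ∈ V, G v = pullMetric ψ G' v)
    {A A' : EuclideanSpace ℝ (Fin m) → Matrix (Fin m) (Fin m) ℝ} (hAs : MSmooth V A)
    (hAs' : MSmooth U A') (hA : ∀ v ∈ V, jac ψ v * A v = A' (ψ v) * jac ψ v) (hv : v ∈ V)
    (j : Fin m) : ∑ k, nabla G A k v k j = ∑ d, (∑ b, nabla G' A' b (ψ v) b d) * jac ψ v d j := by
  refine hψ.contract hv (M := fun k => nabla G A k v) (N := fun b => nabla G' A' b (ψ v))
    (fun k => ?_) j
  have hJs := hψ.smooth_jac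
  have e1 : mpd k (jac ψ) v * A v + jac ψ v * mpd k A v
      = (∑ b, jac ψ v b k • mpd b A' (ψ v)) * jac ψ v + A' (ψ v) * mpd k (jac ψ) v := by
    rw [← mpd_mul k hψ.isOpen hv hJs hAs, ← hψ.mpd_comp h.isOpen hv hAs',
      ← mpd_mul k hψ.isOpen hv (hψ.msmooth_comp hAs') hJs]
    exact mpd_congr k hψ.isOpen hv hA
  have e2 : jac ψ v * mpd k A v = (∑ b, jac ψ v b k • mpd b A' (ψ v)) * jac ψ v
      + A' (ψ v) * mpd k (jac ψ) v - mpd k (jac ψ) v * A v := by rw [← e1]; abel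
  have e3 : ∑ b, jac ψ v b k • nabla G' A' b (ψ v) = ∑ b, jac ψ v b k • mpd b A' (ψ v)
      + (pullChr ψ G' k v * A' (ψ v) - A' (ψ v) * pullChr ψ G' k v) := by
    simp only [nabla, pullChr, smul_add, smul_sub, Finset.sum_add_distrib, Finset.sum_sub_distrib,
      Matrix.sum_mul, Matrix.mul_sum, Matrix.smul_mul, Matrix.mul_smul]
  have e4 : jac ψ v * (chr G k v * A v)
      = pullChr ψ G' k v * (A' (ψ v) * jac ψ v) + mpd k (jac ψ) v * A v := by
    rw [← Matrix.mul_assoc, hψ.jac_mul_chr h hG hv, Matrix.add_mul, Matrix.mul_assoc, hA v hv]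
  have e5 : jac ψ v * (A v * chr G k v)
      = A' (ψ v) * (pullChr ψ G' k v * jac ψ v) + A' (ψ v) * mpd k (jac ψ) v := by
    rw [← Matrix.mul_assoc, hA v hv, Matrix.mul_assoc, hψ.jac_mul_chr h hG hv, Matrix.mul_add]
  rw [e3, nabla, Matrix.mul_add, Matrix.mul_sub, e2, e4, e5]
  noncomm_ring

end Tensors

/-! ### Normal coordinates -/

section Normal

variable {m : ℕ}

theorem pd_coord (i j : Fin m) (u : EuclideanSpace ℝ (Fin m)) :
    pd i (fun w : EuclideanSpace ℝ (Fin m) => w j) u = if j = i then 1 else 0 := by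
  have h : HasFDerivAt (fun w : EuclideanSpace ℝ (Fin m) => w j)
      (EuclideanSpace.proj (𝕜 := ℝ) j) u := (EuclideanSpace.proj (𝕜 := ℝ) j).hasFDerivAt
  simp only [pd, h.fderiv]
  simp

/-- A quadratic change of coordinates with prescribed value, differential and second derivative
at the origin. -/
noncomputable def quadMap (u : EuclideanSpace ℝ (Fin m)) (L : Matrix (Fin m) (Fin m) ℝ)
    (Q : Fin m → Matrix (Fin m) (Fin m) ℝ) (w : EuclideanSpace ℝ (Fin m)) :
    EuclideanSpace ℝ (Fin m) :=
  WithLp.toLp 2 fun a => u a + ∑ i, w i * (L a i + (1 / 2) * ∑ j, Q a i j * w j)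

theorem contDiff_coord (j : Fin m) :
    ContDiff ℝ ∞ (fun w : EuclideanSpace ℝ (Fin m) => w j) :=
  (EuclideanSpace.proj (𝕜 := ℝ) j).contDiff

theorem contDiff_quadMap (u : EuclideanSpace ℝ (Fin m)) (L : Matrix (Fin m) (Fin m) ℝ)
    (Q : Fin m → Matrix (Fin m) (Fin m) ℝ) : ContDiff ℝ ∞ (quadMap u L Q) := by
  rw [contDiff_euclidean]
  intro a
  exact contDiff_const.add (ContDiff.sum fun i _ => (contDiff_coord i).mul
    (contDiff_const.add (contDiff_const.mul (ContDiff.sum fun j _ =>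
      contDiff_const.mul (contDiff_coord j)))))

theorem quadMap_zero (u : EuclideanSpace ℝ (Fin m)) (L : Matrix (Fin m) (Fin m) ℝ)
    (Q : Fin m → Matrix (Fin m) (Fin m) ℝ) : quadMap u L Q 0 = u := by
  ext a; simp [quadMap]

theorem jac_quadMap (u : EuclideanSpace ℝ (Fin m)) (L : Matrix (Fin m) (Fin m) ℝ)
    {Q : Fin m → Matrix (Fin m) (Fin m) ℝ} (hQ : ∀ a i j, Q a i j = Q a j i)
    (w : EuclideanSpace ℝ (Fin m)) (a i : Fin m) :
    jac (quadMap u L Q) w a i = L a i + ∑ j, Q a i j * w j := by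
  have dc := fun j => (contDiff_coord (m := m) j).differentiable (by simp) w
  have d1 : ∀ i, DifferentiableAt ℝ (fun w : EuclideanSpace ℝ (Fin m) => ∑ j, Q a i j * w j) w :=
    fun i => DifferentiableAt.fun_sum fun j _ => (dc j).const_mul _
  have d2 : ∀ i, DifferentiableAt ℝ (fun w : EuclideanSpace ℝ (Fin m) =>
      L a i + (1 / 2) * ∑ j, Q a i j * w j) w := fun i =>
    (differentiableAt_const _).add ((d1 i).const_mul _)
  have e1 : ∀ k, pd i (fun w : EuclideanSpace ℝ (Fin m) => ∑ j, Q a k j * w j) w = Q a k i := by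
    intro k
    rw [pd_sum i _ (f := fun j w => Q a k j * w j) fun j _ => (dc j).const_mul _]
    simp only [pd_const_mul i _ (dc _), pd_coord]
    simp
  change pd i (fun w => u a + ∑ i, w i * (L a i + (1 / 2) * ∑ j, Q a i j * w j)) w = _
  rw [pd_add i (differentiableAt_const _) (DifferentiableAt.fun_sum fun k _ => (dc k).fun_mul (d2 k)),
    pd_const, pd_sum i _ (f := fun k w => w k * (L a k + (1 / 2) * ∑ j, Q a k j * w j))
      fun k _ => (dc k).fun_mul (d2 k)]
  have e2 : ∀ k, pd i (fun w => w k * (L a k + (1 / 2) * ∑ j, Q a k j * w j)) w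
      = (if k = i then 1 else 0) * (L a k + (1 / 2) * ∑ j, Q a k j * w j)
        + w k * ((1 / 2) * Q a k i) := by
    intro k
    rw [pd_mul i (dc k) (d2 k), pd_coord, pd_add i (differentiableAt_const _)
      ((d1 k).const_mul _), pd_const, pd_const_mul i _ (d1 k), e1]
    ring
  simp only [e2, Finset.sum_add_distrib]
  simp only [ite_mul, one_mul, zero_mul, Finset.sum_ite_eq', Finset.mem_univ, if_true, zero_add]
  rw [add_assoc, Finset.mul_sum, ← Finset.sum_add_distrib]
  congr 1
  refine Finset.sum_congr rfl fun k _ => ?_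
  rw [hQ a k i]; ring

/-- The coordinates are orthonormal at `p` and the Christoffel symbols vanish there. -/
structure NormalAt (G : EuclideanSpace ℝ (Fin m) → Matrix (Fin m) (Fin m) ℝ)
    (p : EuclideanSpace ℝ (Fin m)) : Prop where
  eq_one : G p = 1
  chr_eq : ∀ i, chr G i p = 0

variable {U V : Set (EuclideanSpace ℝ (Fin m))}
  {G : EuclideanSpace ℝ (Fin m) → Matrix (Fin m) (Fin m) ℝ}
  {F : EuclideanSpace ℝ (Fin m) → ℝ} {u p : EuclideanSpace ℝ (Fin m)}

-- Positivity in the C⋆-algebra of matrices supplies the factor; over ℝ its adjoint is the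
-- transpose.
open scoped MatrixOrder Matrix.Norms.L2Operator in
theorem exists_transpose_mul_self {A : Matrix (Fin m) (Fin m) ℝ} (hA : A.PosSemidef) :
    ∃ B : Matrix (Fin m) (Fin m) ℝ, A = B.transpose * B := by
  obtain ⟨B, hB⟩ := CStarAlgebra.nonneg_iff_eq_star_mul_self.mp hA.nonneg
  exact ⟨B, by rw [hB, Matrix.star_eq_conjTranspose,
    Matrix.conjTranspose_eq_transpose_of_trivial]⟩

theorem MetricOn.exists_normal (h : MetricOn U G) (hu : u ∈ U) :
    ∃ V ψ, CoordChange V U ψ ∧ (0 : EuclideanSpace ℝ (Fin m)) ∈ V ∧ ψ 0 = u ∧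
      NormalAt (pullMetric ψ G) 0 := by
  obtain ⟨B, hB⟩ := exists_transpose_mul_self (h.posDef u hu).posSemidef
  have hBd : IsUnit B.det := by
    have := h.det_ne hu
    rw [hB, Matrix.det_mul] at this
    exact (right_ne_zero_of_mul this).isUnit
  set L := B⁻¹ with hL
  have hLd : L.det ≠ 0 := by
    rw [hL, Matrix.det_nonsing_inv]; exact (hBd.ringInverse).ne_zero
  -- Prescribes the derivative of the Jacobian at the origin as −Γ(L, L), which is exactly what
  -- annihilates the right-hand side of the transformation law of Γ. The factor `L` = `B⁻¹` makes
  -- the new frame orthonormal.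
  let Q : Fin m → Matrix (Fin m) (Fin m) ℝ := fun a =>
    Matrix.of fun i j => -∑ b, ∑ c, chr G b u a c * L b i * L c j
  have hQ : ∀ a i j, Q a i j = Q a j i := by
    intro a i j
    simp only [Q, Matrix.of_apply]
    rw [Finset.sum_comm]
    congr 1
    refine Finset.sum_congr rfl fun b _ => Finset.sum_congr rfl fun c _ => ?_
    rw [h.chr_symm hu a c b]; ring
  set ψ := quadMap u L Q with hψ
  have hs : ContDiff ℝ ∞ ψ := contDiff_quadMap u L Q
  have hJ : ∀ w a i, jac ψ w a i = L a i + ∑ j, Q a i j * w j := jac_quadMap u L hQ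
  have hψ0 : ψ 0 = u := quadMap_zero u L Q
  have hJ0 : jac ψ 0 = L := by ext a i; rw [hJ]; simp
  have hJs : MSmooth univ (jac ψ) := fun a i => by
    simp only [hJ]
    exact (contDiff_const.add (ContDiff.sum fun j _ =>
      contDiff_const.mul (contDiff_coord j))).contDiffOn
  -- A quadratic map need not be invertible globally, so its domain is cut down to where the
  -- Jacobian is nonsingular.
  let V := ψ ⁻¹' U ∩ {w | (jac ψ w).det ≠ 0}
  have hdc : Continuous fun w => (jac ψ w).det :=
    continuousOn_univ.1 hJs.det.continuousOn
  have hV : IsOpen V := (h.isOpen.preimage hs.continuous).inter (isOpen_ne.preimage hdc)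
  have h0 : (0 : EuclideanSpace ℝ (Fin m)) ∈ V := by
    refine ⟨?_, ?_⟩
    · rw [mem_preimage, hψ, quadMap_zero]; exact hu
    · rw [Set.mem_ofPred_eq, hJ0]; exact hLd
  have hcc : CoordChange V U ψ := ⟨hV, hs.contDiffOn, fun w hw => hw.1, fun w hw => hw.2⟩
  refine ⟨V, ψ, hcc, h0, quadMap_zero u L Q, ?_, fun i => ?_⟩
  · rw [pullMetric, hJ0, hψ, quadMap_zero, hB, Matrix.mul_assoc, Matrix.mul_assoc,
      Matrix.mul_nonsing_inv _ hBd, Matrix.mul_one, ← Matrix.transpose_mul,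
      Matrix.mul_nonsing_inv _ hBd, Matrix.transpose_one]
  · have key := hcc.jac_mul_chr h (fun _ _ => rfl) h0 i
    have hz : pullChr ψ G i 0 * jac ψ 0 + mpd i (jac ψ) 0 = 0 := by
      ext a k
      have e1 : mpd i (jac ψ) 0 a k = Q a k i := by
        rw [mpd_apply]
        simp only [hJ]
        have dc := fun j => (contDiff_coord (m := m) j).differentiable (by simp) 0
        rw [pd_add i (differentiableAt_const _)
          (DifferentiableAt.fun_sum fun j _ => (dc j).const_mul _), pd_const,
          pd_sum i _ (f := fun j w => Q a k j * w j) fun j _ => (dc j).const_mul _]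
        simp only [pd_const_mul i _ (dc _), pd_coord]
        simp
      rw [Matrix.add_apply, e1, hQ]
      simp only [pullChr, hJ0, hψ0, Q, Matrix.of_apply, Matrix.mul_apply,
        Matrix.sum_apply, Matrix.smul_apply, smul_eq_mul, Finset.sum_mul]
      rw [Finset.sum_comm, Matrix.zero_apply, add_neg_eq_zero]
      exact Finset.sum_congr rfl fun _ _ => Finset.sum_congr rfl fun _ _ => by ring
    rw [hz] at key
    have := congrArg (fun M => (jac ψ 0)⁻¹ * M) key
    simpa only [← Matrix.mul_assoc, hcc.inv_mul h0, Matrix.one_mul, Matrix.mul_zero] using this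

theorem MetricOn.smooth_inv (h : MetricOn U G) : MSmooth U (fun v => (G v)⁻¹) :=
  h.smooth.inv fun _ hv => h.det_ne hv

theorem MetricOn.smooth_ricci (h : MetricOn U G) : MSmooth U (fun v => Matrix.of (ricci G v)) :=
  fun i j => (h.family.smooth_ricci i j).slice (mem_univ 0)

theorem MetricOn.smooth_sic (h : MetricOn U G) (hF : ContDiffOn ℝ ∞ F U) (a : ℝ) :
    MSmooth U (fun v => Matrix.of (sic G F a v)) := fun i j =>
  (h.smooth_ricci i j).sub (contDiffOn_const.mul
    ((smooth_pd h.isOpen hF i).mul (smooth_pd h.isOpen hF j)))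

theorem MetricOn.smooth_lap (h : MetricOn U G) (hF : ContDiffOn ℝ ∞ F U) :
    ContDiffOn ℝ ∞ (fun v => lap G F v) U :=
  (h.family.smooth_lap (JSmooth.of_slice hF)).slice (mem_univ 0)

theorem MetricOn.smooth_gradSq (h : MetricOn U G) (hF : ContDiffOn ℝ ∞ F U) :
    ContDiffOn ℝ ∞ (fun v => gradSq G F v) U :=
  (h.family.smooth_gradSq (JSmooth.of_slice hF)).slice (mem_univ 0)

/-- The endomorphism `g^{ik} Sic_kj`. -/
noncomputable def sicEnd (G : EuclideanSpace ℝ (Fin m) → Matrix (Fin m) (Fin m) ℝ)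
    (F : EuclideanSpace ℝ (Fin m) → ℝ) (a : ℝ) (u : EuclideanSpace ℝ (Fin m)) :
    Matrix (Fin m) (Fin m) ℝ := (G u)⁻¹ * Matrix.of (sic G F a u)

theorem MetricOn.smooth_sicEnd (h : MetricOn U G) (hF : ContDiffOn ℝ ∞ F U) (a : ℝ) :
    MSmooth U (sicEnd G F a) := h.smooth_inv.mul (h.smooth_sic hF a)

theorem MetricOn.mul_sicEnd (h : MetricOn U G) (hu : u ∈ U) (F : EuclideanSpace ℝ (Fin m) → ℝ)
    (a : ℝ) : G u * sicEnd G F a u = Matrix.of (sic G F a u) := by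
  rw [sicEnd, ← Matrix.mul_assoc, h.mul_inv hu, Matrix.one_mul]

theorem NormalAt.mpd_metric (hn : NormalAt G p) (h : MetricOn U G) (hp : p ∈ U)
    (k : Fin m) : mpd k G p = 0 := by
  rw [h.compat hp, hn.chr_eq]; simp

/-- Since g = 1 and ∂g = 0 at `p`, lowering an index commutes with one derivative there. -/
theorem NormalAt.mpd_mul_metric (hn : NormalAt G p) (h : MetricOn U G) (hp : p ∈ U)
    {A : EuclideanSpace ℝ (Fin m) → Matrix (Fin m) (Fin m) ℝ}
    (hA : MSmooth U A) (k : Fin m) : mpd k (fun v => G v * A v) p = mpd k A p := by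
  rw [mpd_mul k h.isOpen hp h.smooth hA, hn.mpd_metric h hp, hn.eq_one]
  simp

/-- With two derivatives only the ∂∂g term survives besides ∂∂A. This defect is the source of the
correction terms in the evolution of Sic. -/
theorem NormalAt.mpd_mpd_mul_metric (hn : NormalAt G p) (h : MetricOn U G) (hp : p ∈ U)
    {A : EuclideanSpace ℝ (Fin m) → Matrix (Fin m) (Fin m) ℝ}
    (hA : MSmooth U A) (k l : Fin m) : mpd k (fun w => mpd l (fun v => G v * A v) w) p
      = mpd k (fun w => mpd l G w) p * A p + mpd k (fun w => mpd l A w) p := by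
  have hG := h.smooth
  rw [mpd_congr k h.isOpen hp fun w hw => mpd_mul l h.isOpen hw hG hA,
    mpd_add k h.isOpen hp ((hG.mpd l h.isOpen).mul hA) (hG.mul (hA.mpd l h.isOpen)),
    mpd_mul k h.isOpen hp (hG.mpd l h.isOpen) hA, mpd_mul k h.isOpen hp hG (hA.mpd l h.isOpen),
    hn.mpd_metric h hp, hn.mpd_metric h hp, hn.eq_one]
  simp

theorem NormalAt.pd_christoffel (hn : NormalAt G p) (h : MetricOn U G) (hp : p ∈ U)
    (a k i j : Fin m) :
    pd a (fun v => christoffel G v k i j) p = (1 / 2) * (pd a (fun v => pd i (fun w => G w j k) v) p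
      + pd a (fun v => pd j (fun w => G w i k) v) p
      - pd a (fun v => pd k (fun w => G w i j) v) p) := by
  have e1 := hn.mpd_mul_metric h hp (h.smooth_chr i) a
  have e2 := congrFun (congrFun e1 k) j
  have d := fun i j k => differentiableAt_of_smooth h.isOpen
    (smooth_pd h.isOpen (h.smooth j k) i) hp
  have e3 : mpd a (fun v => G v * chr G i v) p = mpd a (fun v => (1 / 2 : ℝ) • koszul G i v) p :=
    mpd_congr a h.isOpen hp fun v hv => h.mul_chr hv i
  rw [e3, mpd_apply, mpd_apply] at e2
  change _ = pd a (fun v => christoffel G v k i j) p at e2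
  rw [← e2]
  change pd a (fun v => (1 / 2) * (pd i (fun w => G w j k) v + pd j (fun w => G w i k) v
    - pd k (fun w => G w i j) v)) p = _
  rw [pd_const_mul a _ (((d i j k).fun_add (d j i k)).fun_sub (d k i j)),
    pd_sub a ((d i j k).fun_add (d j i k)) (d k i j), pd_add a (d i j k) (d j i k)]

theorem NormalAt.pd_pd_christoffel (hn : NormalAt G p) (h : MetricOn U G) (hp : p ∈ U)
    (b a k i j : Fin m) :
    pd b (fun w => pd a (fun v => christoffel G v k i j) w) p
      = (1 / 2) * (pd b (fun w => pd a (fun v => pd i (fun w => G w j k) v) w) p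
      + pd b (fun w => pd a (fun v => pd j (fun w => G w i k) v) w) p
      - pd b (fun w => pd a (fun v => pd k (fun w => G w i j) v) w) p) := by
  have e1 := hn.mpd_mpd_mul_metric h hp (h.smooth_chr i) b a
  -- For A = Γ the defect vanishes as well, so second derivatives of Γ are still those of half the
  -- Koszul expression.
  rw [hn.chr_eq, Matrix.mul_zero, zero_add] at e1
  have e2 := congrFun (congrFun e1 k) j
  have s := fun i j k => smooth_pd h.isOpen (h.smooth j k) i
  have s2 := fun i j k => smooth_pd h.isOpen (s i j k) a
  have e3 : ∀ v ∈ U, pd a (fun v => (G v * chr G i v) k j) v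
      = (1 / 2) * (pd a (fun v => pd i (fun w => G w j k) v) v
      + pd a (fun v => pd j (fun w => G w i k) v) v
      - pd a (fun v => pd k (fun w => G w i j) v) v) := by
    intro v hv
    have d := fun i j k => differentiableAt_of_smooth h.isOpen (s i j k) hv
    have : ∀ v ∈ U, (G v * chr G i v) k j = (1 / 2) * (pd i (fun w => G w j k) v
        + pd j (fun w => G w i k) v - pd k (fun w => G w i j) v) := fun v hv => by
      rw [h.mul_chr hv i]; rfl
    rw [pd_congr a h.isOpen hv this, pd_const_mul a _ (((d i j k).fun_add (d j i k)).fun_sub (d k i j)),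
      pd_sub a ((d i j k).fun_add (d j i k)) (d k i j), pd_add a (d i j k) (d j i k)]
  have d := fun i j k => differentiableAt_of_smooth h.isOpen (s2 i j k) hp
  change _ = pd b (fun w => pd a (fun v => christoffel G v k i j) w) p at e2
  rw [← e2]
  change pd b (fun w => pd a (fun v => (G v * chr G i v) k j) w) p = _
  rw [pd_congr b h.isOpen hp e3, pd_const_mul b _ (((d i j k).fun_add (d j i k)).fun_sub (d k i j)),
      pd_sub b ((d i j k).fun_add (d j i k)) (d k i j), pd_add b (d i j k) (d j i k)]

theorem NormalAt.curv_eq (hn : NormalAt G p) (i j : Fin m) :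
    curv G i j p = mpd i (chr G j) p - mpd j (chr G i) p := by
  rw [RicciHarmonic.curv_eq, hn.chr_eq, hn.chr_eq]; simp

/-- A product of two Christoffel symbols vanishes to second order at `p`, so it is invisible to one
derivative. -/
theorem NormalAt.mpd_curv (hn : NormalAt G p) (h : MetricOn U G) (hp : p ∈ U)
    (a i j : Fin m) :
    mpd a (curv G i j) p
      = mpd a (fun v => mpd i (chr G j) v) p - mpd a (fun v => mpd j (chr G i) v) p := by
  have hs := h.smooth_chr
  have hd := fun i j => (hs j).mpd i h.isOpen
  have e : ∀ i j, mpd a (fun v => chr G i v * chr G j v) p = 0 := by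
    intro i j
    rw [mpd_mul a h.isOpen hp (hs i) (hs j), hn.chr_eq, hn.chr_eq]; simp
  ext l k
  have d1 : ∀ i j, DifferentiableAt ℝ (fun v => mpd i (chr G j) v l k) p :=
    fun i j => differentiableAt_of_smooth h.isOpen (hd i j l k) hp
  have d2 : ∀ i j, DifferentiableAt ℝ (fun v => (chr G i v * chr G j v) l k) p :=
    fun i j => differentiableAt_of_smooth h.isOpen (((hs i).mul (hs j)) l k) hp
  have e' : ∀ i j, pd a (fun v => (chr G i v * chr G j v) l k) p = 0 :=
    fun i j => congrFun (congrFun (e i j) l) k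
  rw [mpd_apply]
  simp only [RicciHarmonic.curv_eq, Matrix.add_apply, Matrix.sub_apply]
  rw [pd_add a ((d1 i j).fun_sub (d1 j i)) ((d2 i j).fun_sub (d2 j i)), pd_sub a (d1 i j) (d1 j i),
    pd_sub a (d2 i j) (d2 j i), e', e']
  simp [mpd_apply]

end Normal

/-! ### The contracted Bianchi identity -/

section Bianchi

variable {m : ℕ} {U V : Set (EuclideanSpace ℝ (Fin m))}
  {G : EuclideanSpace ℝ (Fin m) → Matrix (Fin m) (Fin m) ℝ}
  {F : EuclideanSpace ℝ (Fin m) → ℝ} {u p : EuclideanSpace ℝ (Fin m)}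

/-- Second partial derivatives of the metric. -/
noncomputable def metric2 (G : EuclideanSpace ℝ (Fin m) → Matrix (Fin m) (Fin m) ℝ)
    (p : EuclideanSpace ℝ (Fin m)) (a b i j : Fin m) : ℝ :=
  pd a (fun v => pd b (fun w => G w i j) v) p

/-- Third partial derivatives of the metric. -/
noncomputable def metric3 (G : EuclideanSpace ℝ (Fin m) → Matrix (Fin m) (Fin m) ℝ)
    (p : EuclideanSpace ℝ (Fin m)) (a b c i j : Fin m) : ℝ :=
  pd a (fun v => pd b (fun w => pd c (fun x => G x i j) w) v) p

theorem MetricOn.metric2_comm (h : MetricOn U G) (hp : p ∈ U) (a b i j : Fin m) :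
    metric2 G p a b i j = metric2 G p b a i j := pd_comm h.isOpen (h.smooth i j) hp a b

theorem MetricOn.metric2_symm (h : MetricOn U G) (hp : p ∈ U) (a b i j : Fin m) :
    metric2 G p a b i j = metric2 G p a b j i :=
  pd_congr a h.isOpen hp fun _ hv => h.pd_symm hv b i j

theorem MetricOn.metric3_comm (h : MetricOn U G) (hp : p ∈ U) (a b c i j : Fin m) :
    metric3 G p a b c i j = metric3 G p b a c i j :=
  pd_comm h.isOpen (smooth_pd h.isOpen (h.smooth i j) c) hp a b

theorem MetricOn.metric3_comm' (h : MetricOn U G) (hp : p ∈ U) (a b c i j : Fin m) :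
    metric3 G p a b c i j = metric3 G p a c b i j :=
  pd_congr a h.isOpen hp fun _ hv => pd_comm h.isOpen (h.smooth i j) hv b c

theorem NormalAt.ricci_eq (hn : NormalAt G p) (h : MetricOn U G) (hp : p ∈ U) (i j : Fin m) :
    ricci G p i j = ∑ k, (pd k (fun v => christoffel G v k i j) p
      - pd i (fun v => christoffel G v k k j) p) := by
  rw [h.ricci_eq hp]
  refine Finset.sum_congr rfl fun k _ => ?_
  rw [hn.curv_eq]
  rfl

theorem NormalAt.ricci_eq_metric2 (hn : NormalAt G p) (h : MetricOn U G) (hp : p ∈ U)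
    (i j : Fin m) : ricci G p i j = ∑ k, (1 / 2) * (metric2 G p k i j k + metric2 G p k j i k
      - metric2 G p k k i j - metric2 G p i j k k) := by
  rw [hn.ricci_eq h hp]
  refine Finset.sum_congr rfl fun k _ => ?_
  rw [hn.pd_christoffel h hp, hn.pd_christoffel h hp]
  change (1 / 2) * (metric2 G p k i j k + metric2 G p k j i k - metric2 G p k k i j)
    - (1 / 2) * (metric2 G p i k j k + metric2 G p i j k k - metric2 G p i k k j) = _
  rw [h.metric2_symm hp i k k j]; ring

theorem NormalAt.ricci_symm (hn : NormalAt G p) (h : MetricOn U G) (hp : p ∈ U)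
    (i j : Fin m) : ricci G p i j = ricci G p j i := by
  rw [hn.ricci_eq_metric2 h hp, hn.ricci_eq_metric2 h hp]
  refine Finset.sum_congr rfl fun k _ => ?_
  rw [h.metric2_symm hp k k i j, h.metric2_comm hp i j k k]; ring

/-- In normal coordinates the symmetry is visible from the formula in second partials of g;
congruence by an invertible Jacobian carries it back. -/
theorem MetricOn.ricci_symm (h : MetricOn U G) (hu : u ∈ U) (i j : Fin m) :
    ricci G u i j = ricci G u j i := by
  obtain ⟨V, ψ, hψ, h0, rfl, hn⟩ := h.exists_normal hu
  have hV : MetricOn V (pullMetric ψ G) := hψ.metricOn h fun _ _ => rfl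
  have e := hψ.ricci_eq h (fun _ _ => rfl) h0
  set R := Matrix.of (ricci G (ψ 0)) with hR
  set J := jac ψ 0
  have hsym : (pull2 J R).transpose = pull2 J R := by
    rw [← e]; ext i j; exact hn.ricci_symm hV h0 j i
  have hJ : J * J⁻¹ = 1 := hψ.mul_inv h0
  have hJ' : (J⁻¹).transpose * J.transpose = 1 := by rw [← Matrix.transpose_mul, hJ]; simp
  have e2 : ∀ R : Matrix (Fin m) (Fin m) ℝ, R = (J⁻¹).transpose * pull2 J R * J⁻¹ := by
    intro R
    rw [pull2, Matrix.mul_assoc, Matrix.mul_assoc, Matrix.mul_assoc, hJ, Matrix.mul_one,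
      ← Matrix.mul_assoc, hJ', Matrix.one_mul]
  have e3 : R.transpose = R := by
    rw [e2 R]
    simp only [Matrix.transpose_mul, Matrix.transpose_transpose, hsym, Matrix.mul_assoc]
  exact congrFun (congrFun e3 j) i

theorem MetricOn.sic_symm (h : MetricOn U G) (hu : u ∈ U) (F : EuclideanSpace ℝ (Fin m) → ℝ)
    (a : ℝ) (i j : Fin m) : sic G F a u i j = sic G F a u j i := by
  simp only [sic, h.ricci_symm hu i j, mul_comm (pd i F u)]

theorem NormalAt.pd_ricci (hn : NormalAt G p) (h : MetricOn U G) (hp : p ∈ U) (a i j : Fin m) :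
    pd a (fun v => ricci G v i j) p = ∑ k, (1 / 2) * (metric3 G p a k j i k
      - metric3 G p a k k i j - metric3 G p a i j k k + metric3 G p a i k k j) := by
  have hs : ∀ k, DifferentiableAt ℝ (fun v => curv G k i v k j) p := fun k =>
    differentiableAt_of_smooth h.isOpen
      ((h.family.smooth_riemUp k i j k).slice (mem_univ 0)) hp
  rw [pd_congr a h.isOpen hp fun v hv => h.ricci_eq hv i j, pd_sum a _ fun k _ => hs k]
  refine Finset.sum_congr rfl fun k _ => ?_
  have e1 := congrFun (congrFun (hn.mpd_curv h hp a k i) k) j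
  have e2 := hn.pd_pd_christoffel h hp a k k i j
  have e3 := hn.pd_pd_christoffel h hp a i k k j
  change pd a (fun v => curv G k i v k j) p
    = pd a (fun w => pd k (fun v => christoffel G v k i j) w) p
      - pd a (fun w => pd i (fun v => christoffel G v k k j) w) p at e1
  rw [e1, e2, e3]
  change (1 / 2) * (metric3 G p a k i j k + metric3 G p a k j i k - metric3 G p a k k i j)
    - (1 / 2) * (metric3 G p a i k j k + metric3 G p a i j k k - metric3 G p a i k k j) = _
  rw [h.metric3_comm' hp a k i j k]; ring

/-- At a normal point both sides are sums of third partials of g, and they agree after commuting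
partials and relabelling indices. -/
theorem NormalAt.bianchi_ricci (hn : NormalAt G p) (h : MetricOn U G) (hp : p ∈ U) (j : Fin m) :
    ∑ k, pd k (fun v => ricci G v k j) p
      = (1 / 2) * ∑ k, pd j (fun v => ricci G v k k) p := by
  simp only [hn.pd_ricci h hp, ← Finset.mul_sum, Finset.sum_add_distrib, Finset.sum_sub_distrib]
  have e1 : ∑ k, ∑ l, metric3 G p k k l l j = ∑ k, ∑ l, metric3 G p k l l k j := by
    rw [Finset.sum_comm]
    refine Finset.sum_congr rfl fun k _ => Finset.sum_congr rfl fun l _ => ?_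
    rw [h.metric3_comm' hp l l k, h.metric3_comm hp l k l]
  have e2 : ∑ k, ∑ l, metric3 G p j k k l l = ∑ k, ∑ l, metric3 G p j l l k k := Finset.sum_comm
  have e3 : ∑ k, ∑ l, metric3 G p j k l l k = ∑ k, ∑ l, metric3 G p j l k k l := Finset.sum_comm
  have e4 : ∑ k, ∑ l, metric3 G p k l j k l = ∑ k, ∑ l, metric3 G p j l k k l :=
    Finset.sum_congr rfl fun k _ => Finset.sum_congr rfl fun l _ => by
      rw [h.metric3_comm' hp k l j, h.metric3_comm hp k j l, h.metric3_comm' hp j k l]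
  have e5 : ∑ k, ∑ l, metric3 G p k k j l l = ∑ k, ∑ l, metric3 G p j l l k k := by
    rw [Finset.sum_comm]
    refine Finset.sum_congr rfl fun k _ => Finset.sum_congr rfl fun l _ => ?_
    rw [h.metric3_comm' hp l l j, h.metric3_comm hp l j l]
  rw [e1, e2, e3, e4, e5]; ring

theorem NormalAt.hess_eq (hn : NormalAt G p) (F : EuclideanSpace ℝ (Fin m) → ℝ) (i j : Fin m) :
    hess G F p i j = pd i (fun v => pd j F v) p := by
  have : ∀ k, christoffel G p k i j = 0 := fun k => congrFun (congrFun (hn.chr_eq i) k) j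
  simp [hess, this]

theorem NormalAt.trace2_eq (hn : NormalAt G p) (A : Fin m → Fin m → ℝ) :
    trace2 G p A = ∑ i, A i i := by
  simp [trace2, hn.eq_one, Matrix.one_apply]

theorem NormalAt.lap_eq (hn : NormalAt G p) (F : EuclideanSpace ℝ (Fin m) → ℝ) :
    lap G F p = ∑ i, pd i (fun v => pd i F v) p := by
  simp only [lap, hn.trace2_eq, hn.hess_eq]

theorem MetricOn.sicTrace_eq (h : MetricOn U G) (hu : u ∈ U) (F : EuclideanSpace ℝ (Fin m) → ℝ)
    (a : ℝ) : sicTrace G F a u = ∑ k, sicEnd G F a u k k := by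
  simp only [sicTrace, trace2, sicEnd, Matrix.mul_apply, Matrix.of_apply]
  exact Finset.sum_congr rfl fun i _ => Finset.sum_congr rfl fun j _ => by rw [h.sic_symm hu]

theorem NormalAt.mpd_sicEnd (hn : NormalAt G p) (h : MetricOn U G) (hp : p ∈ U)
    (hF : ContDiffOn ℝ ∞ F U) (a : ℝ) (k i j : Fin m) :
    mpd k (sicEnd G F a) p i j = pd k (fun v => sic G F a v i j) p := by
  rw [← hn.mpd_mul_metric h hp (h.smooth_sicEnd hF a) k, mpd_apply]
  exact pd_congr k h.isOpen hp fun v hv => congrFun (congrFun (h.mul_sicEnd hv F a) i) j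

theorem MetricOn.pd_sic (h : MetricOn U G) (hu : u ∈ U) (hF : ContDiffOn ℝ ∞ F U) (a : ℝ)
    (k i j : Fin m) : pd k (fun v => sic G F a v i j) u = pd k (fun v => ricci G v i j) u
      - a * (pd k (fun v => pd i F v) u * pd j F u + pd i F u * pd k (fun v => pd j F v) u) := by
  have d1 := differentiableAt_of_smooth h.isOpen (h.smooth_ricci i j) hu
  have d2 := fun i => differentiableAt_of_smooth h.isOpen (smooth_pd h.isOpen hF i) hu
  simp only [sic]
  rw [pd_sub k (f := fun v => ricci G v i j) d1 (((d2 i).fun_mul (d2 j)).const_mul a),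
    pd_const_mul k a ((d2 i).fun_mul (d2 j)), pd_mul k (d2 i) (d2 j)]

theorem MetricOn.pd_sicTrace (h : MetricOn U G) (hu : u ∈ U) (hF : ContDiffOn ℝ ∞ F U) (a : ℝ)
    (j : Fin m) : pd j (sicTrace G F a) u = ∑ k, mpd j (sicEnd G F a) u k k := by
  rw [pd_congr j h.isOpen hu fun v hv => h.sicTrace_eq hv F a, pd_sum j _
    (f := fun k v => sicEnd G F a v k k) fun k _ =>
    differentiableAt_of_smooth h.isOpen (h.smooth_sicEnd hF a k k) hu]
  rfl

/-- The Ricci part contributes ½dR, and div(α dφ⊗dφ) = αΔφ dφ + ½α d|∇φ|². The last term turns ½dR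
into ½dS. -/
theorem NormalAt.bianchi (hn : NormalAt G p) (h : MetricOn U G) (hp : p ∈ U)
    (hF : ContDiffOn ℝ ∞ F U) (a : ℝ) (j : Fin m) :
    ∑ k, nabla G (sicEnd G F a) k p k j
      = (1 / 2) * pd j (sicTrace G F a) p - a * lap G F p * pd j F p := by
  simp only [nabla, hn.chr_eq, Matrix.zero_mul, Matrix.mul_zero, sub_zero, add_zero]
  rw [h.pd_sicTrace hp hF]
  simp only [hn.mpd_sicEnd h hp hF, h.pd_sic hp hF, Finset.sum_sub_distrib, hn.lap_eq]
  rw [hn.bianchi_ricci h hp]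
  have e : ∑ x, a * (pd j (fun v => pd x F v) p * pd x F p + pd x F p * pd j (fun v => pd x F v) p)
      = 2 * (a * ∑ x, pd x F p * pd x (fun v => pd j F v) p) := by
    simp only [Finset.mul_sum]
    exact Finset.sum_congr rfl fun x _ => by rw [pd_comm h.isOpen hF hp j x]; ring
  rw [e, ← Finset.mul_sum, Finset.sum_add_distrib, ← Finset.sum_mul]
  ring

theorem CoordChange.sicEnd_eq {ψ : EuclideanSpace ℝ (Fin m) → EuclideanSpace ℝ (Fin m)}
    {G' : EuclideanSpace ℝ (Fin m) → Matrix (Fin m) (Fin m) ℝ}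
    {F' : EuclideanSpace ℝ (Fin m) → ℝ} {v : EuclideanSpace ℝ (Fin m)}
    (hψ : CoordChange V U ψ) (h : MetricOn U G')
    (hG : ∀ v ∈ V, G v = pullMetric ψ G' v) (hF' : ContDiffOn ℝ ∞ F' U)
    (hF : ∀ v ∈ V, F v = F' (ψ v)) (hv : v ∈ V) (a : ℝ) :
    jac ψ v * sicEnd G F a v = sicEnd G' F' a (ψ v) * jac ψ v := by
  rw [sicEnd, hψ.sic_eq h hG hF' hF hv, sicEnd, ← hψ.jac_mul_inv_mul hG hv, pull2]
  simp only [Matrix.mul_assoc]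

/-- Both sides are covectors, so the identity at a normal point transfers by cancelling the
Jacobian. It is wanted at every point of `U`, not only at one centre, because it will be
differentiated. -/
theorem MetricOn.bianchi (h : MetricOn U G) (hu : u ∈ U) (hF : ContDiffOn ℝ ∞ F U) (a : ℝ)
    (j : Fin m) : ∑ k, nabla G (sicEnd G F a) k u k j
      = (1 / 2) * pd j (sicTrace G F a) u - a * lap G F u * pd j F u := by
  obtain ⟨V, ψ, hψ, h0, rfl, hn⟩ := h.exists_normal hu
  have hG : ∀ v ∈ V, pullMetric ψ G v = pullMetric ψ G v := fun _ _ => rfl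
  have hFF : ∀ v ∈ V, (fun v => F (ψ v)) v = F (ψ v) := fun _ _ => rfl
  have hV : MetricOn V (pullMetric ψ G) := hψ.metricOn h hG
  have hFV := hψ.smooth_comp hF
  have hb := hn.bianchi hV h0 hFV a
  have hS : ContDiffOn ℝ ∞ (sicTrace G F a) U := by
    refine ContDiffOn.congr (ContDiffOn.sum fun k _ => h.smooth_sicEnd hF a k k)
      fun v hv => h.sicTrace_eq hv F a
  have key : ∀ j, ∑ d, (∑ b, nabla G (sicEnd G F a) b (ψ 0) b d) * jac ψ 0 d j
      = ∑ d, ((1 / 2) * pd d (sicTrace G F a) (ψ 0) - a * lap G F (ψ 0) * pd d F (ψ 0))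
        * jac ψ 0 d j := by
    intro j
    rw [← hψ.div_eq h hG (hV.smooth_sicEnd hFV a) (h.smooth_sicEnd hF a)
      (fun v hv => hψ.sicEnd_eq h hG hF hFF hv a) h0, hb,
      hψ.pd_scalar h.isOpen hS (fun v hv => hψ.sicTrace_eq h hG hF hFF hv a) h0,
      hψ.pd_scalar h.isOpen hF hFF h0, hψ.lap_eq h hG hF hFF h0, Finset.mul_sum, Finset.mul_sum,
      ← Finset.sum_sub_distrib]
    exact Finset.sum_congr rfl fun d _ => by ring
  have hinj := Matrix.vecMul_injective_of_isUnit
    ((Matrix.isUnit_iff_isUnit_det _).2 (hψ.det_ne 0 h0).isUnit)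
  exact congrFun (hinj (funext key : Matrix.vecMul _ (jac ψ 0) = Matrix.vecMul _ (jac ψ 0))) j

end Bianchi

/-! ### Evolution equations -/

section Evolution

variable {m : ℕ}

/-- The Ricci-harmonic flow in one coordinate system, on an open time set. -/
structure LocalFlow (U : Set (EuclideanSpace ℝ (Fin m))) (I : Set ℝ) (α : ℝ → ℝ)
    (G : ℝ → EuclideanSpace ℝ (Fin m) → Matrix (Fin m) (Fin m) ℝ)
    (F : ℝ → EuclideanSpace ℝ (Fin m) → ℝ) : Prop where
  family : MetricFamily U I G
  isOpen_time : IsOpen I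
  smooth_map : JSmooth U I F
  metric_eq : ∀ t ∈ I, ∀ u ∈ U, ∀ i j, HasDerivAt (fun s => G s u i j)
    (-2 * sic (G t) (F t) (α t) u i j) t
  map_eq : ∀ t ∈ I, ∀ u ∈ U, HasDerivAt (fun s => F s u) (lap (G t) (F t) u) t

variable {U : Set (EuclideanSpace ℝ (Fin m))} {I : Set ℝ} {α : ℝ → ℝ}
  {G : ℝ → EuclideanSpace ℝ (Fin m) → Matrix (Fin m) (Fin m) ℝ}
  {F : ℝ → EuclideanSpace ℝ (Fin m) → ℝ} {t : ℝ} {p u : EuclideanSpace ℝ (Fin m)}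

theorem LocalFlow.metricOn (hf : LocalFlow U I α G F) (ht : t ∈ I) : MetricOn U (G t) :=
  hf.family.slice ht

theorem LocalFlow.hasDerivAt_pd_map (hf : LocalFlow U I α G F) (ht : t ∈ I) (hu : u ∈ U)
    (i : Fin m) : HasDerivAt (fun s => pd i (F s) u) (pd i (lap (G t) (F t)) u) t :=
  hasDerivAt_pd hf.family.isOpen hf.isOpen_time hf.smooth_map ht (hf.map_eq t ht) i hu

theorem LocalFlow.hasDerivAt_pd_metric (hf : LocalFlow U I α G F) (ht : t ∈ I) (hu : u ∈ U)
    (k i j : Fin m) : HasDerivAt (fun s => pd k (fun v => G s v i j) u)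
      (-2 * pd k (fun v => sic (G t) (F t) (α t) v i j) u) t := by
  have h := hf.metricOn ht
  have := hasDerivAt_pd hf.family.isOpen hf.isOpen_time (hf.family.smooth i j) ht
    (fun v hv => hf.metric_eq t ht v hv i j) k hu
  have hs : ContDiffOn ℝ ∞ (fun v => sic (G t) (F t) (α t) v i j) U :=
    h.smooth_sic (hf.smooth_map.slice ht) _ i j
  rwa [pd_const_mul k _ (differentiableAt_of_smooth h.isOpen hs hu)] at this

/-- Solve the product rule (BC)' = D' for C'. With BC = 1 this differentiates the inverse metric,
and with gΓ equal to half the Koszul matrix it differentiates the Christoffel symbols. -/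
theorem hasDerivAt_inv_of_mul {B C : ℝ → Matrix (Fin m) (Fin m) ℝ} {B' D' : Matrix (Fin m) (Fin m) ℝ}
    (hB : ∀ i j, HasDerivAt (fun s => B s i j) (B' i j) t)
    (hC : ∀ i j, DifferentiableAt ℝ (fun s => C s i j) t)
    (hD : ∀ i j, HasDerivAt (fun s => (B s * C s) i j) (D' i j) t)
    (hdet : IsUnit (B t).det) (i j : Fin m) :
    HasDerivAt (fun s => C s i j) (((B t)⁻¹ * (D' - B' * C t)) i j) t := by
  let C' : Matrix (Fin m) (Fin m) ℝ := Matrix.of fun i j => deriv (fun s => C s i j) t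
  have hC' : ∀ i j, HasDerivAt (fun s => C s i j) (C' i j) t := fun i j => (hC i j).hasDerivAt
  have e : B' * C t + B t * C' = D' := by
    ext i j
    refine HasDerivAt.unique ?_ (hD i j)
    simp only [Matrix.mul_apply, Matrix.add_apply, ← Finset.sum_add_distrib]
    exact HasDerivAt.fun_sum fun k _ => (hB i k).fun_mul (hC' k j)
  have e2 : C' = (B t)⁻¹ * (D' - B' * C t) := by
    rw [← e, add_sub_cancel_left, ← Matrix.mul_assoc, Matrix.nonsing_inv_mul _ hdet,
      Matrix.one_mul]
  rw [← e2]
  exact hC' i j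

theorem LocalFlow.hasDerivAt_inv (hf : LocalFlow U I α G F) (ht : t ∈ I) (hp : p ∈ U)
    (hn : NormalAt (G t) p) (i j : Fin m) :
    HasDerivAt (fun s => (G s p)⁻¹ i j) (2 * sic (G t) (F t) (α t) p i j) t := by
  have h := hf.metricOn ht
  have key := hasDerivAt_inv_of_mul (B := fun s => G s p) (C := fun s => (G s p)⁻¹)
    (B' := Matrix.of fun i j => -2 * sic (G t) (F t) (α t) p i j) (D' := 0)
    (hf.metric_eq t ht p hp)
    (fun i j => (hf.family.smooth_inv i j).differentiableAt_time hf.family.isOpen hf.isOpen_time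
      ht hp) (fun i j => ?_) (h.det_ne hp).isUnit i j
  · convert key using 1
    rw [hn.eq_one]
    simp
  · refine (hasDerivAt_const t ((1 : Matrix (Fin m) (Fin m) ℝ) i j)).congr_of_eventuallyEq ?_
    filter_upwards [hf.isOpen_time.mem_nhds ht] with s hs
    rw [(hf.metricOn hs).mul_inv hp]

/-- The matrix `k, j ↦ ∂_i A_jk + ∂_j A_ik - ∂_k A_ij`. -/
noncomputable def koszulOf (A : EuclideanSpace ℝ (Fin m) → Fin m → Fin m → ℝ) (i : Fin m)
    (u : EuclideanSpace ℝ (Fin m)) : Matrix (Fin m) (Fin m) ℝ :=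
  Matrix.of fun k j =>
    pd i (fun v => A v j k) u + pd j (fun v => A v i k) u - pd k (fun v => A v i j) u

theorem smooth_koszulOf (hU : IsOpen U) {A : EuclideanSpace ℝ (Fin m) → Fin m → Fin m → ℝ}
    (hA : ∀ i j, ContDiffOn ℝ ∞ (fun v => A v i j) U) (i : Fin m) :
    MSmooth U (koszulOf A i) := fun k j =>
  ((smooth_pd hU (hA j k) i).add (smooth_pd hU (hA i k) j)).sub (smooth_pd hU (hA i j) k)

theorem pd_koszulOf (hU : IsOpen U) {A : EuclideanSpace ℝ (Fin m) → Fin m → Fin m → ℝ}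
    (hA : ∀ i j, ContDiffOn ℝ ∞ (fun v => A v i j) U) (hu : u ∈ U) (a i k j : Fin m) :
    pd a (fun v => koszulOf A i v k j) u = pd a (fun v => pd i (fun w => A w j k) v) u
      + pd a (fun v => pd j (fun w => A w i k) v) u
      - pd a (fun v => pd k (fun w => A w i j) v) u := by
  have d := fun i j k => differentiableAt_of_smooth hU (smooth_pd hU (hA j k) i) hu
  simp only [koszulOf, Matrix.of_apply]
  rw [pd_sub a ((d i j k).fun_add (d j i k)) (d k i j), pd_add a (d i j k) (d j i k)]

theorem LocalFlow.hasDerivAt_pd_christoffel (hf : LocalFlow U I α G F) (ht : t ∈ I) (hp : p ∈ U)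
    (hn : NormalAt (G t) p) (a k i j : Fin m) :
    HasDerivAt (fun s => pd a (fun v => christoffel (G s) v k i j) p)
      (2 * ∑ l, sic (G t) (F t) (α t) p k l * pd a (fun v => christoffel (G t) v l i j) p
        - pd a (fun v => koszulOf (sic (G t) (F t) (α t)) i v k j) p) t := by
  have h := hf.metricOn ht
  have hF := hf.smooth_map.slice ht
  have hU := hf.family.isOpen
  set σ := sic (G t) (F t) (α t) with hσ
  have hσs : MSmooth U (fun v => Matrix.of (σ v)) := h.smooth_sic hF (α t)
  have hQ := smooth_koszulOf (A := σ) hU hσs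
  -- The time derivative of Γ on all of `U`. Knowing it at `p` alone would not suffice, since its
  -- spatial derivative is needed.
  let γ : EuclideanSpace ℝ (Fin m) → Matrix (Fin m) (Fin m) ℝ := fun v =>
    (G t v)⁻¹ * (-koszulOf σ i v - (-2 : ℝ) • (Matrix.of (σ v)) * chr (G t) i v)
  have hR : MSmooth U (fun v => -koszulOf σ i v - (-2 : ℝ) • (Matrix.of (σ v)) * chr (G t) i v) :=
    fun k j => (hQ i k j).neg.sub
      ((MSmooth.mul (A := fun v => (-2 : ℝ) • (Matrix.of (σ v)))
        (fun i j => (hσs i j).const_smul (-2 : ℝ)) (h.smooth_chr i)) k j)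
  have hγ : MSmooth U γ := h.smooth_inv.mul hR
  have hd : ∀ v ∈ U, ∀ k j, HasDerivAt (fun s => christoffel (G s) v k i j) (γ v k j) t := by
    intro v hv k j
    refine hasDerivAt_inv_of_mul (B := fun s => G s v) (C := fun s => chr (G s) i v)
      (B' := (-2 : ℝ) • (Matrix.of (σ v)))
      (D' := -koszulOf σ i v) (hf.metric_eq t ht v hv)
      (fun k j => (hf.family.smooth_christoffel k i j).differentiableAt_time hU hf.isOpen_time
        ht hv) (fun k j => ?_) (h.det_ne hv).isUnit k j
    have e : HasDerivAt (fun s => (1 / 2 : ℝ) * (pd i (fun w => G s w j k) v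
        + pd j (fun w => G s w i k) v - pd k (fun w => G s w i j) v))
        ((-koszulOf σ i v) k j) t := by
      have e0 := (((hf.hasDerivAt_pd_metric ht hv i j k).fun_add
        (hf.hasDerivAt_pd_metric ht hv j i k)).fun_sub
        (hf.hasDerivAt_pd_metric ht hv k i j)).const_mul (1 / 2 : ℝ)
      refine e0.congr_deriv ?_
      rw [Matrix.neg_apply, koszulOf, Matrix.of_apply, hσ]
      ring
    refine e.congr_of_eventuallyEq ?_
    filter_upwards [hf.isOpen_time.mem_nhds ht] with s hs
    rw [(hf.metricOn hs).mul_chr hv i]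
    rfl
  have key := hasDerivAt_pd hU hf.isOpen_time (hf.family.smooth_christoffel k i j) ht
    (fun v hv => hd v hv k j) a hp
  convert key using 1
  -- Differentiating g·γ instead of γ costs nothing at `p` and removes the inverse metric.
  have e1 := congrFun (congrFun (hn.mpd_mul_metric h hp hγ a) k) j
  have e2 : ∀ v ∈ U, (G t v * γ v) k j
      = -koszulOf σ i v k j + 2 * ∑ l, σ v k l * christoffel (G t) v l i j := by
    intro v hv
    simp only [γ]
    rw [← Matrix.mul_assoc, h.mul_inv hv, Matrix.one_mul]
    simp [Matrix.mul_apply, chr, Finset.mul_sum, mul_assoc]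
  rw [mpd_apply, mpd_apply, pd_congr a hU hp e2] at e1
  rw [← e1]
  have dc : ∀ l, DifferentiableAt ℝ (fun v => christoffel (G t) v l i j) p :=
    fun l => differentiableAt_of_smooth hU (h.smooth_chr i l j) hp
  have dσ : ∀ k l, DifferentiableAt ℝ (fun v => σ v k l) p :=
    fun k l => differentiableAt_of_smooth hU (hσs k l) hp
  have hz : ∀ l, christoffel (G t) p l i j = 0 := fun l => congrFun (congrFun (hn.chr_eq i) l) j
  rw [pd_add a (f := fun v => -koszulOf σ i v k j)
    (differentiableAt_of_smooth hU (hQ i k j) hp).fun_neg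
    ((DifferentiableAt.fun_sum fun l _ => (dσ k l).fun_mul (dc l)).const_mul 2), pd_neg,
    pd_const_mul a _ (f := fun v => ∑ l, σ v k l * christoffel (G t) v l i j)
      (DifferentiableAt.fun_sum fun l _ => (dσ k l).fun_mul (dc l)),
    pd_sum a _ (f := fun l v => σ v k l * christoffel (G t) v l i j)
      fun l _ => (dσ k l).fun_mul (dc l)]
  have e3 : ∀ l, pd a (fun v => σ v k l * christoffel (G t) v l i j) p
      = σ p k l * pd a (fun v => christoffel (G t) v l i j) p := by
    intro l
    rw [pd_mul a (f := fun v => σ v k l) (g := fun v => christoffel (G t) v l i j)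
      (dσ k l) (dc l), hz]
    ring
  simp only [e3]
  ring

theorem LocalFlow.hasDerivAt_ricci (hf : LocalFlow U I α G F) (ht : t ∈ I) (hp : p ∈ U)
    (hn : NormalAt (G t) p) (i j : Fin m) :
    HasDerivAt (fun s => ricci (G s) p i j)
      (∑ k, ((2 * ∑ l, sic (G t) (F t) (α t) p k l * pd k (fun v => christoffel (G t) v l i j) p
          - pd k (fun v => koszulOf (sic (G t) (F t) (α t)) i v k j) p)
        - (2 * ∑ l, sic (G t) (F t) (α t) p k l * pd i (fun v => christoffel (G t) v l k j) p
          - pd i (fun v => koszulOf (sic (G t) (F t) (α t)) k v k j) p))) t := by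
  have hU := hf.family.isOpen
  have hz : ∀ k i j, christoffel (G t) p k i j = 0 :=
    fun k i j => congrFun (congrFun (hn.chr_eq i) k) j
  have hc : ∀ k i j, DifferentiableAt ℝ (fun s => christoffel (G s) p k i j) t := fun k i j =>
    (hf.family.smooth_christoffel k i j).differentiableAt_time hU hf.isOpen_time ht hp
  -- The coordinates are normal only at time `t`. A product of two Christoffel symbols nevertheless
  -- has zero time derivative at that instant, because both factors vanish.
  have hcc : ∀ k i j k' i' j', HasDerivAt (fun s => christoffel (G s) p k i j
      * christoffel (G s) p k' i' j') 0 t := by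
    intro k i j k' i' j'
    have := (hc k i j).hasDerivAt.fun_mul (hc k' i' j').hasDerivAt
    rw [hz, hz] at this
    simpa using this
  have key : HasDerivAt (fun s => ∑ k, riemUp (G s) p k i j k) _ t := HasDerivAt.fun_sum fun k _ =>
    ((hf.hasDerivAt_pd_christoffel ht hp hn k k i j).fun_sub
      (hf.hasDerivAt_pd_christoffel ht hp hn i k k j)).fun_add
      (HasDerivAt.fun_sum (u := Finset.univ) fun q _ =>
        (hcc q i j k k q).fun_sub (hcc q k j k i q))
  simp only [sub_zero, Finset.sum_const_zero, add_zero] at key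
  refine key.congr_of_eventuallyEq ?_
  filter_upwards [hf.isOpen_time.mem_nhds ht] with s hs
  exact (hf.metricOn hs).ricci_eq hp i j

end Evolution

/-! ### Evolution of Ric and Sic at the centre of normal coordinates. -/

section SicEvolution

variable {m : ℕ} {U : Set (EuclideanSpace ℝ (Fin m))}
  {p u : EuclideanSpace ℝ (Fin m)}

section Static

variable {G : EuclideanSpace ℝ (Fin m) → Matrix (Fin m) (Fin m) ℝ}
  {F : EuclideanSpace ℝ (Fin m) → ℝ}

/-- Second partial derivatives of the endomorphism `Sic`. -/
noncomputable def sicEnd2 (G : EuclideanSpace ℝ (Fin m) → Matrix (Fin m) (Fin m) ℝ)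
    (F : EuclideanSpace ℝ (Fin m) → ℝ) (a : ℝ) (p : EuclideanSpace ℝ (Fin m))
    (k l i j : Fin m) : ℝ :=
  pd k (fun v => pd l (fun w => sicEnd G F a w i j) v) p

theorem NormalAt.sicEnd_eq (hn : NormalAt G p) (F : EuclideanSpace ℝ (Fin m) → ℝ) (a : ℝ)
    (i j : Fin m) : sicEnd G F a p i j = sic G F a p i j := by
  simp [sicEnd, hn.eq_one]

theorem NormalAt.pd_pd_sic (hn : NormalAt G p) (h : MetricOn U G) (hp : p ∈ U)
    (hF : ContDiffOn ℝ ∞ F U) (a : ℝ) (k l i j : Fin m) :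
    pd k (fun v => pd l (fun w => sic G F a w i j) v) p
      = ∑ q, metric2 G p k l i q * sic G F a p q j + sicEnd2 G F a p k l i j := by
  have e1 := congrFun (congrFun (hn.mpd_mpd_mul_metric h hp (h.smooth_sicEnd hF a) k l) i) j
  have e2 : mpd k (fun w => mpd l (fun v => G v * sicEnd G F a v) w) p i j
      = pd k (fun v => pd l (fun w => sic G F a w i j) v) p :=
    pd_congr k h.isOpen hp fun v hv => pd_congr l h.isOpen hv fun w hw =>
      congrFun (congrFun (h.mul_sicEnd hw F a) i) j
  rw [← e2, e1, Matrix.add_apply, Matrix.mul_apply]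
  simp only [hn.sicEnd_eq]
  rfl

theorem MetricOn.sicEnd2_comm (h : MetricOn U G) (hp : p ∈ U)
    (hF : ContDiffOn ℝ ∞ F U) (a : ℝ) (k l i j : Fin m) :
    sicEnd2 G F a p k l i j = sicEnd2 G F a p l k i j :=
  pd_comm h.isOpen (h.smooth_sicEnd hF a i j) hp k l

/-- One more derivative of the contracted Bianchi identity. As Γ vanishes at `p`, the connection
terms contribute only through ∂Γ. It serves to eliminate derivatives of the divergence from the
evolution of Ric. -/
theorem NormalAt.pd_bianchi (hn : NormalAt G p) (h : MetricOn U G) (hp : p ∈ U)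
    (hF : ContDiffOn ℝ ∞ F U) (a : ℝ) (i j : Fin m) :
    ∑ k, sicEnd2 G F a p i k k j
      + ∑ k, ∑ l, pd i (fun v => christoffel G v k k l) p * sic G F a p l j
      - ∑ k, ∑ l, sic G F a p k l * pd i (fun v => christoffel G v l k j) p
      = (1 / 2) * ∑ k, sicEnd2 G F a p i j k k
        - a * (pd i (lap G F) p * pd j F p + lap G F p * pd i (fun v => pd j F v) p) := by
  have hA := h.smooth_sicEnd hF a
  have hL : ContDiffOn ℝ ∞ (lap G F) U := h.smooth_lap hF
  have key := pd_congr i h.isOpen hp fun v hv => h.bianchi hv hF a j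
  have hS : ContDiffOn ℝ ∞ (fun v => pd j (sicTrace G F a) v) U :=
    smooth_pd h.isOpen (ContDiffOn.congr (ContDiffOn.sum fun k _ => h.smooth_sicEnd hF a k k)
      fun v hv => h.sicTrace_eq hv F a) j
  have dS := differentiableAt_of_smooth h.isOpen hS hp
  have dL := differentiableAt_of_smooth h.isOpen hL hp
  have dF := differentiableAt_of_smooth h.isOpen (smooth_pd h.isOpen hF j) hp
  have hN : ∀ k, MSmooth U (fun v => chr G k v * sicEnd G F a v) := fun k => (h.smooth_chr k).mul hA
  have hN' : ∀ k, MSmooth U (fun v => sicEnd G F a v * chr G k v) := fun k =>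
    hA.mul (h.smooth_chr k)
  have dA : ∀ k, DifferentiableAt ℝ (fun v => pd k (fun w => sicEnd G F a w k j) v) p := fun k =>
    differentiableAt_of_smooth h.isOpen (smooth_pd h.isOpen (hA k j) k) hp
  have dN : ∀ k, DifferentiableAt ℝ (fun v => (chr G k v * sicEnd G F a v) k j) p := fun k =>
    differentiableAt_of_smooth h.isOpen (hN k k j) hp
  have dN' : ∀ k, DifferentiableAt ℝ (fun v => (sicEnd G F a v * chr G k v) k j) p := fun k =>
    differentiableAt_of_smooth h.isOpen (hN' k k j) hp
  have eR : pd i (fun v => (1 / 2) * pd j (sicTrace G F a) v - a * lap G F v * pd j F v) p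
      = (1 / 2) * ∑ k, sicEnd2 G F a p i j k k
        - a * (pd i (lap G F) p * pd j F p + lap G F p * pd i (fun v => pd j F v) p) := by
    have e1 : pd i (fun v => pd j (sicTrace G F a) v) p = ∑ k, sicEnd2 G F a p i j k k := by
      rw [pd_congr i h.isOpen hp fun v hv => h.pd_sicTrace hv hF a j]
      exact pd_sum i _ (f := fun k v => pd j (fun w => sicEnd G F a w k k) v) fun k _ =>
        differentiableAt_of_smooth h.isOpen (smooth_pd h.isOpen (hA k k) j) hp
    rw [pd_sub i (dS.const_mul _) ((dL.const_mul a).fun_mul dF), pd_const_mul i _ dS, e1,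
      pd_mul i (dL.const_mul a) dF, pd_const_mul i _ dL]
    ring
  have eN : ∀ k, pd i (fun v => nabla G (sicEnd G F a) k v k j) p = sicEnd2 G F a p i k k j
      + (∑ l, pd i (fun v => christoffel G v k k l) p * sic G F a p l j
      - ∑ l, sic G F a p k l * pd i (fun v => christoffel G v l k j) p) := by
    intro k
    have e1 : pd i (fun v => (chr G k v * sicEnd G F a v) k j) p
        = ∑ l, pd i (fun v => christoffel G v k k l) p * sic G F a p l j := by
      have := congrFun (congrFun (mpd_mul i h.isOpen hp (h.smooth_chr k) hA) k) j
      rw [hn.chr_eq, Matrix.zero_mul, add_zero, Matrix.mul_apply] at this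
      simp only [hn.sicEnd_eq] at this
      exact this
    have e2 : pd i (fun v => (sicEnd G F a v * chr G k v) k j) p
        = ∑ l, sic G F a p k l * pd i (fun v => christoffel G v l k j) p := by
      have := congrFun (congrFun (mpd_mul i h.isOpen hp hA (h.smooth_chr k)) k) j
      rw [hn.chr_eq, Matrix.mul_zero, zero_add, Matrix.mul_apply] at this
      simp only [hn.sicEnd_eq] at this
      exact this
    rw [← e1, ← e2, ← pd_sub i (dN k) (dN' k)]
    exact pd_add i (dA k) ((dN k).fun_sub (dN' k))
  have dNab : ∀ k, DifferentiableAt ℝ (fun v => nabla G (sicEnd G F a) k v k j) p := fun k =>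
    (dA k).fun_add ((dN k).fun_sub (dN' k))
  rw [eR, pd_sum i _ (f := fun k v => nabla G (sicEnd G F a) k v k j) fun k _ => dNab k] at key
  simp only [eN, Finset.sum_add_distrib, Finset.sum_sub_distrib] at key
  rw [← key]; ring

theorem NormalAt.pd_christoffel' (hn : NormalAt G p) (h : MetricOn U G) (hp : p ∈ U)
    (a k i j : Fin m) : pd a (fun v => christoffel G v k i j) p
      = (1 / 2) * (metric2 G p a i j k + metric2 G p a j i k - metric2 G p a k i j) :=
  hn.pd_christoffel h hp a k i j

theorem NormalAt.riem_eq (hn : NormalAt G p) (i j k l : Fin m) :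
    riem G p i j k l = pd i (fun v => christoffel G v l j k) p
      - pd j (fun v => christoffel G v l i k) p := by
  rw [RicciHarmonic.riem_eq, hn.eq_one, Matrix.one_mul, hn.curv_eq]; rfl

theorem NormalAt.sum_riem (hn : NormalAt G p) (h : MetricOn U G) (hp : p ∈ U)
    (k l : Fin m) : ∑ i, riem G p k i i l = ricci G p k l := by
  rw [hn.ricci_eq_metric2 h hp]
  refine Finset.sum_congr rfl fun i _ => ?_
  rw [hn.riem_eq, hn.pd_christoffel' h hp, hn.pd_christoffel' h hp, h.metric2_comm hp i k l i,
    h.metric2_comm hp i k i l, h.metric2_symm hp k i l i]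
  ring

/-- The correction terms that arise because second derivatives in normal coordinates are not
covariant derivatives. -/
noncomputable def corr (G : EuclideanSpace ℝ (Fin m) → Matrix (Fin m) (Fin m) ℝ)
    (p : EuclideanSpace ℝ (Fin m)) (i l : Fin m) : ℝ :=
  ∑ k, (metric2 G p k k i l - metric2 G p i k k l + (1 / 2) * metric2 G p i l k k)

/-- The correction terms for the second index. -/
noncomputable def corr' (G : EuclideanSpace ℝ (Fin m) → Matrix (Fin m) (Fin m) ℝ)
    (p : EuclideanSpace ℝ (Fin m)) (i l : Fin m) : ℝ :=
  ∑ k, ((1 / 2) * metric2 G p i l k k - metric2 G p i k k l)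

/-- The sum of the two corrections is −2Ric plus a part antisymmetric in its two indices, which a
symmetric tensor annihilates. In this way the non-tensorial terms leave the evolution equations of
scalars. -/
theorem NormalAt.sum_corr (hn : NormalAt G p) (h : MetricOn U G) (hp : p ∈ U)
    (q : Fin m → Fin m → ℝ) (hq : ∀ i l, q i l = q l i) :
    ∑ i, ∑ l, (corr G p i l + corr' G p i l) * q i l = -2 * ∑ i, ∑ l, ricci G p i l * q i l := by
  have e1 : ∀ i l, corr G p i l + corr' G p i l = -2 * ricci G p i l
      + ∑ k, (metric2 G p l k k i - metric2 G p i k k l) := by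
    intro i l
    rw [corr, corr', hn.ricci_eq_metric2 h hp, ← Finset.sum_add_distrib, Finset.mul_sum,
      ← Finset.sum_add_distrib]
    refine Finset.sum_congr rfl fun k _ => ?_
    rw [h.metric2_comm hp k i l k, h.metric2_comm hp k l i k, h.metric2_symm hp i k l k,
      h.metric2_symm hp l k i k]
    ring
  have e2 : ∑ i, ∑ l, (∑ k, metric2 G p l k k i) * q i l
      = ∑ i, ∑ l, (∑ k, metric2 G p i k k l) * q i l := by
    rw [Finset.sum_comm]
    exact Finset.sum_congr rfl fun i _ => Finset.sum_congr rfl fun l _ => by rw [hq]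
  simp only [e1, add_mul, Finset.sum_add_distrib, Finset.sum_sub_distrib, sub_mul, e2, sub_self,
    add_zero, Finset.mul_sum, mul_assoc]

end Static

variable {I : Set ℝ} {α : ℝ → ℝ}
  {G : ℝ → EuclideanSpace ℝ (Fin m) → Matrix (Fin m) (Fin m) ℝ}
  {F : ℝ → EuclideanSpace ℝ (Fin m) → ℝ} {t α' : ℝ}

/-- Sic is written as g times an endomorphism, so its second partials are those of the endomorphism
plus ∂∂g terms. The former reduce, through Bianchi, to a plain Laplacian and terms in φ; the latter
form the curvature action and the corrections. -/
theorem LocalFlow.hasDerivAt_ricci' (hf : LocalFlow U I α G F) (ht : t ∈ I) (hp : p ∈ U)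
    (hn : NormalAt (G t) p) (i j : Fin m) :
    HasDerivAt (fun s => ricci (G s) p i j)
      (∑ k, sicEnd2 (G t) (F t) (α t) p k k i j
        + α t * (2 * lap (G t) (F t) p * pd i (fun v => pd j (F t) v) p
          + pd i (lap (G t) (F t)) p * pd j (F t) p + pd i (F t) p * pd j (lap (G t) (F t)) p)
        + 2 * ∑ k, ∑ l, sic (G t) (F t) (α t) p k l * riem (G t) p k i j l
        + ∑ l, corr (G t) p i l * sic (G t) (F t) (α t) p l j
        + ∑ l, corr' (G t) p j l * sic (G t) (F t) (α t) p l i) t := by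
  have h := hf.metricOn ht
  have hF := hf.smooth_map.slice ht
  have hU := hf.family.isOpen
  refine (hf.hasDerivAt_ricci ht hp hn i j).congr_deriv ?_
  set σ := sic (G t) (F t) (α t) with hσ
  set A2 := sicEnd2 (G t) (F t) (α t) p with hA2
  set G2 := metric2 (G t) p with hG2
  have hσs : ∀ i j, ContDiffOn ℝ ∞ (fun v => σ v i j) U := h.smooth_sic hF (α t)
  have hsym : ∀ i j, σ p i j = σ p j i := h.sic_symm hp _ _
  have hP : ∀ a b i j, pd a (fun v => pd b (fun w => σ w i j) v) p
      = ∑ q, G2 a b i q * σ p q j + A2 a b i j := hn.pd_pd_sic h hp hF _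
  have hPs : ∀ a b i j, pd a (fun v => pd b (fun w => σ w i j) v) p
      = pd a (fun v => pd b (fun w => σ w j i) v) p := fun a b i j =>
    pd_congr a hU hp fun v hv => pd_congr b hU hv fun w hw => h.sic_symm hw _ _ i j
  have hPc : ∀ a b i j, pd a (fun v => pd b (fun w => σ w i j) v) p
      = pd b (fun v => pd a (fun w => σ w i j) v) p := fun a b i j =>
    pd_comm hU (hσs i j) hp a b
  have e1 : ∀ k, pd k (fun v => koszulOf σ i v k j) p
      = (∑ q, G2 i k k q * σ p q j + A2 i k k j) + (∑ q, G2 j k k q * σ p q i + A2 j k k i)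
        - (∑ q, G2 k k i q * σ p q j + A2 k k i j) := by
    intro k
    rw [pd_koszulOf hU hσs hp, hPs k i j k, hPc k i k j, hPs k j i k, hPc k j k i, hP, hP, hP]
  have e2 : ∀ k, pd i (fun v => koszulOf σ k v k j) p
      = ∑ q, G2 i j k q * σ p q k + A2 i j k k := by
    intro k
    rw [pd_koszulOf hU hσs hp, hPs i k j k, hP i j k k]
    ring
  have c1 : ∀ i j, ∑ k, ∑ l, σ p k l * pd i (fun v => christoffel (G t) v l k j) p
      = (1 / 2) * ∑ k, ∑ l, G2 i j k l * σ p l k := by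
    intro i j
    have e : ∑ k, ∑ l, σ p k l * G2 i k j l = ∑ k, ∑ l, σ p k l * G2 i l k j := by
      rw [Finset.sum_comm]
      refine Finset.sum_congr rfl fun k _ => Finset.sum_congr rfl fun l _ => ?_
      rw [hsym, hG2, h.metric2_symm hp i l j k]
    have e' : ∀ k l, σ p k l * pd i (fun v => christoffel (G t) v l k j) p
        = (1 / 2) * (G2 i j k l * σ p l k) + ((1 / 2) * (σ p k l * G2 i k j l)
          - (1 / 2) * (σ p k l * G2 i l k j)) := by
      intro k l
      rw [hn.pd_christoffel' h hp, hsym l k]; ring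
    simp only [e', Finset.sum_add_distrib, Finset.sum_sub_distrib, ← Finset.mul_sum, e]
    ring
  have c2 : ∀ i j, ∑ k, ∑ l, pd i (fun v => christoffel (G t) v k k l) p * σ p l j
      = (1 / 2) * ∑ k, ∑ l, G2 i l k k * σ p l j := by
    intro i j
    simp only [Finset.mul_sum]
    refine Finset.sum_congr rfl fun k _ => Finset.sum_congr rfl fun l _ => ?_
    rw [hn.pd_christoffel' h hp, h.metric2_symm hp i k l k]; ring
  -- The variation of Ric contains derivatives of div Sic in both index orders. The two halves of
  -- ∂ᵢ∂ⱼS obtained this way cancel the trace term from `e2`.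
  have b1 := hn.pd_bianchi h hp hF (α t) i j
  have b2 := hn.pd_bianchi h hp hF (α t) j i
  rw [← hσ, ← hA2, c1, c2] at b1 b2
  have hA2c : ∑ k, A2 j i k k = ∑ k, A2 i j k k :=
    Finset.sum_congr rfl fun k _ => h.sicEnd2_comm hp hF _ j i k k
  have hG2c : ∑ k, ∑ l, G2 j i k l * σ p l k = ∑ k, ∑ l, G2 i j k l * σ p l k :=
    Finset.sum_congr rfl fun k _ => Finset.sum_congr rfl fun l _ => by
      rw [hG2, h.metric2_comm hp j i]
  rw [hA2c, hG2c, pd_comm hU hF hp j i] at b2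
  have r1 : ∀ i j, ∑ l, corr (G t) p i l * σ p l j
      = ∑ k, ∑ l, G2 k k i l * σ p l j - ∑ k, ∑ l, G2 i k k l * σ p l j
        + (1 / 2) * ∑ k, ∑ l, G2 i l k k * σ p l j := by
    intro i j
    simp only [corr, Finset.sum_mul]
    rw [Finset.sum_comm]
    simp only [← hG2, add_mul, sub_mul, Finset.sum_add_distrib, Finset.sum_sub_distrib, Finset.mul_sum,
      mul_assoc]
  have r2 : ∀ i j, ∑ l, corr' (G t) p i l * σ p l j
      = (1 / 2) * ∑ k, ∑ l, G2 i l k k * σ p l j - ∑ k, ∑ l, G2 i k k l * σ p l j := by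
    intro i j
    simp only [corr', Finset.sum_mul]
    rw [Finset.sum_comm]
    simp only [← hG2, sub_mul, Finset.sum_sub_distrib, Finset.mul_sum, mul_assoc]
  rw [r1, r2]
  simp only [hn.riem_eq, e1, e2, mul_sub, Finset.sum_sub_distrib,
    Finset.sum_add_distrib, ← Finset.mul_sum, c1]
  linarith

/-- The evolution of `Sic` in normal coordinates. -/
theorem LocalFlow.hasDerivAt_sic (hf : LocalFlow U I α G F) (ht : t ∈ I) (hp : p ∈ U)
    (hn : NormalAt (G t) p) (hα : HasDerivAt α α' t) (i j : Fin m) :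
    HasDerivAt (fun s => sic (G s) (F s) (α s) p i j)
      (∑ k, sicEnd2 (G t) (F t) (α t) p k k i j
        + 2 * α t * lap (G t) (F t) p * hess (G t) (F t) p i j
        - α' * (pd i (F t) p * pd j (F t) p)
        + 2 * ∑ k, ∑ l, sic (G t) (F t) (α t) p k l * riem (G t) p k i j l
        + ∑ l, corr (G t) p i l * sic (G t) (F t) (α t) p l j
        + ∑ l, corr' (G t) p j l * sic (G t) (F t) (α t) p l i) t := by
  -- The product rule for α dφ⊗dφ yields α(dΔφ⊗dφ + dφ⊗dΔφ), which cancels the third-order terms in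
  -- φ coming from Bianchi.
  refine ((hf.hasDerivAt_ricci' ht hp hn i j).fun_sub (hα.fun_mul
    ((hf.hasDerivAt_pd_map ht hp i).fun_mul (hf.hasDerivAt_pd_map ht hp j)))).congr_deriv ?_
  rw [hn.hess_eq]
  ring

end SicEvolution

/-! ### Evolution of S, |Sic|² and |∇φ|². -/

section ScalarEvolution

variable {m : ℕ} {U : Set (EuclideanSpace ℝ (Fin m))}
  {p u : EuclideanSpace ℝ (Fin m)}

/-- The squared norm `|Sic|²`. -/
noncomputable def sicSq (G : EuclideanSpace ℝ (Fin m) → Matrix (Fin m) (Fin m) ℝ)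
    (F : EuclideanSpace ℝ (Fin m) → ℝ) (a : ℝ) (u : EuclideanSpace ℝ (Fin m)) : ℝ :=
  ∑ i, ∑ j, sicEnd G F a u i j * sicEnd G F a u j i

section Static

variable {G : EuclideanSpace ℝ (Fin m) → Matrix (Fin m) (Fin m) ℝ}
  {F : EuclideanSpace ℝ (Fin m) → ℝ}

theorem MetricOn.smooth_sicTrace (h : MetricOn U G) (hF : ContDiffOn ℝ ∞ F U) (a : ℝ) :
    ContDiffOn ℝ ∞ (sicTrace G F a) U :=
  ContDiffOn.congr (ContDiffOn.sum fun k _ => h.smooth_sicEnd hF a k k)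
    fun _ hv => h.sicTrace_eq hv F a

theorem MetricOn.smooth_sicSq (h : MetricOn U G) (hF : ContDiffOn ℝ ∞ F U) (a : ℝ) :
    ContDiffOn ℝ ∞ (sicSq G F a) U :=
  ContDiffOn.sum fun i _ => ContDiffOn.sum fun j _ =>
    (h.smooth_sicEnd hF a i j).mul (h.smooth_sicEnd hF a j i)

theorem MetricOn.pd_sicSq (h : MetricOn U G) (hu : u ∈ U) (hF : ContDiffOn ℝ ∞ F U) (a : ℝ)
    (k : Fin m) : pd k (sicSq G F a) u
      = 2 * ∑ i, ∑ j, sicEnd G F a u i j * pd k (fun v => sicEnd G F a v j i) u := by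
  have hA := h.smooth_sicEnd hF a
  have dA : ∀ i j, DifferentiableAt ℝ (fun v => sicEnd G F a v i j) u := fun i j =>
    differentiableAt_of_smooth h.isOpen (hA i j) hu
  have e : pd k (sicSq G F a) u = ∑ i, ∑ j,
      (pd k (fun v => sicEnd G F a v i j) u * sicEnd G F a u j i
        + sicEnd G F a u i j * pd k (fun v => sicEnd G F a v j i) u) := by
    rw [show sicSq G F a = fun v => ∑ i, ∑ j, sicEnd G F a v i j * sicEnd G F a v j i from rfl,
      pd_sum k _ (f := fun i v => ∑ j, sicEnd G F a v i j * sicEnd G F a v j i) fun i _ =>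
      DifferentiableAt.fun_sum fun j _ => (dA i j).fun_mul (dA j i)]
    refine Finset.sum_congr rfl fun i _ => ?_
    rw [pd_sum k _ (f := fun j v => sicEnd G F a v i j * sicEnd G F a v j i) fun j _ =>
      (dA i j).fun_mul (dA j i)]
    exact Finset.sum_congr rfl fun j _ => pd_mul k (dA i j) (dA j i)
  have e2 : ∑ i, ∑ j, pd k (fun v => sicEnd G F a v i j) u * sicEnd G F a u j i
      = ∑ i, ∑ j, sicEnd G F a u i j * pd k (fun v => sicEnd G F a v j i) u := by
    rw [Finset.sum_comm]
    exact Finset.sum_congr rfl fun i _ => Finset.sum_congr rfl fun j _ => mul_comm _ _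
  rw [e]
  simp only [Finset.sum_add_distrib, e2]
  ring

theorem NormalAt.pd_sicEnd_symm (hn : NormalAt G p) (h : MetricOn U G) (hp : p ∈ U)
    (hF : ContDiffOn ℝ ∞ F U) (a : ℝ) (k i j : Fin m) :
    pd k (fun v => sicEnd G F a v i j) p = pd k (fun v => sicEnd G F a v j i) p := by
  have e := hn.mpd_sicEnd h hp hF a
  simp only [mpd_apply] at e
  rw [e, e]
  exact pd_congr k h.isOpen hp fun v hv => h.sic_symm hv F a i j

theorem NormalAt.pd_pd_sicSq (hn : NormalAt G p) (h : MetricOn U G) (hp : p ∈ U)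
    (hF : ContDiffOn ℝ ∞ F U) (a : ℝ) (k : Fin m) :
    pd k (fun v => pd k (sicSq G F a) v) p
      = 2 * ∑ i, ∑ j, sic G F a p i j * sicEnd2 G F a p k k i j
        + 2 * ∑ i, ∑ j, pd k (fun v => sicEnd G F a v i j) p ^ 2 := by
  have hA := h.smooth_sicEnd hF a
  have dA : ∀ i j, DifferentiableAt ℝ (fun v => sicEnd G F a v i j) p := fun i j =>
    differentiableAt_of_smooth h.isOpen (hA i j) hp
  have dA' : ∀ i j, DifferentiableAt ℝ (fun v => pd k (fun w => sicEnd G F a w i j) v) p :=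
    fun i j => differentiableAt_of_smooth h.isOpen (smooth_pd h.isOpen (hA i j) k) hp
  have dS : ∀ i, DifferentiableAt ℝ (fun v => ∑ j, sicEnd G F a v i j
      * pd k (fun w => sicEnd G F a w j i) v) p := fun i =>
    DifferentiableAt.fun_sum fun j _ => (dA i j).fun_mul (dA' j i)
  rw [pd_congr k h.isOpen hp fun v hv => h.pd_sicSq hv hF a k,
    pd_const_mul k _ (DifferentiableAt.fun_sum fun i _ => dS i),
    pd_sum k _ (f := fun i v => ∑ j, sicEnd G F a v i j
      * pd k (fun w => sicEnd G F a w j i) v) fun i _ => dS i]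
  have e1 : ∀ i, pd k (fun v => ∑ j, sicEnd G F a v i j * pd k (fun w => sicEnd G F a w j i) v) p
      = ∑ j, pd k (fun v => sicEnd G F a v i j) p ^ 2
        + ∑ j, sic G F a p i j * sicEnd2 G F a p k k j i := by
    intro i
    rw [pd_sum k _ (f := fun j v => sicEnd G F a v i j * pd k (fun w => sicEnd G F a w j i) v)
      fun j _ => (dA i j).fun_mul (dA' j i), ← Finset.sum_add_distrib]
    refine Finset.sum_congr rfl fun j _ => ?_
    rw [pd_mul k (dA i j) (dA' j i), hn.sicEnd_eq, hn.pd_sicEnd_symm h hp hF a k j i, sq]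
    rfl
  have e2 : ∑ i, ∑ j, sic G F a p i j * sicEnd2 G F a p k k j i
      = ∑ i, ∑ j, sic G F a p i j * sicEnd2 G F a p k k i j := by
    rw [Finset.sum_comm]
    exact Finset.sum_congr rfl fun i _ => Finset.sum_congr rfl fun j _ => by
      rw [h.sic_symm hp F a j i]
  simp only [e1, Finset.sum_add_distrib, e2]
  ring

theorem MetricOn.pd_pd_sicTrace (h : MetricOn U G) (hp : p ∈ U)
    (hF : ContDiffOn ℝ ∞ F U) (a : ℝ) (k l : Fin m) :
    pd k (fun v => pd l (sicTrace G F a) v) p = ∑ i, sicEnd2 G F a p k l i i := by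
  have hA := h.smooth_sicEnd hF a
  rw [pd_congr k h.isOpen hp fun v hv => h.pd_sicTrace hv hF a l]
  exact pd_sum k _ (f := fun i v => pd l (fun w => sicEnd G F a w i i) v) fun i _ =>
    differentiableAt_of_smooth h.isOpen (smooth_pd h.isOpen (hA i i) l) hp

/-- `∂_k ∂_l` of the inverse metric in normal coordinates. -/
theorem NormalAt.pd_pd_inv (hn : NormalAt G p) (h : MetricOn U G) (hp : p ∈ U) (k l i j : Fin m) :
    pd k (fun v => pd l (fun w => (G w)⁻¹ i j) v) p = -metric2 G p k l i j := by
  have e1 := congrFun (congrFun (hn.mpd_mpd_mul_metric h hp h.smooth_inv k l) i) j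
  have e2 : mpd k (fun w => mpd l (fun v => G v * (G v)⁻¹) w) p i j = 0 := by
    have : ∀ v ∈ U, mpd l (fun v => G v * (G v)⁻¹) v i j = 0 := fun v hv => by
      rw [mpd_apply, pd_congr l h.isOpen hv (g := fun _ => (1 : Matrix (Fin m) (Fin m) ℝ) i j)
        fun w hw => by rw [h.mul_inv hw], pd_const]
    rw [mpd_apply, pd_congr k h.isOpen hp this, pd_const]
  rw [e2, hn.eq_one, inv_one, Matrix.mul_one, Matrix.add_apply] at e1
  have e3 : mpd k (fun w => mpd l G w) p i j = metric2 G p k l i j := rfl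
  have e4 : mpd k (fun w => mpd l (fun v => (G v)⁻¹) w) p i j
      = pd k (fun v => pd l (fun w => (G w)⁻¹ i j) v) p := rfl
  rw [← e4]; linarith

theorem NormalAt.pd_inv (hn : NormalAt G p) (h : MetricOn U G) (hp : p ∈ U) (l i j : Fin m) :
    pd l (fun w => (G w)⁻¹ i j) p = 0 := by
  have e1 := congrFun (congrFun (hn.mpd_mul_metric h hp h.smooth_inv l) i) j
  rw [mpd_apply, pd_congr l h.isOpen hp (g := fun _ => (1 : Matrix (Fin m) (Fin m) ℝ) i j)
        fun w hw => by rw [h.mul_inv hw], pd_const] at e1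
  exact e1.symm

theorem NormalAt.pd_pd_gradSq (hn : NormalAt G p) (h : MetricOn U G) (hp : p ∈ U)
    (hF : ContDiffOn ℝ ∞ F U) (k : Fin m) :
    pd k (fun v => pd k (gradSq G F) v) p
      = -∑ i, ∑ j, metric2 G p k k i j * (pd i F p * pd j F p)
        + 2 * ∑ i, pd i F p * pd k (fun v => pd k (fun w => pd i F w) v) p
        + 2 * ∑ i, hess G F p k i ^ 2 := by
  have hU := h.isOpen
  have sH : ∀ i j, ContDiffOn ℝ ∞ (fun v => (G v)⁻¹ i j) U := h.smooth_inv
  have sV : ∀ i, ContDiffOn ℝ ∞ (fun v => pd i F v) U := smooth_pd hU hF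
  have dH : ∀ v ∈ U, ∀ i j, DifferentiableAt ℝ (fun v => (G v)⁻¹ i j) v := fun v hv i j =>
    differentiableAt_of_smooth hU (sH i j) hv
  have dV : ∀ v ∈ U, ∀ i, DifferentiableAt ℝ (fun v => pd i F v) v := fun v hv i =>
    differentiableAt_of_smooth hU (sV i) hv
  have dH' : ∀ i j, DifferentiableAt ℝ (fun v => pd k (fun v => (G v)⁻¹ i j) v) p := fun i j =>
    differentiableAt_of_smooth hU (smooth_pd hU (sH i j) k) hp
  have dV' : ∀ i, DifferentiableAt ℝ (fun v => pd k (fun v => pd i F v) v) p := fun i =>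
    differentiableAt_of_smooth hU (smooth_pd hU (sV i) k) hp
  have e1 : ∀ v ∈ U, pd k (gradSq G F) v = ∑ i, ∑ j, (pd k (fun v => (G v)⁻¹ i j) v
      * (pd i F v * pd j F v) + (G v)⁻¹ i j * (pd k (fun v => pd i F v) v * pd j F v
        + pd i F v * pd k (fun v => pd j F v) v)) := by
    intro v hv
    have d : ∀ i j, DifferentiableAt ℝ (fun v => (G v)⁻¹ i j * (pd i F v * pd j F v)) v :=
      fun i j => (dH v hv i j).fun_mul ((dV v hv i).fun_mul (dV v hv j))
    rw [show gradSq G F = fun v => ∑ i, ∑ j, (G v)⁻¹ i j * (pd i F v * pd j F v) from rfl,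
      pd_sum k _ (f := fun i v => ∑ j, (G v)⁻¹ i j * (pd i F v * pd j F v)) fun i _ =>
        DifferentiableAt.fun_sum fun j _ => d i j]
    refine Finset.sum_congr rfl fun i _ => ?_
    rw [pd_sum k _ (f := fun j v => (G v)⁻¹ i j * (pd i F v * pd j F v)) fun j _ => d i j]
    refine Finset.sum_congr rfl fun j _ => ?_
    rw [pd_mul k (dH v hv i j) ((dV v hv i).fun_mul (dV v hv j)), pd_mul k (dV v hv i) (dV v hv j)]
  have d1 : ∀ i j, DifferentiableAt ℝ (fun v => pd k (fun v => (G v)⁻¹ i j) v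
      * (pd i F v * pd j F v)) p := fun i j =>
    (dH' i j).fun_mul ((dV p hp i).fun_mul (dV p hp j))
  have d2 : ∀ i j, DifferentiableAt ℝ (fun v => pd k (fun v => pd i F v) v * pd j F v
        + pd i F v * pd k (fun v => pd j F v) v) p := fun i j =>
    ((dV' i).fun_mul (dV p hp j)).fun_add ((dV p hp i).fun_mul (dV' j))
  have d3 : ∀ i j, DifferentiableAt ℝ (fun v => pd k (fun v => (G v)⁻¹ i j) v
      * (pd i F v * pd j F v) + (G v)⁻¹ i j * (pd k (fun v => pd i F v) v * pd j F v
        + pd i F v * pd k (fun v => pd j F v) v)) p := fun i j =>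
    (d1 i j).fun_add ((dH p hp i j).fun_mul (d2 i j))
  have e2 : ∀ i j, pd k (fun v => pd k (fun v => (G v)⁻¹ i j) v
      * (pd i F v * pd j F v) + (G v)⁻¹ i j * (pd k (fun v => pd i F v) v * pd j F v
        + pd i F v * pd k (fun v => pd j F v) v)) p
      = -(metric2 G p k k i j * (pd i F p * pd j F p))
        + (if i = j then 2 * (pd i F p * pd k (fun v => pd k (fun w => pd i F w) v) p)
          + 2 * hess G F p k i ^ 2 else 0) := by
    intro i j
    rw [pd_add k (d1 i j) ((dH p hp i j).fun_mul (d2 i j)),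
      pd_mul k (dH' i j) ((dV p hp i).fun_mul (dV p hp j)), pd_mul k (dH p hp i j) (d2 i j),
      hn.pd_pd_inv h hp, hn.pd_inv h hp, hn.eq_one, inv_one,
      pd_add k ((dV' i).fun_mul (dV p hp j)) ((dV p hp i).fun_mul (dV' j)),
      pd_mul k (dV' i) (dV p hp j), pd_mul k (dV p hp i) (dV' j), hn.hess_eq, Matrix.one_apply]
    split_ifs with hij
    · subst hij; ring
    · ring
  rw [pd_congr k hU hp e1, pd_sum k _ (f := fun i v => ∑ j, (pd k (fun v => (G v)⁻¹ i j) v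
      * (pd i F v * pd j F v) + (G v)⁻¹ i j * (pd k (fun v => pd i F v) v * pd j F v
        + pd i F v * pd k (fun v => pd j F v) v))) fun i _ =>
      DifferentiableAt.fun_sum fun j _ => d3 i j]
  have e3 : ∀ i, pd k (fun v => ∑ j, (pd k (fun v => (G v)⁻¹ i j) v
      * (pd i F v * pd j F v) + (G v)⁻¹ i j * (pd k (fun v => pd i F v) v * pd j F v
        + pd i F v * pd k (fun v => pd j F v) v))) p
      = -∑ j, metric2 G p k k i j * (pd i F p * pd j F p)
        + (2 * (pd i F p * pd k (fun v => pd k (fun w => pd i F w) v) p)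
          + 2 * hess G F p k i ^ 2) := by
    intro i
    rw [pd_sum k _ (f := fun j v => pd k (fun v => (G v)⁻¹ i j) v
      * (pd i F v * pd j F v) + (G v)⁻¹ i j * (pd k (fun v => pd i F v) v * pd j F v
        + pd i F v * pd k (fun v => pd j F v) v)) fun j _ => d3 i j]
    simp only [e2, Finset.sum_add_distrib, Finset.sum_neg_distrib, Finset.sum_ite_eq,
      Finset.mem_univ, if_true]
  rw [Finset.sum_congr rfl fun i _ => e3 i]
  simp only [Finset.sum_add_distrib, Finset.sum_neg_distrib, ← Finset.mul_sum]
  ring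

/-- Third partials of φ commute freely, so the curvature of the Bochner formula is contained in the
∂Γ term. -/
theorem NormalAt.pd_lap (hn : NormalAt G p) (h : MetricOn U G) (hp : p ∈ U)
    (hF : ContDiffOn ℝ ∞ F U) (i : Fin m) :
    pd i (lap G F) p = ∑ k, pd k (fun v => pd k (fun w => pd i F w) v) p
      - ∑ k, ∑ l, pd i (fun v => christoffel G v l k k) p * pd l F p := by
  have hU := h.isOpen
  have sH : ∀ i j, ContDiffOn ℝ ∞ (fun v => (G v)⁻¹ i j) U := h.smooth_inv
  have sV : ∀ i, ContDiffOn ℝ ∞ (fun v => pd i F v) U := smooth_pd hU hF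
  have sC : ∀ k i j, ContDiffOn ℝ ∞ (fun v => christoffel G v k i j) U := fun k i j =>
    h.smooth_chr i k j
  have d1 : ∀ i j, DifferentiableAt ℝ (fun v => pd i (fun v => pd j F v) v) p := fun i j =>
    differentiableAt_of_smooth hU (smooth_pd hU (sV j) i) hp
  have dC : ∀ k i j, DifferentiableAt ℝ (fun v => christoffel G v k i j * pd k F v) p :=
    fun k i j => differentiableAt_of_smooth hU ((sC k i j).mul (sV k)) hp
  have dc : ∀ k i j, DifferentiableAt ℝ (fun v => christoffel G v k i j) p :=
    fun k i j => differentiableAt_of_smooth hU (sC k i j) hp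
  have dv : ∀ k, DifferentiableAt ℝ (fun v => pd k F v) p :=
    fun k => differentiableAt_of_smooth hU (sV k) hp
  have dh : ∀ i j, DifferentiableAt ℝ (fun v => hess G F v i j) p := fun i j =>
    (d1 i j).fun_sub (DifferentiableAt.fun_sum fun k _ => dC k i j)
  have dH : ∀ i j, DifferentiableAt ℝ (fun v => (G v)⁻¹ i j) p := fun i j =>
    differentiableAt_of_smooth hU (sH i j) hp
  have hz : ∀ k i j, christoffel G p k i j = 0 :=
    fun k i j => congrFun (congrFun (hn.chr_eq i) k) j
  have e1 : ∀ k, pd i (fun v => hess G F v k k) p = pd k (fun v => pd k (fun w => pd i F w) v) p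
      - ∑ l, pd i (fun v => christoffel G v l k k) p * pd l F p := by
    intro k
    simp only [hess]
    rw [pd_sub i (d1 k k) (DifferentiableAt.fun_sum fun l _ => dC l k k),
      pd_sum i _ (f := fun l v => christoffel G v l k k * pd l F v) fun l _ => dC l k k,
      pd_comm hU (sV k) hp i k, pd_congr k hU hp fun v hv => pd_comm hU hF hv i k]
    congr 1
    refine Finset.sum_congr rfl fun l _ => ?_
    rw [pd_mul i (dc l k k) (dv l), hz, zero_mul, add_zero]
  have e2 : ∀ k j, pd i (fun v => (G v)⁻¹ k j * hess G F v k j) p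
      = if k = j then pd i (fun v => hess G F v k k) p else 0 := by
    intro k j
    rw [pd_mul i (dH k j) (dh k j), hn.pd_inv h hp, hn.eq_one, inv_one, Matrix.one_apply]
    split_ifs with hkj
    · subst hkj; ring
    · ring
  rw [show lap G F = fun v => ∑ k, ∑ j, (G v)⁻¹ k j * hess G F v k j from rfl,
    pd_sum i _ (f := fun k v => ∑ j, (G v)⁻¹ k j * hess G F v k j) fun k _ =>
      DifferentiableAt.fun_sum fun j _ => (dH k j).fun_mul (dh k j), ← Finset.sum_sub_distrib]
  refine Finset.sum_congr rfl fun k _ => ?_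
  rw [pd_sum i _ (f := fun j v => (G v)⁻¹ k j * hess G F v k j) fun j _ =>
      (dH k j).fun_mul (dh k j), ← e1]
  simp [e2]

end Static

variable {I : Set ℝ} {α : ℝ → ℝ}
  {G : ℝ → EuclideanSpace ℝ (Fin m) → Matrix (Fin m) (Fin m) ℝ}
  {F : ℝ → EuclideanSpace ℝ (Fin m) → ℝ} {t α' : ℝ}

/-- The time derivative of `Sic` in normal coordinates. -/
noncomputable def sicDot (G : EuclideanSpace ℝ (Fin m) → Matrix (Fin m) (Fin m) ℝ)
    (F : EuclideanSpace ℝ (Fin m) → ℝ) (a a' : ℝ) (p : EuclideanSpace ℝ (Fin m))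
    (i j : Fin m) : ℝ :=
  ∑ k, sicEnd2 G F a p k k i j + 2 * a * lap G F p * hess G F p i j
    - a' * (pd i F p * pd j F p)
    + 2 * ∑ k, ∑ l, sic G F a p k l * riem G p k i j l
    + ∑ l, corr G p i l * sic G F a p l j + ∑ l, corr' G p j l * sic G F a p l i

theorem LocalFlow.hasDerivAt_sicEnd (hf : LocalFlow U I α G F) (ht : t ∈ I) (hp : p ∈ U)
    (hn : NormalAt (G t) p) (hα : HasDerivAt α α' t) (i j : Fin m) :
    HasDerivAt (fun s => sicEnd (G s) (F s) (α s) p i j)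
      (2 * ∑ k, sic (G t) (F t) (α t) p i k * sic (G t) (F t) (α t) p k j
        + sicDot (G t) (F t) (α t) α' p i j) t := by
  have key : HasDerivAt (fun s => ∑ k, (G s p)⁻¹ i k * sic (G s) (F s) (α s) p k j) _ t :=
    HasDerivAt.fun_sum (u := Finset.univ) fun k _ =>
    (hf.hasDerivAt_inv ht hp hn i k).fun_mul (hf.hasDerivAt_sic ht hp hn hα k j)
  refine key.congr_deriv ?_
  rw [Finset.sum_add_distrib, hn.eq_one, inv_one]
  simp only [Matrix.one_apply, ite_mul, one_mul, zero_mul, Finset.sum_ite_eq, Finset.mem_univ,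
    if_true, sicDot, Finset.mul_sum, mul_assoc]

/-- The evolution equation of `S`. -/
theorem LocalFlow.hasDerivAt_sicTrace (hf : LocalFlow U I α G F) (ht : t ∈ I) (hp : p ∈ U)
    (hn : NormalAt (G t) p) (hα : HasDerivAt α α' t) :
    HasDerivAt (fun s => sicTrace (G s) (F s) (α s) p)
      (∑ k, pd k (fun v => pd k (sicTrace (G t) (F t) (α t)) v) p
        + 2 * ∑ i, ∑ j, sic (G t) (F t) (α t) p i j ^ 2
        + 2 * α t * lap (G t) (F t) p ^ 2 - α' * ∑ i, pd i (F t) p ^ 2) t := by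
  have h := hf.metricOn ht
  have hF := hf.smooth_map.slice ht
  have key : HasDerivAt (fun s => ∑ i, sicEnd (G s) (F s) (α s) p i i) _ t :=
    HasDerivAt.fun_sum (u := Finset.univ) fun i _ => hf.hasDerivAt_sicEnd ht hp hn hα i i
  refine (key.congr_of_eventuallyEq ?_).congr_deriv ?_
  · filter_upwards [hf.isOpen_time.mem_nhds ht] with s hs
    exact (hf.metricOn hs).sicTrace_eq hp _ _
  set σ := sic (G t) (F t) (α t) p with hσ
  have hsym : ∀ i j, σ i j = σ j i := h.sic_symm hp _ _
  have e1 : ∑ i, ∑ k, σ i k * σ k i = ∑ i, ∑ j, σ i j ^ 2 :=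
    Finset.sum_congr rfl fun i _ => Finset.sum_congr rfl fun j _ => by rw [hsym j i]; ring
  have e2 : ∑ i, ∑ k, ∑ l, σ k l * riem (G t) p k i i l = ∑ k, ∑ l, ricci (G t) p k l * σ k l := by
    rw [Finset.sum_comm]
    refine Finset.sum_congr rfl fun k _ => ?_
    rw [Finset.sum_comm]
    refine Finset.sum_congr rfl fun l _ => ?_
    rw [← Finset.mul_sum, hn.sum_riem h hp, mul_comm]
  -- The corrections give −2⟨Ric, Sic⟩, which cancels the traced curvature action from `e2`. The
  -- remaining 2|Sic|² comes from differentiating the inverse metric.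
  have e3 := hn.sum_corr h hp σ hsym
  simp only [add_mul, Finset.sum_add_distrib] at e3
  have e4 : ∀ (c : (EuclideanSpace ℝ (Fin m) → Matrix (Fin m) (Fin m) ℝ)
      → EuclideanSpace ℝ (Fin m) → Fin m → Fin m → ℝ), ∑ i, ∑ l, c (G t) p i l * σ l i
      = ∑ i, ∑ l, c (G t) p i l * σ i l := fun c =>
    Finset.sum_congr rfl fun i _ => Finset.sum_congr rfl fun l _ => by rw [hsym]
  have e5 : ∑ i, ∑ k, sicEnd2 (G t) (F t) (α t) p k k i i
      = ∑ k, pd k (fun v => pd k (sicTrace (G t) (F t) (α t)) v) p := by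
    rw [Finset.sum_comm]
    simp only [h.pd_pd_sicTrace hp hF]
  have e6 : ∑ i, hess (G t) (F t) p i i = lap (G t) (F t) p := by
    rw [lap, hn.trace2_eq]
  simp only [sicDot, ← hσ, Finset.sum_add_distrib, Finset.sum_sub_distrib, ← Finset.mul_sum, e1, e2,
    e4, e5, e6, ← sq]
  linarith

/-- The evolution equation of `|Sic|²`. -/
theorem LocalFlow.hasDerivAt_sicSq (hf : LocalFlow U I α G F) (ht : t ∈ I) (hp : p ∈ U)
    (hn : NormalAt (G t) p) (hα : HasDerivAt α α' t) {σ : Fin m → Fin m → ℝ}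
    (hσ : σ = sic (G t) (F t) (α t) p) :
    HasDerivAt (fun s => sicSq (G s) (F s) (α s) p)
      (∑ k, pd k (fun v => pd k (sicSq (G t) (F t) (α t)) v) p
        - 2 * ∑ k, ∑ i, ∑ j, pd k (fun v => sicEnd (G t) (F t) (α t) v i j) p ^ 2
        + 4 * ∑ i, ∑ j, σ i j * ∑ k, σ i k * σ k j
        + 4 * α t * lap (G t) (F t) p * ∑ i, ∑ j, σ i j * hess (G t) (F t) p i j
        - 2 * α' * ∑ i, ∑ j, σ i j * (pd i (F t) p * pd j (F t) p)
        + 4 * ∑ i, ∑ j, σ i j * ∑ k, ∑ l, σ k l * riem (G t) p k i j l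
        - 4 * ∑ i, ∑ l, ricci (G t) p i l * ∑ j, σ i j * σ l j) t := by
  have h := hf.metricOn ht
  have hF := hf.smooth_map.slice ht
  have hA := hf.hasDerivAt_sicEnd ht hp hn hα
  have key : HasDerivAt (fun s => ∑ i, ∑ j, sicEnd (G s) (F s) (α s) p i j
      * sicEnd (G s) (F s) (α s) p j i) _ t :=
    HasDerivAt.fun_sum (u := Finset.univ) fun i _ =>
      HasDerivAt.fun_sum (u := Finset.univ) fun j _ => (hA i j).fun_mul (hA j i)
  refine key.congr_deriv ?_
  simp only [hn.sicEnd_eq, ← hσ]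
  have hsym : ∀ i j, σ i j = σ j i := by rw [hσ]; exact h.sic_symm hp _ _
  have e0 : ∀ B : Fin m → Fin m → ℝ, ∑ i, ∑ j, (B i j * σ j i + σ i j * B j i)
      = 2 * ∑ i, ∑ j, σ i j * B i j := by
    intro B
    have e1 : ∑ i, ∑ j, B i j * σ j i = ∑ i, ∑ j, σ i j * B i j :=
      Finset.sum_congr rfl fun i _ => Finset.sum_congr rfl fun j _ => by rw [hsym j i, mul_comm]
    have e2 : ∑ i, ∑ j, σ i j * B j i = ∑ i, ∑ j, σ i j * B i j := by
      rw [Finset.sum_comm]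
      exact Finset.sum_congr rfl fun i _ => Finset.sum_congr rfl fun j _ => by rw [hsym j i]
    simp only [Finset.sum_add_distrib, e1, e2]; ring
  rw [e0 fun i j => 2 * ∑ k, σ i k * σ k j + sicDot (G t) (F t) (α t) α' p i j]
  -- Contraction with the symmetric tensor Sic² turns the corrections into the −4⟨Ric, Sic²⟩ term.
  have e3 := hn.sum_corr h hp (fun i l => ∑ j, σ i j * σ l j)
    fun i l => Finset.sum_congr rfl fun j _ => mul_comm _ _
  simp only [add_mul, Finset.sum_add_distrib] at e3
  have e4 : ∑ i, ∑ j, σ i j * ∑ l, corr (G t) p i l * σ l j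
      = ∑ i, ∑ l, corr (G t) p i l * ∑ j, σ i j * σ l j := by
    refine Finset.sum_congr rfl fun i _ => ?_
    simp only [Finset.mul_sum]
    rw [Finset.sum_comm]
    exact Finset.sum_congr rfl fun l _ => Finset.sum_congr rfl fun j _ => by ring
  have e5 : ∑ i, ∑ j, σ i j * ∑ l, corr' (G t) p j l * σ l i
      = ∑ i, ∑ l, corr' (G t) p i l * ∑ j, σ i j * σ l j := by
    rw [Finset.sum_comm]
    refine Finset.sum_congr rfl fun i _ => ?_
    simp only [Finset.mul_sum]
    rw [Finset.sum_comm]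
    exact Finset.sum_congr rfl fun l _ => Finset.sum_congr rfl fun j _ => by rw [hsym j i]; ring
  have e6 : ∑ i, ∑ j, σ i j * ∑ k, sicEnd2 (G t) (F t) (α t) p k k i j
      = ∑ k, ∑ i, ∑ j, σ i j * sicEnd2 (G t) (F t) (α t) p k k i j := by
    simp only [Finset.mul_sum]
    rw [Finset.sum_congr rfl fun i _ => Finset.sum_comm, Finset.sum_comm]
  have e7 : ∑ k, pd k (fun v => pd k (sicSq (G t) (F t) (α t)) v) p
      = 2 * ∑ k, ∑ i, ∑ j, σ i j * sicEnd2 (G t) (F t) (α t) p k k i j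
        + 2 * ∑ k, ∑ i, ∑ j, pd k (fun v => sicEnd (G t) (F t) (α t) v i j) p ^ 2 := by
    simp only [hn.pd_pd_sicSq h hp hF, ← hσ, Finset.sum_add_distrib, Finset.mul_sum]
  have e8 : ∀ (c : ℝ) (B : Fin m → Fin m → ℝ), ∑ i, ∑ j, σ i j * (c * B i j)
      = c * ∑ i, ∑ j, σ i j * B i j := by
    intro c B
    simp only [Finset.mul_sum]
    exact Finset.sum_congr rfl fun i _ => Finset.sum_congr rfl fun j _ => by ring
  simp only [sicDot, ← hσ, mul_add, mul_sub, Finset.sum_add_distrib, Finset.sum_sub_distrib, e4, e5,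
    e6, e8]
  rw [e7]
  linarith

/-- The evolution equation of `|∇φ|²`. -/
theorem LocalFlow.hasDerivAt_gradSq (hf : LocalFlow U I α G F) (ht : t ∈ I) (hp : p ∈ U)
    (hn : NormalAt (G t) p) :
    HasDerivAt (fun s => gradSq (G s) (F s) p)
      (∑ k, pd k (fun v => pd k (gradSq (G t) (F t)) v) p
        - 2 * ∑ k, ∑ i, hess (G t) (F t) p k i ^ 2
        - 2 * α t * (∑ i, pd i (F t) p ^ 2) ^ 2) t := by
  have h := hf.metricOn ht
  have hF := hf.smooth_map.slice ht
  have hV := hf.hasDerivAt_pd_map ht hp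
  have key : HasDerivAt (fun s => ∑ i, ∑ j, (G s p)⁻¹ i j * (pd i (F s) p * pd j (F s) p)) _ t :=
    HasDerivAt.fun_sum (u := Finset.univ) fun i _ =>
      HasDerivAt.fun_sum (u := Finset.univ) fun j _ =>
        (hf.hasDerivAt_inv ht hp hn i j).fun_mul ((hV i).fun_mul (hV j))
  refine key.congr_deriv ?_
  -- Contraction with dφ⊗dφ yields −2Ric(∇φ, ∇φ), the Bochner term. Together with 2Sic(∇φ, ∇φ) from
  -- the inverse metric it leaves −2α|∇φ|⁴.
  have e0 := hn.sum_corr h hp (fun i l => pd i (F t) p * pd l (F t) p) fun i l => mul_comm _ _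
  simp only [corr, corr', ← Finset.sum_add_distrib] at e0
  have e1 : ∑ i, ∑ l, (∑ k, (metric2 (G t) p k k i l - metric2 (G t) p i k k l
      + (1 / 2) * metric2 (G t) p i l k k + ((1 / 2) * metric2 (G t) p i l k k
        - metric2 (G t) p i k k l))) * (pd i (F t) p * pd l (F t) p)
      = ∑ k, ∑ i, ∑ j, metric2 (G t) p k k i j * (pd i (F t) p * pd j (F t) p)
        - 2 * ∑ i, pd i (F t) p
          * ∑ k, ∑ l, pd i (fun v => christoffel (G t) v l k k) p * pd l (F t) p := by
    have e2 : ∑ k, ∑ i, ∑ j, metric2 (G t) p k k i j * (pd i (F t) p * pd j (F t) p)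
        = ∑ i, ∑ l, ∑ k, metric2 (G t) p k k i l * (pd i (F t) p * pd l (F t) p) := by
      rw [Finset.sum_comm]
      exact Finset.sum_congr rfl fun i _ => Finset.sum_comm
    have e3 : ∑ i, pd i (F t) p
        * ∑ k, ∑ l, pd i (fun v => christoffel (G t) v l k k) p * pd l (F t) p
        = ∑ i, ∑ l, ∑ k, pd i (F t) p
          * (pd i (fun v => christoffel (G t) v l k k) p * pd l (F t) p) := by
      refine Finset.sum_congr rfl fun i _ => ?_
      rw [Finset.sum_comm]
      simp only [Finset.mul_sum]
    rw [e2, e3]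
    simp only [Finset.mul_sum, Finset.sum_mul, ← Finset.sum_sub_distrib]
    refine Finset.sum_congr rfl fun i _ => Finset.sum_congr rfl fun l _ =>
      Finset.sum_congr rfl fun k _ => ?_
    rw [hn.pd_christoffel' h hp]; ring
  rw [e1] at e0
  have e4 : ∑ i, ∑ l, ricci (G t) p i l * (pd i (F t) p * pd l (F t) p)
      = ∑ i, ∑ l, sic (G t) (F t) (α t) p i l * (pd i (F t) p * pd l (F t) p)
        + α t * (∑ i, pd i (F t) p ^ 2) ^ 2 := by
    rw [sq, Finset.sum_mul_sum, Finset.mul_sum, ← Finset.sum_add_distrib]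
    refine Finset.sum_congr rfl fun i _ => ?_
    rw [Finset.mul_sum, ← Finset.sum_add_distrib]
    refine Finset.sum_congr rfl fun l _ => ?_
    simp only [sic]; ring
  have e5 : ∑ i, ∑ j, (2 * sic (G t) (F t) (α t) p i j * (pd i (F t) p * pd j (F t) p)
      + (G t p)⁻¹ i j * (pd i (lap (G t) (F t)) p * pd j (F t) p
        + pd i (F t) p * pd j (lap (G t) (F t)) p))
      = 2 * ∑ i, ∑ l, sic (G t) (F t) (α t) p i l * (pd i (F t) p * pd l (F t) p)
        + 2 * ∑ i, pd i (F t) p * pd i (lap (G t) (F t)) p := by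
    simp only [hn.eq_one, inv_one, Matrix.one_apply, Finset.sum_add_distrib, ite_mul, one_mul,
      zero_mul, Finset.sum_ite_eq, Finset.mem_univ, if_true, Finset.mul_sum, mul_assoc]
    congr 1
    rw [← Finset.sum_add_distrib]
    exact Finset.sum_congr rfl fun i _ => by ring
  have e6 : ∑ i, pd i (F t) p * pd i (lap (G t) (F t)) p
      = ∑ k, ∑ i, pd i (F t) p * pd k (fun v => pd k (fun w => pd i (F t) w) v) p
        - ∑ i, pd i (F t) p
          * ∑ k, ∑ l, pd i (fun v => christoffel (G t) v l k k) p * pd l (F t) p := by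
    simp only [hn.pd_lap h hp hF, mul_sub, Finset.sum_sub_distrib]
    congr 1
    rw [Finset.sum_comm]
    simp only [Finset.mul_sum]
  have e7 : ∑ k, pd k (fun v => pd k (gradSq (G t) (F t)) v) p
      = -∑ k, ∑ i, ∑ j, metric2 (G t) p k k i j * (pd i (F t) p * pd j (F t) p)
        + 2 * ∑ k, ∑ i, pd i (F t) p * pd k (fun v => pd k (fun w => pd i (F t) w) v) p
        + 2 * ∑ k, ∑ i, hess (G t) (F t) p k i ^ 2 := by
    simp only [hn.pd_pd_gradSq h hp hF, Finset.sum_add_distrib, Finset.sum_neg_distrib,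
      Finset.mul_sum]
  rw [e5, e6, e7]
  linarith

end ScalarEvolution

/-! ### Algebraic estimates -/

section Algebra

variable {m : ℕ}

theorem sum_sum_mul_sq_le {ι κ : Type*} [Fintype ι] [Fintype κ] (A B : ι → κ → ℝ) :
    (∑ i, ∑ j, A i j * B i j) ^ 2 ≤ (∑ i, ∑ j, A i j ^ 2) * ∑ i, ∑ j, B i j ^ 2 := by
  have := Finset.sum_mul_sq_le_sq_mul_sq Finset.univ (fun p : ι × κ => A p.1 p.2)
    fun p => B p.1 p.2
  simpa only [Fintype.sum_prod_type] using this

theorem sum_outer_sq (v : Fin m → ℝ) : ∑ i, ∑ j, (v i * v j) ^ 2 = (∑ i, v i ^ 2) ^ 2 := by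
  rw [sq (∑ i, v i ^ 2), Finset.sum_mul_sum]
  exact Finset.sum_congr rfl fun i _ => Finset.sum_congr rfl fun j _ => mul_pow _ _ 2

theorem sum_trace_sq_le (H : Fin m → Fin m → ℝ) :
    (∑ i, H i i) ^ 2 ≤ m * ∑ i, ∑ j, H i j ^ 2 := by
  have h1 := Finset.sum_mul_sq_le_sq_mul_sq Finset.univ (fun _ : Fin m => (1 : ℝ)) fun i => H i i
  simp only [one_mul, one_pow, Finset.sum_const, Finset.card_univ, Fintype.card_fin,
    nsmul_eq_mul, mul_one] at h1
  refine h1.trans (mul_le_mul_of_nonneg_left ?_ (Nat.cast_nonneg m))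
  exact Finset.sum_le_sum fun i _ =>
    Finset.single_le_sum (f := fun j => H i j ^ 2) (fun j _ => sq_nonneg _) (Finset.mem_univ i)

theorem abs_sum_sum_mul_le {ι κ : Type*} [Fintype ι] [Fintype κ] {A B : ι → κ → ℝ} {a b : ℝ}
    (ha : 0 ≤ a) (hb : 0 ≤ b) (hA : ∑ i, ∑ j, A i j ^ 2 ≤ a ^ 2)
    (hB : ∑ i, ∑ j, B i j ^ 2 ≤ b ^ 2) : |∑ i, ∑ j, A i j * B i j| ≤ a * b := by
  refine abs_le_of_sq_le_sq ?_ (mul_nonneg ha hb)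
  refine (sum_sum_mul_sq_le A B).trans ?_
  rw [mul_pow]
  exact mul_le_mul hA hB (Finset.sum_nonneg fun _ _ => Finset.sum_nonneg fun _ _ => sq_nonneg _)
    (sq_nonneg _)

/-- The squared norm of the product of two matrices. -/
theorem sum_sq_mul_le {σ : Fin m → Fin m → ℝ} {s : ℝ} (hσ : ∑ i, ∑ j, σ i j ^ 2 ≤ s ^ 2) :
    ∑ i, ∑ j, (∑ k, σ i k * σ j k) ^ 2 ≤ (s ^ 2) ^ 2 := by
  have h1 : ∀ i j, (∑ k, σ i k * σ j k) ^ 2 ≤ (∑ k, σ i k ^ 2) * ∑ k, σ j k ^ 2 := fun i j =>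
    Finset.sum_mul_sq_le_sq_mul_sq _ _ _
  calc _ ≤ ∑ i, ∑ j, (∑ k, σ i k ^ 2) * ∑ k, σ j k ^ 2 :=
        Finset.sum_le_sum fun i _ => Finset.sum_le_sum fun j _ => h1 i j
    _ = (∑ i, ∑ j, σ i j ^ 2) ^ 2 := by rw [← Finset.sum_mul_sum, sq]
    _ ≤ _ := pow_le_pow_left₀ (Finset.sum_nonneg fun _ _ =>
        Finset.sum_nonneg fun _ _ => sq_nonneg _) hσ 2

/-- The quadratic action of a curvature tensor on a symmetric two-tensor, in terms of the
Weyl tensor. -/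
theorem sum_riem_eq {σ Ric : Fin m → Fin m → ℝ} {Rm W : Fin m → Fin m → Fin m → Fin m → ℝ}
    (hσ : ∀ i j, σ i j = σ j i) (c d : ℝ)
    (hRm : ∀ k i j l, Rm k i j l = W k i j l
      + c * (Ric k l * (1 : Matrix (Fin m) (Fin m) ℝ) i j
        + Ric i j * (1 : Matrix (Fin m) (Fin m) ℝ) k l
        - Ric k j * (1 : Matrix (Fin m) (Fin m) ℝ) i l
        - Ric i l * (1 : Matrix (Fin m) (Fin m) ℝ) k j)
      - d * ((1 : Matrix (Fin m) (Fin m) ℝ) k l * (1 : Matrix (Fin m) (Fin m) ℝ) i j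
        - (1 : Matrix (Fin m) (Fin m) ℝ) k j * (1 : Matrix (Fin m) (Fin m) ℝ) i l)) :
    ∑ i, ∑ j, σ i j * ∑ k, ∑ l, σ k l * Rm k i j l
      = ∑ i, ∑ j, σ i j * ∑ k, ∑ l, σ k l * W k i j l
        + c * (2 * ((∑ i, σ i i) * ∑ i, ∑ j, Ric i j * σ i j)
          - 2 * ∑ i, ∑ l, Ric i l * ∑ j, σ i j * σ l j)
        - d * ((∑ i, σ i i) ^ 2 - ∑ i, ∑ j, σ i j ^ 2) := by
  have e : ∀ i j, ∑ k, ∑ l, σ k l * Rm k i j l = ∑ k, ∑ l, σ k l * W k i j l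
      + (c * (∑ k, ∑ l, Ric k l * σ k l) * (1 : Matrix (Fin m) (Fin m) ℝ) i j
        + c * (∑ k, σ k k) * Ric i j - c * ∑ k, σ k i * Ric k j - c * ∑ l, σ j l * Ric i l)
      - (d * (∑ k, σ k k) * (1 : Matrix (Fin m) (Fin m) ℝ) i j - d * σ j i) := by
    intro i j
    have e1 : ∀ k l, σ k l * Rm k i j l = σ k l * W k i j l
        + (c * (Ric k l * σ k l) * (1 : Matrix (Fin m) (Fin m) ℝ) i j
          + (if k = l then c * σ k k * Ric i j else 0) - (if i = l then c * (σ k i * Ric k j) else 0)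
          - (if k = j then c * (σ j l * Ric i l) else 0))
        - ((if k = l then d * σ k k * (1 : Matrix (Fin m) (Fin m) ℝ) i j else 0)
          - (if k = j then (if i = l then d * σ j i else 0) else 0)) := by
      intro k l
      rw [hRm]
      simp only [Matrix.one_apply]
      split_ifs <;> subst_vars <;> ring
    simp only [e1, Finset.sum_add_distrib, Finset.sum_sub_distrib, Finset.sum_ite_eq,
      Finset.mem_univ, if_true, ← Finset.sum_mul, ← Finset.mul_sum]
    congr 2
    · congr 1
      rw [Finset.sum_comm]
      simp [Finset.mul_sum]
    · rw [Finset.sum_comm]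
      simp
  have t1 : ∑ i, ∑ j, σ i j * (1 : Matrix (Fin m) (Fin m) ℝ) i j = ∑ i, σ i i := by
    simp [Matrix.one_apply]
  have t2 : ∑ i, ∑ j, σ i j * Ric i j = ∑ i, ∑ j, Ric i j * σ i j :=
    Finset.sum_congr rfl fun i _ => Finset.sum_congr rfl fun j _ => mul_comm _ _
  have t3 : ∑ i, ∑ j, σ i j * ∑ k, σ k i * Ric k j = ∑ i, ∑ l, Ric i l * ∑ j, σ i j * σ l j := by
    simp only [Finset.mul_sum]
    rw [Finset.sum_congr rfl fun i _ => Finset.sum_comm, Finset.sum_comm]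
    refine Finset.sum_congr rfl fun k _ => ?_
    rw [Finset.sum_comm]
    refine Finset.sum_congr rfl fun j _ => Finset.sum_congr rfl fun i _ => ?_
    rw [hσ i j]; ring
  have t4 : ∑ i, ∑ j, σ i j * ∑ l, σ j l * Ric i l = ∑ i, ∑ l, Ric i l * ∑ j, σ i j * σ l j := by
    simp only [Finset.mul_sum]
    refine Finset.sum_congr rfl fun i _ => ?_
    rw [Finset.sum_comm]
    refine Finset.sum_congr rfl fun l _ => Finset.sum_congr rfl fun j _ => ?_
    rw [hσ j l]; ring
  have t5 : ∑ i, ∑ j, σ i j * σ j i = ∑ i, ∑ j, σ i j ^ 2 :=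
    Finset.sum_congr rfl fun i _ => Finset.sum_congr rfl fun j _ => by rw [hσ j i]; ring
  have p : ∀ (x : ℝ) (B : Fin m → Fin m → ℝ), ∑ i, ∑ j, σ i j * (x * B i j)
      = x * ∑ i, ∑ j, σ i j * B i j := by
    intro x B
    simp only [Finset.mul_sum]
    exact Finset.sum_congr rfl fun i _ => Finset.sum_congr rfl fun j _ => by ring
  obtain ⟨δ, hδ⟩ : ∃ δ : Fin m → Fin m → ℝ, ∀ i j, (1 : Matrix (Fin m) (Fin m) ℝ) i j = δ i j :=
    ⟨_, fun _ _ => rfl⟩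
  simp only [hδ] at e t1
  simp only [e, mul_add, mul_sub, Finset.sum_add_distrib, Finset.sum_sub_distrib, p, t1, t2, t3, t4,
    t5]
  ring

/-- Cauchy–Schwarz over pairs of indices: `W` is paired with σ⊗σ, whose norm is |σ|². -/
theorem sum_weyl_le {W : Fin m → Fin m → Fin m → Fin m → ℝ} {σ : Fin m → Fin m → ℝ} {s w : ℝ}
    (hw : 0 ≤ w) (hσ : ∑ i, ∑ j, σ i j ^ 2 ≤ s ^ 2)
    (hW : ∑ i, ∑ j, ∑ k, ∑ l, W i j k l ^ 2 ≤ w ^ 2) :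
    |∑ i, ∑ j, σ i j * ∑ k, ∑ l, σ k l * W k i j l| ≤ w * s ^ 2 := by
  have e : ∑ i, ∑ j, σ i j * ∑ k, ∑ l, σ k l * W k i j l
      = ∑ p : Fin m × Fin m, ∑ q : Fin m × Fin m, (W q.1 p.1 p.2 q.2) * (σ p.1 p.2 * σ q.1 q.2) := by
    simp only [Fintype.sum_prod_type, Finset.mul_sum]
    exact Finset.sum_congr rfl fun i _ => Finset.sum_congr rfl fun j _ =>
      Finset.sum_congr rfl fun k _ => Finset.sum_congr rfl fun l _ => by ring
  rw [e]
  refine abs_sum_sum_mul_le hw (sq_nonneg s) ?_ ?_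
  · refine le_trans (le_of_eq ?_) hW
    simp only [Fintype.sum_prod_type]
    rw [Finset.sum_congr rfl fun i _ => Finset.sum_comm, Finset.sum_comm]
  · have : ∑ p : Fin m × Fin m, ∑ q : Fin m × Fin m, (σ p.1 p.2 * σ q.1 q.2) ^ 2
        = (∑ i, ∑ j, σ i j ^ 2) ^ 2 := by
      simp only [mul_pow]
      rw [← Finset.sum_mul_sum, sq, Fintype.sum_prod_type]
    rw [this]
    exact pow_le_pow_left₀ (Finset.sum_nonneg fun _ _ =>
        Finset.sum_nonneg fun _ _ => sq_nonneg _) hσ 2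

set_option maxHeartbeats 800000 in
/-- The absorption of all cubic reaction terms by the good term `-4 b z³`. -/
theorem cubic_absorption {B q a₀ μ K b z X s S w h T : ℝ} (hB : 1 ≤ B) (hq : 0 ≤ q) (ha : 0 ≤ a₀)
    (hμ : 0 ≤ μ) (hK : 0 ≤ K) (hz : 1 ≤ z) (hX : 0 ≤ X) (hbz : z = b * X)
    (hb : 7 * B ^ 3 + 6 * q * B ^ 2 + 1 + (B ^ 2 + a₀ * (μ + 1) * B) * K ≤ b)
    (hs : 0 ≤ s) (hsB : s ≤ B * z) (hS : |S| ≤ B * z) (hw0 : 0 ≤ w)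
    (hwh : w + h ^ 2 ≤ K ^ 2 * X)
    (hT : T ≤ 4 * (w * s ^ 2 + (2 * ((s ^ 2 + q * s) * |S|) + 2 * (s ^ 3 + q * s ^ 2)
        + (|S| + q) * (S ^ 2 + s ^ 2)))
      + 4 * a₀ * μ * h ^ 2 * s + 4 * |S| * s ^ 2 + 4 * |S| * a₀ * h ^ 2) :
    T - 4 * b ^ 2 * X * z ^ 2 ≤ 0 := by
  have hB0 : 0 ≤ B := by linarith
  have hz0 : 0 < z := by linarith
  have hC2 : 1 ≤ B ^ 2 + a₀ * (μ + 1) * B := by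
    have : 0 ≤ a₀ * (μ + 1) * B := by positivity
    nlinarith
  have hb1 : 1 ≤ b := by
    have : 0 ≤ (B ^ 2 + a₀ * (μ + 1) * B) * K := by positivity
    have : 0 ≤ 7 * B ^ 3 + 6 * q * B ^ 2 := by positivity
    linarith
  have hSa : 0 ≤ |S| := abs_nonneg S
  have hBz : 0 ≤ B * z := by positivity
  have s2 : s ^ 2 ≤ (B * z) ^ 2 := pow_le_pow_left₀ hs hsB 2
  have s3 : s ^ 3 ≤ (B * z) ^ 3 := pow_le_pow_left₀ hs hsB 3
  have S2 : S ^ 2 ≤ (B * z) ^ 2 := by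
    rw [← sq_abs]; exact pow_le_pow_left₀ hSa hS 2
  have hzz : z ^ 2 ≤ z ^ 3 := by nlinarith [sq_nonneg z]
  have hqz : q * z ^ 2 ≤ q * z ^ 3 := mul_le_mul_of_nonneg_left hzz hq
  have hwK : w ≤ K ^ 2 * X := by nlinarith [sq_nonneg h]
  have hhK : h ^ 2 ≤ K ^ 2 * X := by linarith
  have hKX : 0 ≤ K ^ 2 * X := by positivity
  have k1 : w * s ^ 2 ≤ K ^ 2 * X * (B * z) ^ 2 := mul_le_mul hwK s2 (sq_nonneg s) hKX
  have k2 : (s ^ 2 + q * s) * |S| ≤ ((B * z) ^ 2 + q * (B * z)) * (B * z) :=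
    mul_le_mul (add_le_add s2 (mul_le_mul_of_nonneg_left hsB hq)) hS hSa (by positivity)
  have k3 : (|S| + q) * (S ^ 2 + s ^ 2) ≤ (B * z + q) * ((B * z) ^ 2 + (B * z) ^ 2) :=
    mul_le_mul (by linarith) (add_le_add S2 s2) (by positivity) (by positivity)
  have k4 : q * s ^ 2 ≤ q * (B * z) ^ 2 := mul_le_mul_of_nonneg_left s2 hq
  have k5 : |S| * s ^ 2 ≤ (B * z) * (B * z) ^ 2 := mul_le_mul hS s2 (sq_nonneg s) hBz
  have k6 : h ^ 2 * s ≤ K ^ 2 * X * (B * z) := mul_le_mul hhK hsB hs hKX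
  have k6' : a₀ * μ * (h ^ 2 * s) ≤ a₀ * μ * (K ^ 2 * X * (B * z)) :=
    mul_le_mul_of_nonneg_left k6 (by positivity)
  have k7 : |S| * h ^ 2 ≤ (B * z) * (K ^ 2 * X) := mul_le_mul hS hhK (sq_nonneg h) hBz
  have k7' : a₀ * (|S| * h ^ 2) ≤ a₀ * ((B * z) * (K ^ 2 * X)) :=
    mul_le_mul_of_nonneg_left k7 ha
  have k8 : a₀ * (μ + 1) * B * (K ^ 2 * X) * z ≤ a₀ * (μ + 1) * B * (K ^ 2 * X) * z ^ 2 :=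
    mul_le_mul_of_nonneg_left (by nlinarith) (by positivity)
  -- Every s and |S| is replaced by Bz. The cubic terms count 4·(2 + 2 + 2 + 1) = 28 and the terms
  -- with `q` count 4·(2 + 2 + 2) = 24; z ≥ 1 raises the lower powers of z.
  have hT2 : T ≤ (28 * B ^ 3 + 24 * q * B ^ 2) * z ^ 3
      + 4 * (B ^ 2 + a₀ * (μ + 1) * B) * (K ^ 2 * X) * z ^ 2 := by
    have hqB : q * B ^ 2 * z ^ 2 ≤ q * B ^ 2 * z ^ 3 :=
      mul_le_mul_of_nonneg_left hzz (by positivity)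
    have hY : T ≤ 4 * (K ^ 2 * X) * (B * z) ^ 2 + 28 * (B * z) ^ 3 + 24 * (q * (B * z) ^ 2)
        + 4 * (a₀ * (μ + 1) * B * (K ^ 2 * X) * z) := by
      linarith [k1, k2, k3, k4, k5, k6', k7', s3]
    linarith [k8, hqB]
  have hb0 : 0 ≤ b := by linarith
  -- The coefficient of K is at least 1, so K ≤ b and one factor K of K² can be traded for b. This
  -- is why the threshold is linear in K.
  have hbb : (7 * B ^ 3 + 6 * q * B ^ 2) * b + (B ^ 2 + a₀ * (μ + 1) * B) * K ^ 2 ≤ b ^ 2 := by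
    set C₂ := B ^ 2 + a₀ * (μ + 1) * B
    have h1 : K ≤ C₂ * K := le_mul_of_one_le_left hK hC2
    have h2 : C₂ * K ≤ b := by
      have : 0 ≤ 7 * B ^ 3 + 6 * q * B ^ 2 := by positivity
      linarith
    have h3 : C₂ * K ^ 2 ≤ C₂ * K * b := by
      rw [sq, ← mul_assoc]
      exact mul_le_mul_of_nonneg_left (h1.trans h2) (by positivity)
    have h4 := mul_le_mul_of_nonneg_right hb hb0
    linarith
  have e1 : 4 * b ^ 2 * X * z ^ 2 - ((28 * B ^ 3 + 24 * q * B ^ 2) * z ^ 3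
      + 4 * (B ^ 2 + a₀ * (μ + 1) * B) * (K ^ 2 * X) * z ^ 2)
      = 4 * (X * z ^ 2) * (b ^ 2 - ((7 * B ^ 3 + 6 * q * B ^ 2) * b
        + (B ^ 2 + a₀ * (μ + 1) * B) * K ^ 2)) := by
    have : z ^ 3 = b * X * z ^ 2 := by rw [← hbz]; ring
    rw [this]; ring
  have e2 : 0 ≤ 4 * (X * z ^ 2) * (b ^ 2 - ((7 * B ^ 3 + 6 * q * B ^ 2) * b
        + (B ^ 2 + a₀ * (μ + 1) * B) * K ^ 2)) :=
    mul_nonneg (by positivity) (by linarith)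
  linarith

end Algebra

/-! ### Second derivative test -/

section Extremum

variable {m : ℕ} {U : Set (EuclideanSpace ℝ (Fin m))} {p : EuclideanSpace ℝ (Fin m)}
  {f : EuclideanSpace ℝ (Fin m) → ℝ}

theorem pd_eq_zero_of_isLocalMax (h : IsLocalMax f p) (k : Fin m) : pd k f p = 0 := by
  simp [pd, h.fderiv_eq_zero]

/-- A positive second derivative would make the point a local minimum too; then `g` is locally
constant and its second derivative vanishes. -/
theorem deriv_deriv_nonpos_of_isLocalMax {g : ℝ → ℝ} {x : ℝ} (h : IsLocalMax g x)
    (hc : ContinuousAt g x) : deriv (deriv g) x ≤ 0 := by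
  by_contra! hpos
  have hmin := isLocalMin_of_deriv_deriv_pos hpos h.deriv_eq_zero hc
  have hconst : g =ᶠ[nhds x] fun _ => g x := by
    filter_upwards [h, hmin] with y h1 h2 using le_antisymm h1 h2
  have h1 : deriv g =ᶠ[nhds x] fun _ => 0 := by
    filter_upwards [hconst.eventuallyEq_nhds] with y hy
    rw [hy.deriv_eq, deriv_const]
  rw [h1.deriv_eq, deriv_const] at hpos
  exact lt_irrefl _ hpos

theorem pd_pd_nonpos_of_isLocalMax (hU : IsOpen U) (hp : p ∈ U) (hf : ContDiffOn ℝ ∞ f U)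
    (h : IsLocalMax f p) (k : Fin m) : pd k (fun v => pd k f v) p ≤ 0 := by
  set e : EuclideanSpace ℝ (Fin m) := EuclideanSpace.single k 1
  let c : ℝ → EuclideanSpace ℝ (Fin m) := fun s => p + s • e
  have hc : ∀ s, HasDerivAt c e s := fun s => by
    refine (((hasDerivAt_id s).smul_const e).const_add p).congr_deriv ?_
    simp only [one_smul]
  have hc0 : c 0 = p := by simp [c]
  have hcont : Filter.Tendsto c (nhds 0) (nhds p) := by
    have := (hc 0).continuousAt.tendsto
    rwa [hc0] at this
  have hd : ∀ g : EuclideanSpace ℝ (Fin m) → ℝ, ∀ s, DifferentiableAt ℝ g (c s) →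
      HasDerivAt (fun s => g (c s)) (pd k g (c s)) s := fun g s hg =>
    hg.hasFDerivAt.comp_hasDerivAt s (hc s)
  have h1 : deriv (fun s => f (c s)) =ᶠ[nhds 0] fun s => pd k f (c s) := by
    filter_upwards [hcont (hU.mem_nhds hp)] with s hs
    exact (hd f s (differentiableAt_of_smooth hU hf hs)).deriv
  have h2 : deriv (deriv fun s => f (c s)) 0 = pd k (fun v => pd k f v) p := by
    rw [h1.deriv_eq]
    have := (hd (fun v => pd k f v) 0 (by
      rw [hc0]; exact differentiableAt_of_smooth hU (smooth_pd hU hf k) hp)).deriv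
    rw [this, hc0]
  rw [← h2]
  refine deriv_deriv_nonpos_of_isLocalMax ?_ ?_
  · have h3 : IsMaxFilter f (nhds p) (c 0) := by rw [hc0]; exact h
    exact IsMaxFilter.comp_tendsto h3 hcont
  · exact (hd f 0 (by rw [hc0]; exact differentiableAt_of_smooth hU hf hp)).continuousAt

end Extremum

/-! ### The reaction inequality at one point -/

section Reaction

variable {m : ℕ}

theorem sum_traceless_mul (hm : m ≠ 0) {σ y : Fin m → Fin m → ℝ} :
    ∑ i, ∑ j, (σ i j - (∑ k, σ k k) / m * if i = j then 1 else 0)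
        * (y i j - (∑ k, y k k) / m * if i = j then 1 else 0)
      = ∑ i, ∑ j, σ i j * y i j - (∑ k, σ k k) * (∑ k, y k k) / m := by
  have hm' : (m : ℝ) ≠ 0 := Nat.cast_ne_zero.2 hm
  set s := (∑ k, σ k k) / m
  set r := (∑ k, y k k) / m
  have e : ∀ i j, (σ i j - s * if i = j then 1 else 0) * (y i j - r * if i = j then 1 else 0)
      = σ i j * y i j - (if i = j then r * σ i i else 0) - (if i = j then s * y i i else 0)
        + (if i = j then s * r else 0) := by
    intro i j
    split_ifs with h
    · subst h; ring
    · ring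
  simp only [e, Finset.sum_add_distrib, Finset.sum_sub_distrib, Finset.sum_ite_eq,
    Finset.mem_univ, if_true, ← Finset.mul_sum, Finset.sum_const, Finset.card_univ,
    Fintype.card_fin, nsmul_eq_mul]
  simp only [s, r]
  field_simp
  ring

theorem sum_traceless_sq (hm : m ≠ 0) {σ : Fin m → Fin m → ℝ} :
    ∑ i, ∑ j, (σ i j - (∑ k, σ k k) / m * if i = j then 1 else 0) ^ 2
      = ∑ i, ∑ j, σ i j ^ 2 - (∑ k, σ k k) ^ 2 / m := by
  simpa only [← sq] using sum_traceless_mul hm (σ := σ) (y := σ)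

/-- The refined Kato inequality at a critical point of the pinching quotient. -/
theorem kato_of_critical (hm : m ≠ 0) {σ y : Fin m → Fin m → ℝ} {b X : ℝ} (hb : 0 < b)
    (hX : 0 < X) (hP : ∑ i, ∑ j, σ i j ^ 2 - (∑ k, σ k k) ^ 2 / m = b ^ 2 * X ^ 2)
    (hy : ∑ i, ∑ j, σ i j * y i j = ((∑ k, σ k k) / m + b ^ 2 * X) * ∑ k, y k k) :
    (1 / m + b ^ 2) * (∑ k, y k k) ^ 2 ≤ ∑ i, ∑ j, y i j ^ 2 := by
  -- Cauchy–Schwarz for trace-free parts. That of σ has norm bX, and criticality makes its product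
  -- with that of y equal to b²X tr y, so the trace-free part of y has squared norm at least b²(tr
  -- y)².
  have h := sum_sum_mul_sq_le (fun i j => σ i j - (∑ k, σ k k) / m * if i = j then 1 else 0)
    fun i j => y i j - (∑ k, y k k) / m * if i = j then 1 else 0
  rw [sum_traceless_mul hm, sum_traceless_sq hm, sum_traceless_sq hm, hP, hy] at h
  have h1 : (b ^ 2 * X ^ 2) * (b ^ 2 * (∑ k, y k k) ^ 2)
      ≤ (b ^ 2 * X ^ 2) * (∑ i, ∑ j, y i j ^ 2 - (∑ k, y k k) ^ 2 / m) := by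
    refine le_trans (le_of_eq ?_) h
    ring
  have h2 := le_of_mul_le_mul_left h1 (by positivity)
  have h3 : (1 / m + b ^ 2) * (∑ k, y k k) ^ 2
      = b ^ 2 * (∑ k, y k k) ^ 2 + (∑ k, y k k) ^ 2 / m := by ring
  linarith

/-- Cauchy–Schwarz for the trace-free part of σ against v⊗v. It decides the sign of the α̇ terms. -/
theorem sum_traceless_outer_le (hm : m ≠ 0) {σ : Fin m → Fin m → ℝ} {v : Fin m → ℝ} {z : ℝ}
    (hz : 0 ≤ z) (hP : ∑ i, ∑ j, σ i j ^ 2 - (∑ k, σ k k) ^ 2 / m ≤ z ^ 2) :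
    ∑ i, ∑ j, σ i j * (v i * v j) - (∑ k, σ k k) / m * ∑ i, v i ^ 2 ≤ z * ∑ i, v i ^ 2 := by
  have hE : 0 ≤ ∑ i, v i ^ 2 := Finset.sum_nonneg fun _ _ => sq_nonneg _
  have h := abs_sum_sum_mul_le hz hE
    (A := fun i j => σ i j - (∑ k, σ k k) / m * if i = j then 1 else 0)
    (B := fun i j => v i * v j) (by rw [sum_traceless_sq hm]; exact hP) (sum_outer_sq v).le
  refine le_trans (le_of_eq ?_) ((le_abs_self _).trans h)
  have e : ∀ i j, (σ i j - (∑ k, σ k k) / m * if i = j then 1 else 0) * (v i * v j)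
      = σ i j * (v i * v j) - (if i = j then (∑ k, σ k k) / m * v i ^ 2 else 0) := by
    intro i j
    split_ifs with h
    · subst h; ring
    · ring
  simp only [e, Finset.sum_sub_distrib, Finset.sum_ite_eq, Finset.mem_univ, if_true,
    Finset.mul_sum]

/-- The size of the curvature term in the evolution of `|Sic|²`. -/
theorem sum_riem_le (hm : 3 ≤ m) {σ Ric : Fin m → Fin m → ℝ} {v : Fin m → ℝ}
    {Rm W : Fin m → Fin m → Fin m → Fin m → ℝ} {a q s w : ℝ}
    (hσ : ∀ i j, σ i j = σ j i) (hRic : ∀ i j, Ric i j = σ i j + a * (v i * v j))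
    (hRm : ∀ k i j l, Rm k i j l = W k i j l
      + 1 / ((m : ℝ) - 2) * (Ric k l * (1 : Matrix (Fin m) (Fin m) ℝ) i j
        + Ric i j * (1 : Matrix (Fin m) (Fin m) ℝ) k l
        - Ric k j * (1 : Matrix (Fin m) (Fin m) ℝ) i l
        - Ric i l * (1 : Matrix (Fin m) (Fin m) ℝ) k j)
      - (∑ k, Ric k k) / (((m : ℝ) - 1) * ((m : ℝ) - 2))
        * ((1 : Matrix (Fin m) (Fin m) ℝ) k l * (1 : Matrix (Fin m) (Fin m) ℝ) i j
        - (1 : Matrix (Fin m) (Fin m) ℝ) k j * (1 : Matrix (Fin m) (Fin m) ℝ) i l))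
    (ha : 0 ≤ a) (hq : a * ∑ i, v i ^ 2 ≤ q) (hs : 0 ≤ s) (hw : 0 ≤ w)
    (hσs : ∑ i, ∑ j, σ i j ^ 2 = s ^ 2)
    (hW : ∑ i, ∑ j, ∑ k, ∑ l, W i j k l ^ 2 ≤ w ^ 2) :
    ∑ i, ∑ j, σ i j * ∑ k, ∑ l, σ k l * Rm k i j l
      ≤ w * s ^ 2 + (2 * ((s ^ 2 + q * s) * |∑ k, σ k k|) + 2 * (s ^ 3 + q * s ^ 2)
        + (|∑ k, σ k k| + q) * ((∑ k, σ k k) ^ 2 + s ^ 2)) := by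
  have hm3 : (3 : ℝ) ≤ m := by exact_mod_cast hm
  set S := ∑ k, σ k k with hS
  set E := ∑ i, v i ^ 2 with hEd
  have hE : 0 ≤ E := Finset.sum_nonneg fun _ _ => sq_nonneg _
  have haE : 0 ≤ a * E := mul_nonneg ha hE
  have hq0 : 0 ≤ q := haE.trans hq
  have hR : ∑ k, Ric k k = S + a * E := by
    simp only [hRic, Finset.sum_add_distrib, hS, hEd, Finset.mul_sum, sq]
  -- The triangle inequality |Ric| ≤ |Sic| + α|∇φ|², with the last term at most `q`.
  have hRicSq : ∑ i, ∑ j, Ric i j ^ 2 ≤ (s + q) ^ 2 := by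
    have e : ∑ i, ∑ j, Ric i j ^ 2 = s ^ 2 + 2 * a * (∑ i, ∑ j, σ i j * (v i * v j))
        + a ^ 2 * E ^ 2 := by
      rw [← hσs, hEd, ← sum_outer_sq]
      simp only [Finset.mul_sum, ← Finset.sum_add_distrib, hRic]
      exact Finset.sum_congr rfl fun i _ => Finset.sum_congr rfl fun j _ => by ring
    have h1 : ∑ i, ∑ j, σ i j * (v i * v j) ≤ s * E :=
      (le_abs_self _).trans (abs_sum_sum_mul_le hs hE hσs.le (sum_outer_sq v).le)
    have h2 : a * (∑ i, ∑ j, σ i j * (v i * v j)) ≤ q * s := by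
      calc _ ≤ a * (s * E) := mul_le_mul_of_nonneg_left h1 ha
        _ = (a * E) * s := by ring
        _ ≤ q * s := mul_le_mul_of_nonneg_right hq hs
    have h3 : (a * E) ^ 2 ≤ q ^ 2 := pow_le_pow_left₀ haE hq 2
    rw [e]
    linarith [h2, h3]
  have b1 := sum_weyl_le hw hσs.le hW
  have b2 : |∑ i, ∑ j, Ric i j * σ i j| ≤ (s + q) * s :=
    abs_sum_sum_mul_le (by positivity) hs hRicSq hσs.le
  have b3 : |∑ i, ∑ l, Ric i l * ∑ j, σ i j * σ l j| ≤ (s + q) * s ^ 2 :=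
    abs_sum_sum_mul_le (by positivity) (sq_nonneg s) hRicSq (sum_sq_mul_le hσs.le)
  rw [sum_riem_eq hσ _ _ hRm, hσs, hR]
  -- From here on m ≥ 3 is used: 1/(m − 2) and 1/((m − 1)(m − 2)) lie between 0 and 1, so the bound
  -- needs no dimensional constants.
  have c0 : 0 ≤ 1 / ((m : ℝ) - 2) := by
    apply div_nonneg zero_le_one; linarith
  have c1 : 1 / ((m : ℝ) - 2) ≤ 1 := by
    rw [div_le_one] <;> linarith
  have d1 : |(S + a * E) / (((m : ℝ) - 1) * ((m : ℝ) - 2))| ≤ |S| + q := by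
    have hden : 1 ≤ ((m : ℝ) - 1) * ((m : ℝ) - 2) := by nlinarith
    rw [abs_div, abs_of_nonneg (by linarith : 0 ≤ ((m : ℝ) - 1) * ((m : ℝ) - 2))]
    refine (div_le_self (abs_nonneg _) hden).trans ((abs_add_le _ _).trans ?_)
    rw [abs_of_nonneg haE]
    linarith
  set c := 1 / ((m : ℝ) - 2)
  set d := (S + a * E) / (((m : ℝ) - 1) * ((m : ℝ) - 2))
  set A := ∑ i, ∑ j, Ric i j * σ i j
  set B := ∑ i, ∑ l, Ric i l * ∑ j, σ i j * σ l j
  have t1 : c * (2 * (S * A) - 2 * B) ≤ 2 * ((s + q) * s * |S|) + 2 * ((s + q) * s ^ 2) := by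
    have u1 : |S * A| ≤ (s + q) * s * |S| := by
      rw [abs_mul, mul_comm]
      exact mul_le_mul_of_nonneg_right b2 (abs_nonneg S)
    have u2 : 2 * (S * A) - 2 * B ≤ 2 * ((s + q) * s * |S|) + 2 * ((s + q) * s ^ 2) := by
      have := (abs_le.1 u1).2
      have := (abs_le.1 b3).1
      linarith
    have u3 : 0 ≤ 2 * ((s + q) * s * |S|) + 2 * ((s + q) * s ^ 2) := by positivity
    calc _ ≤ c * (2 * ((s + q) * s * |S|) + 2 * ((s + q) * s ^ 2)) :=
          mul_le_mul_of_nonneg_left u2 c0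
      _ ≤ _ := mul_le_of_le_one_left u3 c1
  have t2 : -(d * (S ^ 2 - s ^ 2)) ≤ (|S| + q) * (S ^ 2 + s ^ 2) := by
    refine (neg_le_abs _).trans ?_
    rw [abs_mul]
    refine mul_le_mul d1 ?_ (abs_nonneg _) (by positivity)
    rw [abs_le]
    constructor <;> nlinarith [sq_nonneg S, sq_nonneg s]
  have t3 := (abs_le.1 b1).2
  linarith

/-- The difference is α|Sic(∇φ)|² ≥ 0, so the two cubic terms in the evolution of |Sic|² can be
discarded together. -/
theorem sum_cube_le_sum_ricci {σ Ric : Fin m → Fin m → ℝ} {v : Fin m → ℝ} {a : ℝ}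
    (hσ : ∀ i j, σ i j = σ j i) (hRic : ∀ i j, Ric i j = σ i j + a * (v i * v j)) (ha : 0 ≤ a) :
    ∑ i, ∑ j, σ i j * ∑ k, σ i k * σ k j ≤ ∑ i, ∑ l, Ric i l * ∑ j, σ i j * σ l j := by
  have e : ∑ i, ∑ l, Ric i l * ∑ j, σ i j * σ l j
      = ∑ i, ∑ j, σ i j * ∑ k, σ i k * σ k j + a * ∑ j, (∑ i, σ i j * v i) ^ 2 := by
    have e1 : ∑ j, (∑ i, σ i j * v i) ^ 2 = ∑ i, ∑ l, (v i * v l) * ∑ j, σ i j * σ l j := by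
      simp only [sq, Finset.sum_mul_sum]
      simp only [Finset.mul_sum]
      rw [Finset.sum_comm]
      refine Finset.sum_congr rfl fun i _ => ?_
      rw [Finset.sum_comm]
      exact Finset.sum_congr rfl fun l _ => Finset.sum_congr rfl fun j _ => by ring
    rw [e1, Finset.mul_sum, ← Finset.sum_add_distrib]
    refine Finset.sum_congr rfl fun i _ => ?_
    rw [Finset.mul_sum, ← Finset.sum_add_distrib]
    refine Finset.sum_congr rfl fun l _ => ?_
    rw [hRic, Finset.sum_congr rfl fun j _ => by rw [hσ l j]]
    ring
  rw [e]
  have : 0 ≤ a * ∑ j, (∑ i, σ i j * v i) ^ 2 :=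
    mul_nonneg ha (Finset.sum_nonneg fun _ _ => sq_nonneg _)
  linarith

/-- The time derivative of the pinching quotient is nonpositive where the quotient is large. Here
`DP`, `DS` stand for the Laplacians of `|Sic|²` and `S`, and `y k` for `∇_k Sic`. -/
theorem reaction_nonpos (hm : 3 ≤ m) {σ Ric H : Fin m → Fin m → ℝ} {v : Fin m → ℝ}
    {y : Fin m → Fin m → Fin m → ℝ}
    {Rm W : Fin m → Fin m → Fin m → Fin m → ℝ} {a a₀ α' e₀ w h C b K X DP DS : ℝ}
    (hσ : ∀ i j, σ i j = σ j i) (hRic : ∀ i j, Ric i j = σ i j + a * (v i * v j))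
    (hRm : ∀ k i j l, Rm k i j l = W k i j l
      + 1 / ((m : ℝ) - 2) * (Ric k l * (1 : Matrix (Fin m) (Fin m) ℝ) i j
        + Ric i j * (1 : Matrix (Fin m) (Fin m) ℝ) k l
        - Ric k j * (1 : Matrix (Fin m) (Fin m) ℝ) i l
        - Ric i l * (1 : Matrix (Fin m) (Fin m) ℝ) k j)
      - (∑ k, Ric k k) / (((m : ℝ) - 1) * ((m : ℝ) - 2))
        * ((1 : Matrix (Fin m) (Fin m) ℝ) k l * (1 : Matrix (Fin m) (Fin m) ℝ) i j
        - (1 : Matrix (Fin m) (Fin m) ℝ) k j * (1 : Matrix (Fin m) (Fin m) ℝ) i l))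
    (ha : 0 ≤ a) (haa : a ≤ a₀) (hα' : α' ≤ 0) (hE : ∑ i, v i ^ 2 ≤ e₀) (hw : 0 ≤ w)
    (hh : 0 ≤ h) (hW : ∑ i, ∑ j, ∑ k, ∑ l, W i j k l ^ 2 ≤ w ^ 2)
    (hH : ∑ i, ∑ j, H i j ^ 2 ≤ h ^ 2) (hC : 0 ≤ C) (hK : 0 ≤ K) (hX : 1 ≤ X)
    (hXS : X = ∑ k, σ k k + C) (hwh : w + h ^ 2 ≤ K ^ 2 * X)
    (hP : ∑ i, ∑ j, σ i j ^ 2 - (∑ k, σ k k) ^ 2 / m = b ^ 2 * X ^ 2)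
    (hb : 7 * (2 + C) ^ 3 + 6 * (a₀ * e₀) * (2 + C) ^ 2 + 1
      + ((2 + C) ^ 2 + a₀ * (m + 1) * (2 + C)) * K ≤ b)
    (hgrad : ∀ k, ∑ i, ∑ j, σ i j * y k i j
      = ((∑ k, σ k k) / m + b ^ 2 * X) * ∑ i, y k i i)
    (hlap : DP ≤ 2 * ((∑ k, σ k k) / m + b ^ 2 * X) * DS
      + 2 * (1 / m + b ^ 2) * ∑ k, (∑ i, y k i i) ^ 2) :
    (DP - 2 * ∑ k, ∑ i, ∑ j, y k i j ^ 2
        + 4 * ∑ i, ∑ j, σ i j * ∑ k, σ i k * σ k j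
        + 4 * a * (∑ i, H i i) * ∑ i, ∑ j, σ i j * H i j
        - 2 * α' * ∑ i, ∑ j, σ i j * (v i * v j)
        + 4 * ∑ i, ∑ j, σ i j * ∑ k, ∑ l, σ k l * Rm k i j l
        - 4 * ∑ i, ∑ l, Ric i l * ∑ j, σ i j * σ l j)
      - 2 * ((∑ k, σ k k) / m + b ^ 2 * X) * (DS + 2 * ∑ i, ∑ j, σ i j ^ 2
        + 2 * a * (∑ i, H i i) ^ 2 - α' * ∑ i, v i ^ 2) ≤ 0 := by
  have hm0 : m ≠ 0 := by omega
  have hm1 : (1 : ℝ) ≤ m := by exact_mod_cast (by omega : 1 ≤ m)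
  have hE0 : 0 ≤ ∑ i, v i ^ 2 := Finset.sum_nonneg fun _ _ => sq_nonneg _
  have ha₀ : 0 ≤ a₀ := ha.trans haa
  have he₀ : 0 ≤ e₀ := hE0.trans hE
  have hq : a * ∑ i, v i ^ 2 ≤ a₀ * e₀ := mul_le_mul haa hE hE0 ha₀
  have hq0 : 0 ≤ a₀ * e₀ := mul_nonneg ha₀ he₀
  have hb1 : 1 ≤ b := by
    have : 0 ≤ 7 * (2 + C) ^ 3 + 6 * (a₀ * e₀) * (2 + C) ^ 2
      + ((2 + C) ^ 2 + a₀ * (m + 1) * (2 + C)) * K := by positivity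
    linarith
  have hX0 : 0 < X := by linarith
  have hb0 : 0 < b := by linarith
  -- The second-order condition leaves a gradient term of S; the Kato inequality in each direction
  -- `k` lets −2|∇Sic|² absorb it.
  have kato : 2 * (1 / m + b ^ 2) * ∑ k, (∑ i, y k i i) ^ 2
      ≤ 2 * ∑ k, ∑ i, ∑ j, y k i j ^ 2 := by
    rw [mul_assoc, Finset.mul_sum]
    exact mul_le_mul_of_nonneg_left
      (Finset.sum_le_sum fun k _ => kato_of_critical hm0 hb0 hX0 hP (hgrad k)) zero_le_two
  have hz0 : 0 ≤ b * X := by positivity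
  have hout := sum_traceless_outer_le hm0 (v := v) hz0 (hP.trans_le (by rw [mul_pow]))
  have hcube := sum_cube_le_sum_ricci hσ hRic ha
  obtain ⟨s, hs, hσs⟩ : ∃ s : ℝ, 0 ≤ s ∧ ∑ i, ∑ j, σ i j ^ 2 = s ^ 2 :=
    ⟨_, Real.sqrt_nonneg _, (Real.sq_sqrt (Finset.sum_nonneg fun _ _ =>
      Finset.sum_nonneg fun _ _ => sq_nonneg _)).symm⟩
  have hriem := sum_riem_le hm hσ hRic hRm ha hq hs hw hσs hW
  have hσH := abs_sum_sum_mul_le hs hh hσs.le hH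
  have hL2 : (∑ i, H i i) ^ 2 ≤ m * h ^ 2 :=
    (sum_trace_sq_le H).trans (mul_le_mul_of_nonneg_left hH (by positivity))
  set S := ∑ k, σ k k
  set E := ∑ i, v i ^ 2
  set L := ∑ i, H i i
  set D₁ := ∑ k, ∑ i, ∑ j, y k i j ^ 2
  set T₃ := ∑ i, ∑ j, σ i j * ∑ k, σ i k * σ k j
  set R₃ := ∑ i, ∑ l, Ric i l * ∑ j, σ i j * σ l j
  set N := ∑ i, ∑ j, σ i j * H i j
  set V := ∑ i, ∑ j, σ i j * (v i * v j)
  set Q := ∑ i, ∑ j, σ i j * ∑ k, ∑ l, σ k l * Rm k i j l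
  set Y := ∑ k, (∑ i, y k i i) ^ 2
  rw [hσs] at hP ⊢
  -- S = X − C together with X ≥ 1.
  have hSX : |S| ≤ (1 + C) * X := by
    have h1 : C ≤ C * X := le_mul_of_one_le_right hC hX
    rw [abs_le]; constructor <;> linarith
  have hXz : X ≤ b * X := le_mul_of_one_le_left hX0.le hb1
  have hSz : |S| ≤ (1 + C) * (b * X) :=
    hSX.trans (mul_le_mul_of_nonneg_left hXz (by linarith))
  have hSB : |S| ≤ (2 + C) * (b * X) := hSz.trans (mul_le_mul_of_nonneg_right (by linarith) hz0)
  have hSm : S ^ 2 / m ≤ S ^ 2 := div_le_self (sq_nonneg S) hm1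
  -- |Sic|² = z² + S²/m with |S| ≤ (1 + C)z, and 1 + (1 + C)² ≤ (2 + C)². This is the origin of the
  -- constant 2 + C.
  have hsB : s ≤ (2 + C) * (b * X) := by
    refine (le_abs_self _).trans (abs_le_of_sq_le_sq ?_ (by positivity))
    have h1 : S ^ 2 ≤ ((1 + C) * (b * X)) ^ 2 := by
      rw [← sq_abs]; exact pow_le_pow_left₀ (abs_nonneg S) hSz 2
    have h2 : 0 ≤ (1 + C) * (b * X) ^ 2 := by positivity
    linarith
  have hL : |L| ≤ m * h := by
    refine abs_le_of_sq_le_sq ?_ (by positivity)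
    refine hL2.trans ?_
    rw [mul_pow]
    exact mul_le_mul_of_nonneg_right (le_self_pow₀ hm1 two_ne_zero) (sq_nonneg h)
  have hLN : a * L * N ≤ a₀ * m * h ^ 2 * s := by
    calc a * L * N = a * (L * N) := by ring
      _ ≤ a * |L * N| := mul_le_mul_of_nonneg_left (le_abs_self _) ha
      _ ≤ a₀ * ((m * h) * (s * h)) := by
          rw [abs_mul]
          exact mul_le_mul haa (mul_le_mul hL hσH (abs_nonneg _) (by positivity))
            (by positivity) ha₀
      _ = _ := by ring
  have hSd : ∀ x, 0 ≤ x → -(S / m * x) ≤ |S| / m * x := fun x hx => by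
    rw [← neg_mul, ← neg_div]
    exact mul_le_mul_of_nonneg_right
      (div_le_div_of_nonneg_right (neg_le_abs S) (by positivity)) hx
  have hS1 : -(S / m * s ^ 2) ≤ |S| * s ^ 2 :=
    (hSd _ (sq_nonneg s)).trans (mul_le_mul_of_nonneg_right
      (div_le_self (abs_nonneg S) hm1) (sq_nonneg s))
  -- Of the factor S/m + b²X multiplying (Δφ)², the b² part has a favourable sign (`hbL`), so only
  -- the S/m part has to be estimated. Its 1/m cancels the m from (Δφ)² ≤ m|∇²φ|².
  have hS2 : -(S / m * (a * L ^ 2)) ≤ |S| * a₀ * h ^ 2 := by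
    refine (hSd _ (by positivity)).trans ?_
    have : a * L ^ 2 ≤ a₀ * (m * h ^ 2) := mul_le_mul haa hL2 (sq_nonneg L) ha₀
    calc |S| / m * (a * L ^ 2) ≤ |S| / m * (a₀ * (m * h ^ 2)) :=
          mul_le_mul_of_nonneg_left this (by positivity)
      _ = _ := by field_simp
  -- Sin(∇φ, ∇φ) ≤ bX|∇φ|² ≤ b²X|∇φ|² since b ≥ 1, so the α̇ terms are nonpositive however large
  -- |α̇| is.
  have hVE : -2 * α' * (V - S / m * E - b ^ 2 * X * E) ≤ 0 := by
    have h1 : b * X * E ≤ b ^ 2 * X * E := by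
      exact mul_le_mul_of_nonneg_right (mul_le_mul_of_nonneg_right
        (le_self_pow₀ hb1 two_ne_zero) hX0.le) hE0
    exact mul_nonpos_of_nonneg_of_nonpos (by linarith) (by linarith)
  -- The good term: |Sic|² ≥ |Sin|² = z².
  have hPz : b ^ 2 * X * (b * X) ^ 2 ≤ b ^ 2 * X * s ^ 2 := by
    refine mul_le_mul_of_nonneg_left ?_ (by positivity)
    have : 0 ≤ S ^ 2 / m := by positivity
    rw [mul_pow]; linarith
  have hbL : 0 ≤ b ^ 2 * X * (a * L ^ 2) := by positivity
  have hcub := cubic_absorption (B := 2 + C) (q := a₀ * e₀) (a₀ := a₀) (μ := m) (K := K) (b := b)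
    (z := b * X) (X := X) (s := s) (S := S) (w := w) (h := h) (by linarith) hq0 ha₀ (by positivity)
    hK (hX.trans hXz) hX0.le rfl hb hs hsB hSB hw hwh le_rfl
  linarith

end Reaction

/-! ### The pinching quotient in coordinates -/

section Pinching

variable {m : ℕ} {U V : Set (EuclideanSpace ℝ (Fin m))}
  {p u v : EuclideanSpace ℝ (Fin m)}
  {ψ : EuclideanSpace ℝ (Fin m) → EuclideanSpace ℝ (Fin m)}

/-- The square of `|Sin| / (S + C)`. -/
noncomputable def pinching (G : EuclideanSpace ℝ (Fin m) → Matrix (Fin m) (Fin m) ℝ)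
    (F : EuclideanSpace ℝ (Fin m) → ℝ) (a C : ℝ) (u : EuclideanSpace ℝ (Fin m)) : ℝ :=
  (sicSq G F a u - sicTrace G F a u ^ 2 / m) / (sicTrace G F a u + C) ^ 2

variable {G G' : EuclideanSpace ℝ (Fin m) → Matrix (Fin m) (Fin m) ℝ}
  {F F' : EuclideanSpace ℝ (Fin m) → ℝ}

theorem quadForm_one {ι : Type*} [Fintype ι] [DecidableEq ι] (A : Matrix ι ι ℝ) :
    quadForm 1 A = ∑ i, ∑ j, A i j ^ 2 := by
  simp [quadForm_apply, Matrix.one_apply, sq]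

theorem NormalAt.norm2_eq (hn : NormalAt G p) (A : Fin m → Fin m → ℝ) :
    norm2 G p A = Real.sqrt (∑ i, ∑ j, A i j ^ 2) := by
  rw [RicciHarmonic.norm2_eq, hn.eq_one, inv_one, quadForm_one]
  rfl

theorem NormalAt.norm4_eq (hn : NormalAt G p) (A : Fin m → Fin m → Fin m → Fin m → ℝ) :
    norm4 G p A = Real.sqrt (∑ i, ∑ j, ∑ k, ∑ l, A i j k l ^ 2) := by
  rw [RicciHarmonic.norm4_eq, hn.eq_one, inv_one,
    Matrix.kroneckerMap_one_one _ (by simp) (by simp) (by simp), quadForm_one]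
  congr 1
  simp only [Fintype.sum_prod_type]
  rfl

theorem NormalAt.sicSq_eq (hn : NormalAt G p) (h : MetricOn U G) (hp : p ∈ U) (a : ℝ) :
    sicSq G F a p = ∑ i, ∑ j, sic G F a p i j ^ 2 := by
  unfold sicSq
  refine Finset.sum_congr rfl fun i _ => Finset.sum_congr rfl fun j _ => ?_
  rw [hn.sicEnd_eq, hn.sicEnd_eq, h.sic_symm hp F a j i, sq]

theorem NormalAt.sicTrace_eq (hn : NormalAt G p) (a : ℝ) :
    sicTrace G F a p = ∑ i, sic G F a p i i := hn.trace2_eq _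

theorem NormalAt.gradSq_eq (hn : NormalAt G p) : gradSq G F p = ∑ i, pd i F p ^ 2 := by
  refine (hn.trace2_eq _).trans (Finset.sum_congr rfl fun i _ => (sq _).symm)

theorem CoordChange.sicSq_eq (hψ : CoordChange V U ψ) (h : MetricOn U G')
    (hG : ∀ v ∈ V, G v = pullMetric ψ G' v) (hF' : ContDiffOn ℝ ∞ F' U)
    (hF : ∀ v ∈ V, F v = F' (ψ v)) (hv : v ∈ V) (a : ℝ) :
    sicSq G F a v = sicSq G' F' a (ψ v) := by
  have e : ∀ (G : EuclideanSpace ℝ (Fin m) → Matrix (Fin m) (Fin m) ℝ) F u,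
      sicSq G F a u = (sicEnd G F a u * sicEnd G F a u).trace := fun G F u => by
    simp [sicSq, Matrix.trace, Matrix.mul_apply]
  have e1 := hψ.sicEnd_eq h hG hF' hF hv a
  have e2 : sicEnd G F a v = (jac ψ v)⁻¹ * (sicEnd G' F' a (ψ v) * jac ψ v) := by
    rw [← e1, ← Matrix.mul_assoc, hψ.inv_mul hv, Matrix.one_mul]
  rw [e, e]
  have e3 : sicEnd G F a v * sicEnd G F a v
      = (jac ψ v)⁻¹ * (sicEnd G' F' a (ψ v) * sicEnd G' F' a (ψ v) * jac ψ v) := by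
    nth_rewrite 1 [e2]
    rw [Matrix.mul_assoc, Matrix.mul_assoc, e1, Matrix.mul_assoc]
  rw [e3, Matrix.trace_mul_comm, Matrix.mul_assoc, hψ.mul_inv hv, Matrix.mul_one]

theorem CoordChange.pinching_eq (hψ : CoordChange V U ψ) (h : MetricOn U G')
    (hG : ∀ v ∈ V, G v = pullMetric ψ G' v) (hF' : ContDiffOn ℝ ∞ F' U)
    (hF : ∀ v ∈ V, F v = F' (ψ v)) (hv : v ∈ V) (a C : ℝ) :
    pinching G F a C v = pinching G' F' a C (ψ v) := by
  simp only [pinching, hψ.sicSq_eq h hG hF' hF hv a, hψ.sicTrace_eq h hG hF' hF hv a]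

theorem MetricOn.norm2_sin_sq (hm : m ≠ 0) (h : MetricOn U G) (hF : ContDiffOn ℝ ∞ F U)
    (hu : u ∈ U) (a : ℝ) :
    norm2 G u (sin G F a u) ^ 2 = sicSq G F a u - sicTrace G F a u ^ 2 / m := by
  obtain ⟨V, ψ, hψ, h0, hψ0, hn⟩ := h.exists_normal hu
  have hG : ∀ v ∈ V, pullMetric ψ G v = pullMetric ψ G v := fun _ _ => rfl
  have hF' : ∀ v ∈ V, (fun w => F (ψ w)) v = F (ψ v) := fun _ _ => rfl
  have e1 := hψ.norm2_eq hG h0 (hψ.sin_eq h hG hF hF' h0 a)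
  have e2 := hψ.sicSq_eq h hG hF hF' h0 a
  have e3 := hψ.sicTrace_eq h hG hF hF' h0 a
  rw [hψ0] at e1 e2 e3
  rw [← e1, ← e2, ← e3, hn.norm2_eq, Real.sq_sqrt (Finset.sum_nonneg fun _ _ =>
    Finset.sum_nonneg fun _ _ => sq_nonneg _), hn.sicSq_eq (hψ.metricOn h hG) h0,
    hn.sicTrace_eq, ← sum_traceless_sq hm]
  refine Finset.sum_congr rfl fun i _ => Finset.sum_congr rfl fun j _ => ?_
  rw [sin, hn.sicTrace_eq, hn.eq_one, Matrix.one_apply]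

theorem pd_mul_self (hU : IsOpen U) {f : EuclideanSpace ℝ (Fin m) → ℝ} (hf : ContDiffOn ℝ ∞ f U)
    (hu : u ∈ U) (k : Fin m) : pd k (fun v => f v * f v) u = 2 * (f u * pd k f u) := by
  have := differentiableAt_of_smooth hU hf hu
  rw [pd_mul k this this]
  ring

theorem pd_pd_mul_self (hU : IsOpen U) {f : EuclideanSpace ℝ (Fin m) → ℝ}
    (hf : ContDiffOn ℝ ∞ f U) (hu : u ∈ U) (k : Fin m) :
    pd k (fun v => pd k (fun w => f w * f w) v) u
      = 2 * (pd k f u ^ 2 + f u * pd k (fun v => pd k f v) u) := by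
  have d1 := differentiableAt_of_smooth hU hf hu
  have d2 := differentiableAt_of_smooth hU (smooth_pd hU hf k) hu
  rw [pd_congr k hU hu fun v hv => pd_mul_self hU hf hv k, pd_const_mul k _ (d1.fun_mul d2),
    pd_mul k d1 d2]
  ring

/-- First and second order conditions at a spatial maximum of `(P - S²/m) / (S + C)²`. -/
theorem conditions_of_isLocalMax (hU : IsOpen U) (hp : p ∈ U)
    {P S : EuclideanSpace ℝ (Fin m) → ℝ} (hP : ContDiffOn ℝ ∞ P U) (hS : ContDiffOn ℝ ∞ S U)
    {μ b C : ℝ} (hX : 0 < S p + C)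
    (hb : P p - S p ^ 2 / μ = b ^ 2 * (S p + C) ^ 2)
    (hmax : IsLocalMax (fun u => (P u - S u ^ 2 / μ) / (S u + C) ^ 2) p) (k : Fin m) :
    pd k P p = 2 * (S p / μ + b ^ 2 * (S p + C)) * pd k S p ∧
      pd k (fun v => pd k P v) p
        ≤ 2 * (S p / μ + b ^ 2 * (S p + C)) * pd k (fun v => pd k S v) p
          + 2 * (1 / μ + b ^ 2) * pd k S p ^ 2 := by
  let X : EuclideanSpace ℝ (Fin m) → ℝ := fun u => S u + C
  have hXs : ContDiffOn ℝ ∞ X U := hS.add contDiffOn_const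
  have hpX : ∀ v ∈ U, pd k X v = pd k S v := fun v hv => by
    have := pd_add k (differentiableAt_of_smooth hU hS hv) (differentiableAt_const (c := C))
    rw [pd_const, add_zero] at this
    exact this
  -- The denominator is cleared. This function is at most 0 near `p` with equality at `p`, so the
  -- derivative tests apply to a polynomial in P and S.
  let f : EuclideanSpace ℝ (Fin m) → ℝ := fun u =>
    P u - ((1 / μ) * (S u * S u) + b ^ 2 * (X u * X u))
  have hSS : ContDiffOn ℝ ∞ (fun u => S u * S u) U := hS.mul hS
  have hXX : ContDiffOn ℝ ∞ (fun u => X u * X u) U := hXs.mul hXs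
  have hf1 : ContDiffOn ℝ ∞ (fun u => (1 / μ) * (S u * S u) + b ^ 2 * (X u * X u)) U :=
    (contDiffOn_const.mul hSS).add (contDiffOn_const.mul hXX)
  have hfs : ContDiffOn ℝ ∞ f U := hP.sub hf1
  have hfmax : IsLocalMax f p := by
    have hc : ContinuousAt X p := (differentiableAt_of_smooth hU hXs hp).continuousAt
    filter_upwards [hmax, hc.eventually (lt_mem_nhds hX)] with u h1 h2
    rw [hb, mul_div_assoc, div_self (by positivity), mul_one, div_le_iff₀ (pow_pos h2 2)] at h1
    have e1 : f p = 0 := by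
      have : f p = P p - S p ^ 2 / μ - b ^ 2 * (S p + C) ^ 2 := by simp only [f, X]; ring
      rw [this, hb, sub_self]
    have e2 : f u = P u - S u ^ 2 / μ - b ^ 2 * X u ^ 2 := by simp only [f, X]; ring
    rw [e1, e2]
    linarith
  have hpd : ∀ v ∈ U, pd k f v = pd k P v
      - ((1 / μ) * pd k (fun u => S u * S u) v + b ^ 2 * pd k (fun u => X u * X u) v) := by
    intro v hv
    have dS := differentiableAt_of_smooth hU hSS hv
    have dX := differentiableAt_of_smooth hU hXX hv
    rw [pd_sub k (differentiableAt_of_smooth hU hP hv) (differentiableAt_of_smooth hU hf1 hv),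
      pd_add k (dS.const_mul _) (dX.const_mul _), pd_const_mul k _ dS, pd_const_mul k _ dX]
  have h1 := pd_eq_zero_of_isLocalMax hfmax k
  have h2 := pd_pd_nonpos_of_isLocalMax hU hp hfs hfmax k
  rw [hpd p hp, pd_mul_self hU hS hp, pd_mul_self hU hXs hp, hpX p hp] at h1
  have dP := differentiableAt_of_smooth hU (smooth_pd hU hP k) hp
  have dS := differentiableAt_of_smooth hU (smooth_pd hU hSS k) hp
  have dX := differentiableAt_of_smooth hU (smooth_pd hU hXX k) hp
  rw [pd_congr k hU hp hpd, pd_sub k dP ((dS.const_mul _).fun_add (dX.const_mul _)),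
    pd_add k (dS.const_mul _) (dX.const_mul _), pd_const_mul k _ dS, pd_const_mul k _ dX,
    pd_pd_mul_self hU hS hp, pd_pd_mul_self hU hXs hp, hpX p hp, pd_congr k hU hp hpX] at h2
  simp only [X] at h1 h2
  constructor
  · linear_combination h1
  · have e : 2 * (S p / μ + b ^ 2 * (S p + C)) * pd k (fun v => pd k S v) p
          + 2 * (1 / μ + b ^ 2) * pd k S p ^ 2
        = 1 / μ * (2 * (pd k S p ^ 2 + S p * pd k (fun v => pd k S v) p)) +
          b ^ 2 * (2 * (pd k S p ^ 2 + (S p + C) * pd k (fun v => pd k S v) p)) := by ring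
    rw [e]
    linarith

end Pinching

/-! ### The three scalars at their spatial extrema along the flow. -/

section FlowPinching

variable {m : ℕ} {U V : Set (EuclideanSpace ℝ (Fin m))} {I : Set ℝ} {α : ℝ → ℝ}
  {G : ℝ → EuclideanSpace ℝ (Fin m) → Matrix (Fin m) (Fin m) ℝ}
  {F : ℝ → EuclideanSpace ℝ (Fin m) → ℝ} {t α' : ℝ} {p u : EuclideanSpace ℝ (Fin m)}
  {ψ : EuclideanSpace ℝ (Fin m) → EuclideanSpace ℝ (Fin m)}

/-- With the value b² inserted, the quotient rule produces the same factor S/μ + b²(S + C) as the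
spatial conditions, so the second derivatives of S will cancel. -/
theorem hasDerivAt_quotient {P S : ℝ → ℝ} {P' S' μ b C : ℝ} (hP : HasDerivAt P P' t)
    (hS : HasDerivAt S S' t) (hX : S t + C ≠ 0)
    (hb : P t - S t ^ 2 / μ = b ^ 2 * (S t + C) ^ 2) :
    HasDerivAt (fun s => (P s - S s ^ 2 / μ) / (S s + C) ^ 2)
      ((P' - 2 * (S t / μ + b ^ 2 * (S t + C)) * S') / (S t + C) ^ 2) t := by
  refine ((hP.fun_sub ((hS.fun_pow 2).div_const μ)).fun_div ((hS.add_const C).fun_pow 2)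
    (pow_ne_zero 2 hX)).congr_deriv ?_
  rw [hb]
  field_simp
  push_cast
  ring

/-- The coordinate change does not depend on time, so coordinates normal at one instant can be used
without altering the flow equations. -/
theorem LocalFlow.pull (hf : LocalFlow U I α G F) (hψ : CoordChange V U ψ) :
    LocalFlow V I α (fun t => pullMetric ψ (G t)) (fun t v => F t (ψ v)) where
  family := hψ.metricFamily hf.family fun _ _ _ _ => rfl
  isOpen_time := hf.isOpen_time
  smooth_map := hψ.jsmooth_comp hf.smooth_map
  metric_eq := by
    intro t ht v hv i j
    have e := congrFun (congrFun (hψ.sic_eq (hf.metricOn ht) (fun _ _ => rfl)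
      (hf.smooth_map.slice ht) (fun _ _ => rfl) hv (α t)) i) j
    rw [pull2_apply] at e
    simp only [Matrix.of_apply] at e
    rw [e]
    have e2 : ∀ s, pullMetric ψ (G s) v i j
        = ∑ a, ∑ b, jac ψ v a i * jac ψ v b j * G s (ψ v) a b := fun s =>
      pull2_apply _ _ _ _
    simp only [e2, Finset.mul_sum]
    refine HasDerivAt.fun_sum fun a _ => HasDerivAt.fun_sum fun b _ => ?_
    refine ((hf.metric_eq t ht (ψ v) (hψ.mapsTo hv) a b).const_mul _).congr_deriv ?_
    ring
  map_eq := by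
    intro t ht v hv
    have e := hψ.lap_eq (G := pullMetric ψ (G t)) (F := fun v => F t (ψ v)) (hf.metricOn ht)
      (fun _ _ => rfl) (hf.smooth_map.slice ht) (fun _ _ => rfl) hv
    rw [e]
    exact hf.map_eq t ht (ψ v) (hψ.mapsTo hv)

theorem LocalFlow.sicTrace_normal (hf : LocalFlow U I α G F) (ht : t ∈ I) (hp : p ∈ U)
    (hn : NormalAt (G t) p) (hα : HasDerivAt α α' t) (ha : 0 ≤ α t) (ha' : α' ≤ 0)
    (hmin : IsLocalMin (sicTrace (G t) (F t) (α t)) p) :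
    ∃ d, 0 ≤ d ∧ HasDerivAt (fun s => sicTrace (G s) (F s) (α s) p) d t := by
  refine ⟨_, ?_, hf.hasDerivAt_sicTrace ht hp hn hα⟩
  have hs := (hf.metricOn ht).smooth_sicTrace (hf.smooth_map.slice ht) (α t)
  have h1 : ∀ k, 0 ≤ pd k (fun v => pd k (sicTrace (G t) (F t) (α t)) v) p := by
    intro k
    have := pd_pd_nonpos_of_isLocalMax hf.family.isOpen hp hs.neg hmin.neg k
    rw [pd_congr k hf.family.isOpen hp fun v hv => pd_neg k (f := sicTrace (G t) (F t) (α t)),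
      pd_neg k] at this
    linarith
  have h2 : 0 ≤ ∑ i, ∑ j, sic (G t) (F t) (α t) p i j ^ 2 :=
    Finset.sum_nonneg fun _ _ => Finset.sum_nonneg fun _ _ => sq_nonneg _
  have h3 : 0 ≤ -α' * ∑ i, pd i (F t) p ^ 2 :=
    mul_nonneg (by linarith) (Finset.sum_nonneg fun _ _ => sq_nonneg _)
  have h4 : 0 ≤ α t * lap (G t) (F t) p ^ 2 := by positivity
  have h5 := Finset.sum_nonneg fun k (_ : k ∈ Finset.univ) => h1 k
  linarith

theorem LocalFlow.gradSq_normal (hf : LocalFlow U I α G F) (ht : t ∈ I) (hp : p ∈ U)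
    (hn : NormalAt (G t) p) (ha : 0 ≤ α t) (hmax : IsLocalMax (gradSq (G t) (F t)) p) :
    ∃ d, d ≤ 0 ∧ HasDerivAt (fun s => gradSq (G s) (F s) p) d t := by
  refine ⟨_, ?_, hf.hasDerivAt_gradSq ht hp hn⟩
  have hs := (hf.metricOn ht).smooth_gradSq (hf.smooth_map.slice ht)
  have h1 := Finset.sum_nonpos fun k (_ : k ∈ Finset.univ) =>
    pd_pd_nonpos_of_isLocalMax hf.family.isOpen hp hs hmax k
  have h2 : 0 ≤ ∑ k, ∑ i, hess (G t) (F t) p k i ^ 2 :=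
    Finset.sum_nonneg fun _ _ => Finset.sum_nonneg fun _ _ => sq_nonneg _
  have h3 : 0 ≤ α t * (∑ i, pd i (F t) p ^ 2) ^ 2 := by positivity
  linarith

theorem LocalFlow.pinching_normal (hm : 3 ≤ m) (hf : LocalFlow U I α G F) (ht : t ∈ I)
    (hp : p ∈ U) (hn : NormalAt (G t) p) (hα : HasDerivAt α α' t) (ha : 0 ≤ α t)
    (ha' : α' ≤ 0) {a₀ e₀ C K b : ℝ} (haa : α t ≤ a₀) (he : gradSq (G t) (F t) p ≤ e₀)
    (hC : 0 ≤ C) (hK : 0 ≤ K) (hX : 1 ≤ sicTrace (G t) (F t) (α t) p + C)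
    (hWH : norm4 (G t) p (weyl (G t) p) + norm2 (G t) p (hess (G t) (F t) p) ^ 2
      ≤ K ^ 2 * (sicTrace (G t) (F t) (α t) p + C))
    (hb : pinching (G t) (F t) (α t) C p = b ^ 2)
    (hbK : 7 * (2 + C) ^ 3 + 6 * (a₀ * e₀) * (2 + C) ^ 2 + 1
      + ((2 + C) ^ 2 + a₀ * (m + 1) * (2 + C)) * K ≤ b)
    (hmax : IsLocalMax (pinching (G t) (F t) (α t) C) p) :
    ∃ d, d ≤ 0 ∧ HasDerivAt (fun s => pinching (G s) (F s) (α s) C p) d t := by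
  have h := hf.metricOn ht
  have hF := hf.smooth_map.slice ht
  have hU := hf.family.isOpen
  have hS' := hf.hasDerivAt_sicTrace ht hp hn hα
  have hP' := hf.hasDerivAt_sicSq ht hp hn hα rfl
  have hX0 : 0 < sicTrace (G t) (F t) (α t) p + C := by linarith
  have hb' : sicSq (G t) (F t) (α t) p - sicTrace (G t) (F t) (α t) p ^ 2 / m
      = b ^ 2 * (sicTrace (G t) (F t) (α t) p + C) ^ 2 := by
    rw [← hb, pinching, div_mul_cancel₀ _ (by positivity)]
  have hcond := conditions_of_isLocalMax hU hp (h.smooth_sicSq hF (α t))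
    (h.smooth_sicTrace hF (α t)) hX0 hb' hmax
  have hL : lap (G t) (F t) p = ∑ i, hess (G t) (F t) p i i := hn.trace2_eq _
  have hSn : sicTrace (G t) (F t) (α t) p = ∑ i, sic (G t) (F t) (α t) p i i := hn.sicTrace_eq _
  have hpdS : ∀ k, pd k (sicTrace (G t) (F t) (α t)) p
      = ∑ i, pd k (fun v => sicEnd (G t) (F t) (α t) v i i) p := fun k =>
    h.pd_sicTrace hp hF (α t) k
  have hgrad : ∀ k, ∑ i, ∑ j, sic (G t) (F t) (α t) p i j
      * pd k (fun v => sicEnd (G t) (F t) (α t) v i j) p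
      = ((∑ i, sic (G t) (F t) (α t) p i i) / m
          + b ^ 2 * (sicTrace (G t) (F t) (α t) p + C))
        * ∑ i, pd k (fun v => sicEnd (G t) (F t) (α t) v i i) p := by
    intro k
    have e := (hcond k).1
    rw [h.pd_sicSq hp hF, hpdS] at e
    simp only [hn.sicEnd_eq] at e
    rw [← hSn]
    have e2 : ∑ i, ∑ j, sic (G t) (F t) (α t) p i j
        * pd k (fun v => sicEnd (G t) (F t) (α t) v i j) p
        = ∑ i, ∑ j, sic (G t) (F t) (α t) p i j
          * pd k (fun v => sicEnd (G t) (F t) (α t) v j i) p :=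
      Finset.sum_congr rfl fun i _ => Finset.sum_congr rfl fun j _ => by
        rw [hn.pd_sicEnd_symm h hp hF]
    rw [e2]
    linear_combination e / 2
  have hlap : ∑ k, pd k (fun v => pd k (sicSq (G t) (F t) (α t)) v) p
      ≤ 2 * ((∑ i, sic (G t) (F t) (α t) p i i) / m
          + b ^ 2 * (sicTrace (G t) (F t) (α t) p + C))
        * ∑ k, pd k (fun v => pd k (sicTrace (G t) (F t) (α t)) v) p
        + 2 * (1 / m + b ^ 2)
          * ∑ k, (∑ i, pd k (fun v => sicEnd (G t) (F t) (α t) v i i) p) ^ 2 := by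
    rw [← hSn, Finset.mul_sum, Finset.mul_sum, ← Finset.sum_add_distrib]
    refine Finset.sum_le_sum fun k _ => ?_
    rw [← hpdS]
    exact (hcond k).2
  rw [hL] at hS' hP'
  rw [hn.gradSq_eq] at he
  rw [hn.norm4_eq, hn.norm2_eq] at hWH
  have hsqW : 0 ≤ ∑ i, ∑ j, ∑ k, ∑ l, weyl (G t) p i j k l ^ 2 :=
    Finset.sum_nonneg fun _ _ => Finset.sum_nonneg fun _ _ => Finset.sum_nonneg fun _ _ =>
      Finset.sum_nonneg fun _ _ => sq_nonneg _
  have hsqH : 0 ≤ ∑ i, ∑ j, hess (G t) (F t) p i j ^ 2 :=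
    Finset.sum_nonneg fun _ _ => Finset.sum_nonneg fun _ _ => sq_nonneg _
  have key := reaction_nonpos hm (σ := sic (G t) (F t) (α t) p) (Ric := ricci (G t) p)
    (H := hess (G t) (F t) p) (v := fun i => pd i (F t) p)
    (y := fun k i j => pd k (fun v => sicEnd (G t) (F t) (α t) v i j) p)
    (Rm := riem (G t) p) (W := weyl (G t) p) (a := α t)
    (h.sic_symm hp _ _) (fun i j => by rw [sic]; ring)
    (fun k i j l => by
      rw [weyl, scal, hn.trace2_eq, hn.eq_one]; ring)
    ha haa ha' he (Real.sqrt_nonneg _) (Real.sqrt_nonneg _) (Real.sq_sqrt hsqW).ge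
    (Real.sq_sqrt hsqH).ge hC hK hX (by rw [hSn]) hWH
    (by rw [← hn.sicSq_eq h hp, ← hSn, hb']) hbK hgrad hlap
  rw [← hSn] at key
  exact ⟨_, div_nonpos_of_nonpos_of_nonneg key (sq_nonneg _),
    hasDerivAt_quotient hP' hS' hX0.ne' hb'⟩

/-- At a spatial minimum, `S` is nondecreasing in time. -/
theorem LocalFlow.sicTrace_of_isLocalMin (hf : LocalFlow U I α G F) (ht : t ∈ I) (hu : u ∈ U)
    (hα : HasDerivAt α α' t) (ha : 0 ≤ α t) (ha' : α' ≤ 0)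
    (hmin : IsLocalMin (sicTrace (G t) (F t) (α t)) u) :
    ∃ d, 0 ≤ d ∧ HasDerivAt (fun s => sicTrace (G s) (F s) (α s) u) d t := by
  obtain ⟨V, ψ, hψ, h0, rfl, hn⟩ := (hf.metricOn ht).exists_normal hu
  have e : ∀ s ∈ I, ∀ v ∈ V, sicTrace (pullMetric ψ (G s)) (fun v => F s (ψ v)) (α s) v
      = sicTrace (G s) (F s) (α s) (ψ v) := fun s hs v hv =>
    hψ.sicTrace_eq (hf.metricOn hs) (fun _ _ => rfl) (hf.smooth_map.slice hs) (fun _ _ => rfl) hv _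
  have hmin' : IsLocalMin (sicTrace (pullMetric ψ (G t)) (fun v => F t (ψ v)) (α t)) 0 := by
    have h1 := IsMinFilter.comp_tendsto hmin (hψ.differentiableAt h0).continuousAt.tendsto
    filter_upwards [h1, hψ.isOpen.mem_nhds h0] with v hv hvV
    rw [e t ht v hvV, e t ht 0 h0]
    exact hv
  obtain ⟨d, hd, hder⟩ := (hf.pull hψ).sicTrace_normal ht h0 hn hα ha ha' hmin'
  refine ⟨d, hd, hder.congr_of_eventuallyEq ?_⟩
  filter_upwards [hf.isOpen_time.mem_nhds ht] with s hs using (e s hs 0 h0).symm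

/-- At a spatial maximum, `|∇φ|²` is nonincreasing in time. -/
theorem LocalFlow.gradSq_of_isLocalMax (hf : LocalFlow U I α G F) (ht : t ∈ I) (hu : u ∈ U)
    (ha : 0 ≤ α t) (hmax : IsLocalMax (gradSq (G t) (F t)) u) :
    ∃ d, d ≤ 0 ∧ HasDerivAt (fun s => gradSq (G s) (F s) u) d t := by
  obtain ⟨V, ψ, hψ, h0, rfl, hn⟩ := (hf.metricOn ht).exists_normal hu
  have e : ∀ s ∈ I, ∀ v ∈ V, gradSq (pullMetric ψ (G s)) (fun v => F s (ψ v)) v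
      = gradSq (G s) (F s) (ψ v) := fun s hs v hv =>
    hψ.gradSq_eq (hf.metricOn hs) (fun _ _ => rfl) (hf.smooth_map.slice hs) (fun _ _ => rfl) hv
  have hmax' : IsLocalMax (gradSq (pullMetric ψ (G t)) (fun v => F t (ψ v))) 0 := by
    have h1 := IsMaxFilter.comp_tendsto hmax (hψ.differentiableAt h0).continuousAt.tendsto
    filter_upwards [h1, hψ.isOpen.mem_nhds h0] with v hv hvV
    rw [e t ht v hvV, e t ht 0 h0]
    exact hv
  obtain ⟨d, hd, hder⟩ := (hf.pull hψ).gradSq_normal ht h0 hn ha hmax'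
  refine ⟨d, hd, hder.congr_of_eventuallyEq ?_⟩
  filter_upwards [hf.isOpen_time.mem_nhds ht] with s hs using (e s hs 0 h0).symm

/-- At a spatial maximum where it is large, the pinching quotient is nonincreasing in time. -/
theorem LocalFlow.pinching_of_isLocalMax (hm : 3 ≤ m) (hf : LocalFlow U I α G F) (ht : t ∈ I)
    (hu : u ∈ U) (hα : HasDerivAt α α' t) (ha : 0 ≤ α t)
    (ha' : α' ≤ 0) {a₀ e₀ C K b : ℝ} (haa : α t ≤ a₀) (he : gradSq (G t) (F t) u ≤ e₀)
    (hC : 0 ≤ C) (hK : 0 ≤ K) (hX : 1 ≤ sicTrace (G t) (F t) (α t) u + C)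
    (hWH : norm4 (G t) u (weyl (G t) u) + norm2 (G t) u (hess (G t) (F t) u) ^ 2
      ≤ K ^ 2 * (sicTrace (G t) (F t) (α t) u + C))
    (hb : pinching (G t) (F t) (α t) C u = b ^ 2)
    (hbK : 7 * (2 + C) ^ 3 + 6 * (a₀ * e₀) * (2 + C) ^ 2 + 1
      + ((2 + C) ^ 2 + a₀ * (m + 1) * (2 + C)) * K ≤ b)
    (hmax : IsLocalMax (pinching (G t) (F t) (α t) C) u) :
    ∃ d, d ≤ 0 ∧ HasDerivAt (fun s => pinching (G s) (F s) (α s) C u) d t := by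
  obtain ⟨V, ψ, hψ, h0, rfl, hn⟩ := (hf.metricOn ht).exists_normal hu
  have hG : ∀ v ∈ V, pullMetric ψ (G t) v = pullMetric ψ (G t) v := fun _ _ => rfl
  have hF : ∀ v ∈ V, (fun w => F t (ψ w)) v = F t (ψ v) := fun _ _ => rfl
  have h := hf.metricOn ht
  have hFs := hf.smooth_map.slice ht
  have e : ∀ s ∈ I, ∀ v ∈ V, pinching (pullMetric ψ (G s)) (fun v => F s (ψ v)) (α s) C v
      = pinching (G s) (F s) (α s) C (ψ v) := fun s hs v hv =>
    hψ.pinching_eq (hf.metricOn hs) (fun _ _ => rfl) (hf.smooth_map.slice hs) (fun _ _ => rfl) hv _ _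
  have hmax' : IsLocalMax (pinching (pullMetric ψ (G t)) (fun v => F t (ψ v)) (α t) C) 0 := by
    have h1 := IsMaxFilter.comp_tendsto hmax (hψ.differentiableAt h0).continuousAt.tendsto
    filter_upwards [h1, hψ.isOpen.mem_nhds h0] with v hv hvV
    rw [e t ht v hvV, e t ht 0 h0]
    exact hv
  have eS := hψ.sicTrace_eq h hG hFs hF h0 (α t)
  have eE := hψ.gradSq_eq h hG hFs hF h0
  have eW := hψ.norm4_eq hG h0 (hψ.weyl_eq h hG h0)
  have eH := hψ.norm2_eq hG h0 (hψ.hess_eq h hG hFs hF h0)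
  obtain ⟨d, hd, hder⟩ := (hf.pull hψ).pinching_normal hm ht h0 hn hα ha ha' haa
    (by rw [eE]; exact he) hC hK (by rw [eS]; exact hX) (by rw [eS, eW, eH]; exact hWH)
    (by rw [e t ht 0 h0]; exact hb) hbK hmax'
  refine ⟨d, hd, hder.congr_of_eventuallyEq ?_⟩
  filter_upwards [hf.isOpen_time.mem_nhds ht] with s hs using (e s hs 0 h0).symm

end FlowPinching

/-! ### Charts -/

section Transition

variable {m : ℕ} {M : Type*} [TopologicalSpace M] [ChartedSpace (EuclideanSpace ℝ (Fin m)) M]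

/-- The transition map from the chart around `x` to the chart around `y`. -/
noncomputable def transition (x y : M) (v : EuclideanSpace ℝ (Fin m)) : EuclideanSpace ℝ (Fin m) :=
  extChartAt (𝓡 m) y ((extChartAt (𝓡 m) x).symm v)

/-- The domain of the transition map. -/
def overlap (m : ℕ) {M : Type*} [TopologicalSpace M] [ChartedSpace (EuclideanSpace ℝ (Fin m)) M]
    (x y : M) : Set (EuclideanSpace ℝ (Fin m)) :=
  (extChartAt (𝓡 m) x).target ∩ (extChartAt (𝓡 m) x).symm ⁻¹' (extChartAt (𝓡 m) y).source

theorem isOpen_overlap (x y : M) : IsOpen (overlap m x y) :=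
  (continuousOn_extChartAt_symm x).isOpen_inter_preimage (isOpen_extChartAt_target x)
    (isOpen_extChartAt_source y)

theorem symm_transition {x y : M} {v : EuclideanSpace ℝ (Fin m)} (hv : v ∈ overlap m x y) :
    (extChartAt (𝓡 m) y).symm (transition x y v) = (extChartAt (𝓡 m) x).symm v :=
  (extChartAt (𝓡 m) y).left_inv hv.2

theorem transition_mem {x y : M} {v : EuclideanSpace ℝ (Fin m)} (hv : v ∈ overlap m x y) :
    transition x y v ∈ (extChartAt (𝓡 m) y).target :=
  (extChartAt (𝓡 m) y).map_source hv.2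

theorem mem_overlap {y q : M} (hq : q ∈ (extChartAt (𝓡 m) y).source) :
    extChartAt (𝓡 m) q q ∈ overlap m q y := by
  refine ⟨mem_extChartAt_target q, ?_⟩
  rw [mem_preimage, extChartAt_to_inv]
  exact hq

theorem transition_apply_self (q y : M) :
    transition q y (extChartAt (𝓡 m) q q) = extChartAt (𝓡 m) y q := by
  rw [transition, extChartAt_to_inv]

theorem inChart_transition (f : M → ℝ) (x y : M) :
    ∀ v ∈ overlap m x y, inChart m f x v = inChart m f y (transition x y v) := fun v hv => by
  rw [inChart, inChart, symm_transition hv]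

end Transition

/-! ### The metric and the coordinate frame in a chart; change of chart. -/

section Charts

variable {m : ℕ} {M : Type*} [TopologicalSpace M] [ChartedSpace (EuclideanSpace ℝ (Fin m)) M]
  [IsManifold (𝓡 m) ∞ M]

/-- The `i`-th coordinate vector in the chart around `x₀`, at the point with coordinates `u`. -/
noncomputable def coordVec (x₀ : M) (i : Fin m) (u : EuclideanSpace ℝ (Fin m)) :
    TangentSpace (𝓡 m) ((extChartAt (𝓡 m) x₀).symm u) :=
  mfderiv 𝓘(ℝ, EuclideanSpace ℝ (Fin m)) (𝓡 m) (extChartAt (𝓡 m) x₀).symm u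
    (EuclideanSpace.single i 1)

theorem contMDiffOn_coordVec (x₀ : M) (i : Fin m) :
    ContMDiffOn 𝓘(ℝ, EuclideanSpace ℝ (Fin m)) (𝓡 m).tangent ∞
      (fun u => (⟨(extChartAt (𝓡 m) x₀).symm u, coordVec x₀ i u⟩ : TangentBundle (𝓡 m) M))
      (extChartAt (𝓡 m) x₀).target := by
  have hU := isOpen_extChartAt_target (I := 𝓡 m) x₀
  have h1 := (contMDiffOn_extChartAt_symm (I := 𝓡 m) (n := ∞) x₀).contMDiffOn_tangentMapWithin
    (m := ∞) (by simp) hU.uniqueMDiffOn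
  have h2 : ContMDiff 𝓘(ℝ, EuclideanSpace ℝ (Fin m)) 𝓘(ℝ, EuclideanSpace ℝ (Fin m)).tangent ∞
      (fun u => (⟨u, EuclideanSpace.single i 1⟩ :
        TangentBundle 𝓘(ℝ, EuclideanSpace ℝ (Fin m)) (EuclideanSpace ℝ (Fin m)))) :=
    contMDiff_vectorSpace_iff_contDiff.2 contDiff_const
  refine (h1.comp h2.contMDiffOn fun u hu => hu).congr fun u hu => ?_
  simp only [Function.comp_apply, tangentMapWithin, coordVec,
    mfderivWithin_of_isOpen hU hu]

theorem contMDiffOn_prodMap_symm (x₀ : M) (I : Set ℝ) :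
    ContMDiffOn 𝓘(ℝ, EuclideanSpace ℝ (Fin m) × ℝ) ((𝓡 m).prod 𝓘(ℝ, ℝ)) ∞
      (fun p : EuclideanSpace ℝ (Fin m) × ℝ => ((extChartAt (𝓡 m) x₀).symm p.1, p.2))
      ((extChartAt (𝓡 m) x₀).target ×ˢ I) :=
  ((contMDiffOn_extChartAt_symm (I := 𝓡 m) (n := ∞) x₀).comp
    (contDiff_fst.contMDiff.contMDiffOn) fun _ hp => hp.1).prodMk
    contDiff_snd.contMDiff.contMDiffOn

/-- Pulled back to the chart, the metric is a smooth section of a bundle of bilinear forms; it is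
evaluated on the smooth coordinate vector fields. -/
theorem jsmooth_gram {I : Set ℝ} {g : ℝ → Metric m M}
    (hg : ContMDiffOn ((𝓡 m).prod 𝓘(ℝ, ℝ))
    ((𝓡 m).prod 𝓘(ℝ, EuclideanSpace ℝ (Fin m) →L[ℝ] EuclideanSpace ℝ (Fin m) →L[ℝ] ℝ)) ∞
    (fun p : M × ℝ => Bundle.TotalSpace.mk'
      (E := fun x : M => TangentSpace (𝓡 m) x →L[ℝ] TangentSpace (𝓡 m) x →L[ℝ] ℝ)
      (EuclideanSpace ℝ (Fin m) →L[ℝ] EuclideanSpace ℝ (Fin m) →L[ℝ] ℝ) p.1 ((g p.2).inner p.1))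
    (univ ×ˢ I)) (x₀ : M) (i j : Fin m) :
    JSmooth (extChartAt (𝓡 m) x₀).target I (fun t u => gram (g t) x₀ u i j) := by
  have h1 := hg.comp (contMDiffOn_prodMap_symm x₀ I) fun p hp => ⟨mem_univ _, hp.2⟩
  have h2 : ∀ i, ContMDiffOn 𝓘(ℝ, EuclideanSpace ℝ (Fin m) × ℝ) (𝓡 m).tangent ∞
      (fun p : EuclideanSpace ℝ (Fin m) × ℝ =>
        (⟨(extChartAt (𝓡 m) x₀).symm p.1, coordVec x₀ i p.1⟩ : TangentBundle (𝓡 m) M))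
      ((extChartAt (𝓡 m) x₀).target ×ˢ I) := fun i =>
    (contMDiffOn_coordVec x₀ i).comp (contDiff_fst.contMDiff.contMDiffOn) fun _ hp => hp.1
  have h3 : ContMDiffOn 𝓘(ℝ, EuclideanSpace ℝ (Fin m) × ℝ) ((𝓡 m).prod 𝓘(ℝ, ℝ)) ∞
      (fun p : EuclideanSpace ℝ (Fin m) × ℝ => Bundle.TotalSpace.mk' ℝ
        (E := Bundle.Trivial M ℝ) ((extChartAt (𝓡 m) x₀).symm p.1)
        ((g p.2).inner ((extChartAt (𝓡 m) x₀).symm p.1) (coordVec x₀ i p.1) (coordVec x₀ j p.1)))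
      ((extChartAt (𝓡 m) x₀).target ×ˢ I) :=
    ContMDiffOn.clm_bundle_apply₂ (F₁ := EuclideanSpace ℝ (Fin m))
      (F₂ := EuclideanSpace ℝ (Fin m)) (E₁ := (TangentSpace (𝓡 m) : M → Type _))
      (E₂ := (TangentSpace (𝓡 m) : M → Type _)) h1 (h2 i) (h2 j)
  rw [JSmooth, ← contMDiffOn_iff_contDiffOn]
  intro p hp
  have h4 := h3 p hp
  rw [Bundle.contMDiffWithinAt_totalSpace] at h4
  exact h4.2

/-- The scalar product, with all tangent spaces identified with the model space. -/
noncomputable def innerAt (g : Metric m M) (q : M) :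
    EuclideanSpace ℝ (Fin m) →L[ℝ] EuclideanSpace ℝ (Fin m) →L[ℝ] ℝ := g.inner q

/-- The coordinate frame as a linear map on the model space. -/
noncomputable def frameMap (x₀ : M) (u : EuclideanSpace ℝ (Fin m)) :
    EuclideanSpace ℝ (Fin m) →L[ℝ] EuclideanSpace ℝ (Fin m) :=
  mfderiv 𝓘(ℝ, EuclideanSpace ℝ (Fin m)) (𝓡 m) (extChartAt (𝓡 m) x₀).symm u

theorem gram_eq (g : Metric m M) (x₀ : M) (u : EuclideanSpace ℝ (Fin m)) (i j : Fin m) :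
    gram g x₀ u i j = innerAt g ((extChartAt (𝓡 m) x₀).symm u)
      (frameMap x₀ u (EuclideanSpace.single i 1)) (frameMap x₀ u (EuclideanSpace.single j 1)) :=
  rfl

theorem frameMap_injective (x₀ : M) {u : EuclideanSpace ℝ (Fin m)}
    (hu : u ∈ (extChartAt (𝓡 m) x₀).target) : Function.Injective (frameMap x₀ u) := by
  have h := isInvertible_mfderivWithin_extChartAt_symm (I := 𝓡 m) hu
  have e : mfderivWithin 𝓘(ℝ, EuclideanSpace ℝ (Fin m)) (𝓡 m) (extChartAt (𝓡 m) x₀).symm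
      (range (𝓡 m)) u = frameMap x₀ u := by
    rw [(𝓡 m).range_eq_univ, mfderivWithin_univ]
    rfl
  rw [e] at h
  obtain ⟨L, hL⟩ := h
  intro v w hvw
  rw [← hL] at hvw
  exact L.injective hvw

theorem sum_single_eq (x : Fin m → ℝ) (L : EuclideanSpace ℝ (Fin m) →L[ℝ] EuclideanSpace ℝ (Fin m)) :
    ∑ i, x i • L (EuclideanSpace.single i 1) = L (WithLp.toLp 2 x) := by
  have : WithLp.toLp 2 x = ∑ i, x i • EuclideanSpace.single i (1 : ℝ) := by
    ext j
    simp [Pi.single_apply]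
  rw [this, map_sum]
  simp only [map_smul]

theorem posDef_gram (g : Metric m M) (x₀ : M) {u : EuclideanSpace ℝ (Fin m)}
    (hu : u ∈ (extChartAt (𝓡 m) x₀).target) : (gram g x₀ u).PosDef := by
  refine Matrix.PosDef.of_dotProduct_mulVec_pos ?_ fun x hx => ?_
  · ext i j
    simp only [Matrix.conjTranspose_apply, star_trivial]
    exact g.symm _ _ _
  · have e : star x ⬝ᵥ (gram g x₀ u).mulVec x
        = innerAt g ((extChartAt (𝓡 m) x₀).symm u) (frameMap x₀ u (WithLp.toLp 2 x))
          (frameMap x₀ u (WithLp.toLp 2 x)) := by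
      rw [← sum_single_eq]
      simp only [map_sum, _root_.sum_apply, map_smul, _root_.smul_apply,
        dotProduct, Matrix.mulVec, gram_eq, star_trivial, smul_eq_mul, Finset.mul_sum]
      rw [Finset.sum_comm]
      exact Finset.sum_congr rfl fun i _ => Finset.sum_congr rfl fun j _ => by ring
    rw [e]
    refine g.pos _ _ fun h0 => hx ?_
    have := frameMap_injective x₀ hu ((h0 : frameMap x₀ u (WithLp.toLp 2 x) = 0).trans
      (map_zero _).symm)
    exact (WithLp.toLp_injective 2) (this.trans (WithLp.toLp_zero 2).symm)

theorem contDiffOn_transition (x y : M) :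
    ContDiffOn ℝ ∞ (transition (m := m) x y) (overlap m x y) :=
  contDiffOn_ext_coord_change (I := 𝓡 m) y x

theorem frameMap_eq {x y : M} {v : EuclideanSpace ℝ (Fin m)} (hv : v ∈ overlap m x y) :
    frameMap x v = (frameMap y (transition x y v)).comp (fderiv ℝ (transition x y) v) := by
  have hd : DifferentiableAt ℝ (transition (m := m) x y) v :=
    ((contDiffOn_transition x y).contDiffAt ((isOpen_overlap x y).mem_nhds hv)).differentiableAt
      (by simp)
  have hy : MDifferentiableAt 𝓘(ℝ, EuclideanSpace ℝ (Fin m)) (𝓡 m) (extChartAt (𝓡 m) y).symm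
      (transition x y v) :=
    ((contMDiffOn_extChartAt_symm (I := 𝓡 m) (n := ∞) y).contMDiffAt
      ((isOpen_extChartAt_target y).mem_nhds (transition_mem hv))).mdifferentiableAt (by simp)
  have e := mfderiv_comp v hy hd.mdifferentiableAt
  rw [mfderiv_eq_fderiv] at e
  refine Eq.trans (Filter.EventuallyEq.mfderiv_eq ?_) e
  filter_upwards [(isOpen_overlap x y).mem_nhds hv] with w hw using (symm_transition hw).symm

theorem gram_transition (g : Metric m M) {x y : M} {v : EuclideanSpace ℝ (Fin m)}
    (hv : v ∈ overlap m x y) : gram g x v = pullMetric (transition x y) (gram g y) v := by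
  have hd : DifferentiableAt ℝ (transition (m := m) x y) v :=
    ((contDiffOn_transition x y).contDiffAt ((isOpen_overlap x y).mem_nhds hv)).differentiableAt
      (by simp)
  have e : ∀ i, frameMap x v (EuclideanSpace.single i 1)
      = ∑ a, jac (transition x y) v a i •
        frameMap y (transition x y v) (EuclideanSpace.single a 1) := by
    intro i
    rw [frameMap_eq hv, ContinuousLinearMap.comp_apply, sum_single_eq (fun a =>
      jac (transition x y) v a i)]
    congr 1
    ext a
    exact (jac_apply hd a i).symm
  ext i j
  have e2 : pullMetric (transition x y) (gram g y) v i j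
      = ∑ a, ∑ b, jac (transition x y) v a i * jac (transition x y) v b j
        * gram g y (transition x y v) a b := pull2_apply _ _ _ _
  rw [e2, gram_eq, e, e]
  simp only [map_sum, _root_.sum_apply, map_smul, _root_.smul_apply,
    smul_eq_mul, gram_eq, symm_transition hv, Finset.mul_sum]
  rw [Finset.sum_comm]
  exact Finset.sum_congr rfl fun a _ => Finset.sum_congr rfl fun b _ => by ring

/-- The Jacobian is invertible because otherwise the Gram matrix, a congruence by it, would be
degenerate. The metric serves only this purpose. -/
theorem coordChange_transition (g : Metric m M) (x y : M) :
    CoordChange (overlap m x y) (extChartAt (𝓡 m) y).target (transition x y) where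
  isOpen := isOpen_overlap x y
  smooth := contDiffOn_transition x y
  mapsTo _ hv := transition_mem hv
  det_ne v hv h0 := by
    have h := (posDef_gram g x hv.1).det_pos
    rw [gram_transition g hv, pullMetric, Matrix.det_mul, h0, mul_zero] at h
    exact lt_irrefl _ h

end Charts

/-! ### Invariance of the scalar quantities -/

/-! ### The time interval and its interior. -/

section TimeInterval

variable {T : EReal}

theorem ordConnected_timeInterval : (timeInterval T).OrdConnected :=
  ordConnected_iff.2 fun _ ha _ hb _ _ hx =>
    ⟨ha.1.trans hx.1, (EReal.coe_le_coe_iff.2 hx.2).trans_lt hb.2⟩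

theorem zero_mem_timeInterval (hT : 0 < T) : (0 : ℝ) ∈ timeInterval T := ⟨le_rfl, hT⟩

theorem Icc_subset_timeInterval {t : ℝ} (ht : t ∈ timeInterval T) :
    Icc 0 t ⊆ timeInterval T := fun _ hs => ⟨hs.1, (EReal.coe_le_coe_iff.2 hs.2).trans_lt ht.2⟩

/-- The positive times. -/
def openInterval (T : EReal) : Set ℝ := {t : ℝ | 0 < t ∧ (t : EReal) < T}

theorem isOpen_openInterval : IsOpen (openInterval T) :=
  (isOpen_lt continuous_const continuous_id).inter
    (isOpen_lt continuous_coe_real_ereal continuous_const)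

theorem openInterval_subset : openInterval T ⊆ timeInterval T := fun _ ht => ⟨ht.1.le, ht.2⟩

theorem timeInterval_mem_nhds {t : ℝ} (ht : t ∈ openInterval T) : timeInterval T ∈ nhds t :=
  Filter.mem_of_superset (isOpen_openInterval.mem_nhds ht) openInterval_subset

theorem openInterval_nonempty (hT : 0 < T) : (openInterval T).Nonempty := by
  obtain ⟨r, h1, h2⟩ := EReal.lt_iff_exists_real_btwn.1 hT
  exact ⟨r, EReal.coe_pos.1 h1, h2⟩

theorem uniqueDiffOn_timeInterval (hT : 0 < T) : UniqueDiffOn ℝ (timeInterval T) :=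
  uniqueDiffOn_convex ordConnected_timeInterval.convex
    ((openInterval_nonempty hT).mono (interior_maximal openInterval_subset isOpen_openInterval))

theorem interior_timeInterval_subset : interior (timeInterval T) ⊆ openInterval T := by
  intro t ht
  refine ⟨lt_of_le_of_ne (interior_subset ht).1 fun h0 => ?_, (interior_subset ht).2⟩
  have h1 : interior (timeInterval T) ⊆ interior (Ici 0) :=
    interior_mono fun s hs => hs.1
  have h2 := h1 ht
  rw [interior_Ici, ← h0] at h2
  exact lt_irrefl _ (mem_Ioi.1 h2)

theorem antitoneOn_of_derivWithin {α : ℝ → ℝ} (hα : DifferentiableOn ℝ α (timeInterval T))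
    (h : ∀ t ∈ timeInterval T, derivWithin α (timeInterval T) t ≤ 0) :
    AntitoneOn α (timeInterval T) := by
  refine antitoneOn_of_deriv_nonpos ordConnected_timeInterval.convex hα.continuousOn
    (hα.mono interior_subset) fun t ht => ?_
  rw [← derivWithin_of_mem_nhds (timeInterval_mem_nhds (interior_timeInterval_subset ht))]
  exact h t (interior_subset ht)

end TimeInterval

/-! ### Continuity on space-time, read in charts. -/

section Continuity

variable {m : ℕ} {M : Type*} [TopologicalSpace M] [ChartedSpace (EuclideanSpace ℝ (Fin m)) M]

/-- A function on space-time which is continuous in all charts is continuous. -/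
theorem continuousOn_of_charts {I : Set ℝ} {Φ : M × ℝ → ℝ}
    {f : M → ℝ → EuclideanSpace ℝ (Fin m) → ℝ}
    (hf : ∀ y, ContinuousOn (fun p : EuclideanSpace ℝ (Fin m) × ℝ => f y p.2 p.1)
      ((extChartAt (𝓡 m) y).target ×ˢ I))
    (hΦ : ∀ y, ∀ s ∈ I, ∀ q ∈ (extChartAt (𝓡 m) y).source, Φ (q, s) = f y s (extChartAt (𝓡 m) y q)) :
    ContinuousOn Φ (univ ×ˢ I) := by
  rintro ⟨y, s⟩ ⟨-, hs⟩
  have h1 : ContinuousOn (fun p : M × ℝ => f y p.2 (extChartAt (𝓡 m) y p.1))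
      ((extChartAt (𝓡 m) y).source ×ˢ I) :=
    (hf y).comp (f := fun p : M × ℝ => (extChartAt (𝓡 m) y p.1, p.2))
      (((continuousOn_extChartAt y).comp continuousOn_fst fun p hp => hp.1).prodMk
      continuousOn_snd) fun p hp => ⟨(extChartAt (𝓡 m) y).map_source hp.1, hp.2⟩
  have h2 := (h1.congr fun p hp => hΦ y p.2 hp.2 p.1 hp.1) (y, s)
    ⟨mem_extChartAt_source y, hs⟩
  refine h2.mono_of_mem_nhdsWithin ?_
  have h3 : (extChartAt (𝓡 m) y).source ×ˢ univ ∈ nhds (y, s) :=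
    prod_mem_nhds (extChartAt_source_mem_nhds y) Filter.univ_mem
  refine Filter.mem_of_superset (inter_mem_nhdsWithin _ h3) ?_
  rintro p ⟨hp1, hp2⟩
  exact ⟨hp2.1, hp1.2⟩

theorem continuousOn_trace2 {U : Set (EuclideanSpace ℝ (Fin m))} {I : Set ℝ}
    {G : ℝ → EuclideanSpace ℝ (Fin m) → Matrix (Fin m) (Fin m) ℝ} (hG : MetricFamily U I G)
    {A : ℝ → EuclideanSpace ℝ (Fin m) → Fin m → Fin m → ℝ}
    (hA : ∀ i j, ContinuousOn (fun p : EuclideanSpace ℝ (Fin m) × ℝ => A p.2 p.1 i j) (U ×ˢ I)) :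
    ContinuousOn (fun p : EuclideanSpace ℝ (Fin m) × ℝ => trace2 (G p.2) p.1 (A p.2 p.1))
      (U ×ˢ I) :=
  continuousOn_finsetSum _ fun i _ => continuousOn_finsetSum _ fun j _ =>
    (hG.smooth_inv i j).continuousOn.mul (hA i j)

theorem continuousOn_norm2 {U : Set (EuclideanSpace ℝ (Fin m))} {I : Set ℝ}
    {G : ℝ → EuclideanSpace ℝ (Fin m) → Matrix (Fin m) (Fin m) ℝ} (hG : MetricFamily U I G)
    {A : ℝ → EuclideanSpace ℝ (Fin m) → Fin m → Fin m → ℝ}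
    (hA : ∀ i j, ContinuousOn (fun p : EuclideanSpace ℝ (Fin m) × ℝ => A p.2 p.1 i j) (U ×ˢ I)) :
    ContinuousOn (fun p : EuclideanSpace ℝ (Fin m) × ℝ => norm2 (G p.2) p.1 (A p.2 p.1))
      (U ×ˢ I) := by
  have hi := fun i j => (hG.smooth_inv i j).continuousOn
  refine ContinuousOn.sqrt ?_
  exact continuousOn_finsetSum _ fun i _ => continuousOn_finsetSum _ fun j _ =>
    continuousOn_finsetSum _ fun k _ => continuousOn_finsetSum _ fun l _ =>
      (((hi i k).mul (hi j l)).mul (hA i j)).mul (hA k l)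

theorem continuousOn_norm4 {U : Set (EuclideanSpace ℝ (Fin m))} {I : Set ℝ}
    {G : ℝ → EuclideanSpace ℝ (Fin m) → Matrix (Fin m) (Fin m) ℝ} (hG : MetricFamily U I G)
    {A : ℝ → EuclideanSpace ℝ (Fin m) → Fin m → Fin m → Fin m → Fin m → ℝ}
    (hA : ∀ i j k l,
      ContinuousOn (fun p : EuclideanSpace ℝ (Fin m) × ℝ => A p.2 p.1 i j k l) (U ×ˢ I)) :
    ContinuousOn (fun p : EuclideanSpace ℝ (Fin m) × ℝ => norm4 (G p.2) p.1 (A p.2 p.1))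
      (U ×ˢ I) := by
  have hi := fun i j => (hG.smooth_inv i j).continuousOn
  refine ContinuousOn.sqrt ?_
  exact continuousOn_finsetSum _ fun i _ => continuousOn_finsetSum _ fun j _ =>
    continuousOn_finsetSum _ fun k _ => continuousOn_finsetSum _ fun l _ =>
    continuousOn_finsetSum _ fun p _ => continuousOn_finsetSum _ fun q _ =>
    continuousOn_finsetSum _ fun r _ => continuousOn_finsetSum _ fun s _ =>
      (((((hi i p).mul (hi j q)).mul (hi k r)).mul (hi l s)).mul (hA i j k l)).mul (hA p q r s)

theorem continuousOn_time {α : ℝ → ℝ} {U : Set (EuclideanSpace ℝ (Fin m))} {I : Set ℝ}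
    (hα : ContinuousOn α I) :
    ContinuousOn (fun p : EuclideanSpace ℝ (Fin m) × ℝ => α p.2) (U ×ˢ I) :=
  hα.comp continuousOn_snd fun _ hp => hp.2

/-- A maximum on `M` is a local maximum in a chart. -/
theorem isLocalMax_chart {y : M} {Φ : M → ℝ} {f : EuclideanSpace ℝ (Fin m) → ℝ}
    (hΦ : ∀ q ∈ (extChartAt (𝓡 m) y).source, Φ q = f (extChartAt (𝓡 m) y q))
    (hmax : ∀ q, Φ q ≤ Φ y) : IsLocalMax f (extChartAt (𝓡 m) y y) := by
  filter_upwards [extChartAt_target_mem_nhds (I := 𝓡 m) y] with u hu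
  have := hmax ((extChartAt (𝓡 m) y).symm u)
  rwa [hΦ _ ((extChartAt (𝓡 m) y).map_target hu), (extChartAt (𝓡 m) y).right_inv hu,
    hΦ y (mem_extChartAt_source y)] at this

end Continuity

/-! ### The scalars on the manifold, read in a fixed chart. -/

section Invariance

variable {m : ℕ} {M : Type*} [TopologicalSpace M] [ChartedSpace (EuclideanSpace ℝ (Fin m)) M]
  [IsManifold (𝓡 m) ∞ M]

/-- The function `|∇φ|²` on `M`. -/
noncomputable def normGradSq (g : Metric m M) (f : M → ℝ) (x : M) : ℝ :=
  gradSq (gram g x) (inChart m f x) (extChartAt (𝓡 m) x x)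

variable {T : EReal} {α : ℝ → ℝ} {g : ℝ → Metric m M} {φ : ℝ → M → ℝ} {y q : M} {s : ℝ}

theorem IsRicciHarmonicFlow.metricFamily (h : IsRicciHarmonicFlow T α g φ) (y : M) :
    MetricFamily (extChartAt (𝓡 m) y).target (timeInterval T) (fun t => gram (g t) y) where
  isOpen := isOpen_extChartAt_target y
  uniq := uniqueDiffOn_timeInterval h.pos
  smooth := jsmooth_gram h.smooth_metric y
  posDef t _ _ hu := posDef_gram (g t) y hu

theorem IsRicciHarmonicFlow.jsmooth_map (h : IsRicciHarmonicFlow T α g φ) (y : M) :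
    JSmooth (extChartAt (𝓡 m) y).target (timeInterval T) (fun t => inChart m (φ t) y) := by
  rw [JSmooth, ← contMDiffOn_iff_contDiffOn]
  exact h.smooth_map.comp (contMDiffOn_prodMap_symm y _) fun p hp => ⟨mem_univ _, hp.2⟩

/-- The definition reads S at `q` in the chart around `q` itself, a chart that varies with the
point. Regularity in `q` becomes visible only after passing to a fixed chart, by invariance under
the transition map. -/
theorem IsRicciHarmonicFlow.S_eq (h : IsRicciHarmonicFlow T α g φ) (hs : s ∈ timeInterval T)
    (hq : q ∈ (extChartAt (𝓡 m) y).source) (a : ℝ) :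
    S (g s) (φ s) a q = sicTrace (gram (g s) y) (inChart m (φ s) y) a (extChartAt (𝓡 m) y q) := by
  rw [← transition_apply_self]
  exact (coordChange_transition (g s) q y).sicTrace_eq ((h.metricFamily y).slice hs)
    (fun _ hv => gram_transition (g s) hv) ((h.jsmooth_map y).slice hs)
    (inChart_transition (φ s) q y) (mem_overlap hq) a

theorem IsRicciHarmonicFlow.normGradSq_eq (h : IsRicciHarmonicFlow T α g φ)
    (hs : s ∈ timeInterval T) (hq : q ∈ (extChartAt (𝓡 m) y).source) :
    normGradSq (g s) (φ s) q
      = gradSq (gram (g s) y) (inChart m (φ s) y) (extChartAt (𝓡 m) y q) := by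
  rw [← transition_apply_self]
  exact (coordChange_transition (g s) q y).gradSq_eq ((h.metricFamily y).slice hs)
    (fun _ hv => gram_transition (g s) hv) ((h.jsmooth_map y).slice hs)
    (inChart_transition (φ s) q y) (mem_overlap hq)

theorem IsRicciHarmonicFlow.normSin_eq (h : IsRicciHarmonicFlow T α g φ) (hs : s ∈ timeInterval T)
    (hq : q ∈ (extChartAt (𝓡 m) y).source) (a : ℝ) :
    normSin (g s) (φ s) a q = norm2 (gram (g s) y) (extChartAt (𝓡 m) y q)
      (sin (gram (g s) y) (inChart m (φ s) y) a (extChartAt (𝓡 m) y q)) := by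
  rw [← transition_apply_self]
  have hψ := coordChange_transition (g s) q y
  have hG : ∀ v ∈ overlap m q y, gram (g s) q v = pullMetric (transition q y) (gram (g s) y) v :=
    fun _ hv => gram_transition (g s) hv
  exact hψ.norm2_eq hG (mem_overlap hq) (hψ.sin_eq ((h.metricFamily y).slice hs) hG
    ((h.jsmooth_map y).slice hs) (inChart_transition (φ s) q y) (mem_overlap hq) a)

theorem IsRicciHarmonicFlow.normHess_eq (h : IsRicciHarmonicFlow T α g φ)
    (hs : s ∈ timeInterval T) (hq : q ∈ (extChartAt (𝓡 m) y).source) :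
    normHess (g s) (φ s) q = norm2 (gram (g s) y) (extChartAt (𝓡 m) y q)
      (hess (gram (g s) y) (inChart m (φ s) y) (extChartAt (𝓡 m) y q)) := by
  rw [← transition_apply_self]
  have hψ := coordChange_transition (g s) q y
  have hG : ∀ v ∈ overlap m q y, gram (g s) q v = pullMetric (transition q y) (gram (g s) y) v :=
    fun _ hv => gram_transition (g s) hv
  exact hψ.norm2_eq hG (mem_overlap hq) (hψ.hess_eq ((h.metricFamily y).slice hs) hG
    ((h.jsmooth_map y).slice hs) (inChart_transition (φ s) q y) (mem_overlap hq))

theorem IsRicciHarmonicFlow.normWeyl_eq (h : IsRicciHarmonicFlow T α g φ)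
    (hs : s ∈ timeInterval T) (hq : q ∈ (extChartAt (𝓡 m) y).source) :
    normWeyl (g s) q = norm4 (gram (g s) y) (extChartAt (𝓡 m) y q)
      (weyl (gram (g s) y) (extChartAt (𝓡 m) y q)) := by
  rw [← transition_apply_self]
  have hψ := coordChange_transition (g s) q y
  have hG : ∀ v ∈ overlap m q y, gram (g s) q v = pullMetric (transition q y) (gram (g s) y) v :=
    fun _ hv => gram_transition (g s) hv
  exact hψ.norm4_eq hG (mem_overlap hq) (hψ.weyl_eq ((h.metricFamily y).slice hs) hG
    (mem_overlap hq))

theorem IsRicciHarmonicFlow.continuousOn_sic (h : IsRicciHarmonicFlow T α g φ)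
    (hα : ContinuousOn α (timeInterval T)) (y : M) (i j : Fin m) :
    ContinuousOn (fun p : EuclideanSpace ℝ (Fin m) × ℝ =>
      sic (gram (g p.2) y) (inChart m (φ p.2) y) (α p.2) p.1 i j)
      ((extChartAt (𝓡 m) y).target ×ˢ timeInterval T) := by
  have hG := h.metricFamily y
  have hF := fun i => ((h.jsmooth_map y).pd hG.isOpen hG.uniq i).continuousOn
  exact (hG.smooth_ricci i j).continuousOn.sub ((continuousOn_time hα).mul ((hF i).mul (hF j)))

theorem IsRicciHarmonicFlow.continuousOn_sicTrace (h : IsRicciHarmonicFlow T α g φ)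
    (hα : ContinuousOn α (timeInterval T)) (y : M) :
    ContinuousOn (fun p : EuclideanSpace ℝ (Fin m) × ℝ =>
      sicTrace (gram (g p.2) y) (inChart m (φ p.2) y) (α p.2) p.1)
      ((extChartAt (𝓡 m) y).target ×ˢ timeInterval T) :=
  continuousOn_trace2 (h.metricFamily y)
    (A := fun s u => sic (gram (g s) y) (inChart m (φ s) y) (α s) u) (h.continuousOn_sic hα y)

theorem IsRicciHarmonicFlow.continuousOn_S (h : IsRicciHarmonicFlow T α g φ)
    (hα : ContinuousOn α (timeInterval T)) :
    ContinuousOn (fun p : M × ℝ => S (g p.2) (φ p.2) (α p.2) p.1) (univ ×ˢ timeInterval T) :=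
  continuousOn_of_charts (f := fun y s u => sicTrace (gram (g s) y) (inChart m (φ s) y) (α s) u)
    (h.continuousOn_sicTrace hα) fun _ _ hs _ hq => h.S_eq hs hq _

theorem IsRicciHarmonicFlow.continuousOn_normGradSq (h : IsRicciHarmonicFlow T α g φ) :
    ContinuousOn (fun p : M × ℝ => normGradSq (g p.2) (φ p.2) p.1) (univ ×ˢ timeInterval T) :=
  continuousOn_of_charts (f := fun y s u => gradSq (gram (g s) y) (inChart m (φ s) y) u)
    (fun y => ((h.metricFamily y).smooth_gradSq (h.jsmooth_map y)).continuousOn)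
    fun _ _ hs _ hq => h.normGradSq_eq hs hq

theorem IsRicciHarmonicFlow.continuousOn_normSin (h : IsRicciHarmonicFlow T α g φ)
    (hα : ContinuousOn α (timeInterval T)) :
    ContinuousOn (fun p : M × ℝ => normSin (g p.2) (φ p.2) (α p.2) p.1)
      (univ ×ˢ timeInterval T) :=
  continuousOn_of_charts (f := fun y s u => norm2 (gram (g s) y) u
      (sin (gram (g s) y) (inChart m (φ s) y) (α s) u))
    (fun y => continuousOn_norm2 (h.metricFamily y)
      (A := fun s u => sin (gram (g s) y) (inChart m (φ s) y) (α s) u) fun i j =>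
      (h.continuousOn_sic hα y i j).sub (((h.continuousOn_sicTrace hα y).div_const _).mul
        ((h.metricFamily y).smooth i j).continuousOn))
    fun _ _ hs _ hq => h.normSin_eq hs hq _

theorem IsRicciHarmonicFlow.continuousOn_normHess (h : IsRicciHarmonicFlow T α g φ) :
    ContinuousOn (fun p : M × ℝ => normHess (g p.2) (φ p.2) p.1) (univ ×ˢ timeInterval T) :=
  continuousOn_of_charts (f := fun y s u => norm2 (gram (g s) y) u
      (hess (gram (g s) y) (inChart m (φ s) y) u))
    (fun y => continuousOn_norm2 (h.metricFamily y)
      (A := fun s u => hess (gram (g s) y) (inChart m (φ s) y) u) fun i j =>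
      ((h.metricFamily y).smooth_hess (h.jsmooth_map y) i j).continuousOn)
    fun _ _ hs _ hq => h.normHess_eq hs hq

theorem IsRicciHarmonicFlow.continuousOn_normWeyl (h : IsRicciHarmonicFlow T α g φ) :
    ContinuousOn (fun p : M × ℝ => normWeyl (g p.2) p.1) (univ ×ˢ timeInterval T) :=
  continuousOn_of_charts (f := fun y s u => norm4 (gram (g s) y) u (weyl (gram (g s) y) u))
    (fun y => continuousOn_norm4 (h.metricFamily y)
      (A := fun s u => weyl (gram (g s) y) u) fun i j k l =>
      ((h.metricFamily y).smooth_weyl i j k l).continuousOn)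
    fun _ _ hs _ hq => h.normWeyl_eq hs hq

/-- Restricted to positive times, where the one-sided time derivatives are two-sided. The maximum
principle needs no more. -/
theorem IsRicciHarmonicFlow.localFlow (h : IsRicciHarmonicFlow T α g φ) (y : M) :
    LocalFlow (extChartAt (𝓡 m) y).target (openInterval T) α (fun t => gram (g t) y)
      (fun t => inChart m (φ t) y) where
  family :=
    { isOpen := isOpen_extChartAt_target y
      uniq := isOpen_openInterval.uniqueDiffOn
      smooth := fun i j => ((h.metricFamily y).smooth i j).mono
        (prod_mono_right openInterval_subset)
      posDef := fun t _ _ hu => posDef_gram (g t) y hu }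
  isOpen_time := isOpen_openInterval
  smooth_map := (h.jsmooth_map y).mono (prod_mono_right openInterval_subset)
  metric_eq t ht u hu i j :=
    ((h.metric_eq y u hu t (openInterval_subset ht) i j).hasDerivAt
      (timeInterval_mem_nhds ht)).congr_deriv (by rw [sic]; ring)
  map_eq t ht u hu := (h.map_eq y u hu t (openInterval_subset ht)).hasDerivAt
    (timeInterval_mem_nhds ht)

theorem IsRicciHarmonicFlow.hasDerivAt_S (h : IsRicciHarmonicFlow T α g φ)
    (hs : s ∈ openInterval T) {α' : ℝ} (hα : HasDerivAt α α' s) (ha : 0 ≤ α s) (ha' : α' ≤ 0)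
    (hmin : ∀ q, S (g s) (φ s) (α s) y ≤ S (g s) (φ s) (α s) q) :
    ∃ d, 0 ≤ d ∧ HasDerivAt (fun r => S (g r) (φ r) (α r) y) d s := by
  have hmin' : IsLocalMin (sicTrace (gram (g s) y) (inChart m (φ s) y) (α s))
      (extChartAt (𝓡 m) y y) := by
    have := (isLocalMax_chart (Φ := fun q => -S (g s) (φ s) (α s) q)
      (f := fun u => -sicTrace (gram (g s) y) (inChart m (φ s) y) (α s) u)
      (fun q hq => by rw [h.S_eq (openInterval_subset hs) hq])
      fun q => neg_le_neg (hmin q)).neg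
    simpa only [neg_neg] using this
  obtain ⟨d, hd, hder⟩ := (h.localFlow y).sicTrace_of_isLocalMin hs (mem_extChartAt_target y) hα
    ha ha' hmin'
  exact ⟨d, hd, hder⟩

theorem IsRicciHarmonicFlow.hasDerivAt_normGradSq (h : IsRicciHarmonicFlow T α g φ)
    (hs : s ∈ openInterval T) (ha : 0 ≤ α s)
    (hmax : ∀ q, normGradSq (g s) (φ s) q ≤ normGradSq (g s) (φ s) y) :
    ∃ d, d ≤ 0 ∧ HasDerivAt (fun r => normGradSq (g r) (φ r) y) d s :=
  (h.localFlow y).gradSq_of_isLocalMax hs (mem_extChartAt_target y) ha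
    (isLocalMax_chart (fun _ hq => h.normGradSq_eq (openInterval_subset hs) hq) hmax)

theorem IsRicciHarmonicFlow.pinching_eq (hm : m ≠ 0) (h : IsRicciHarmonicFlow T α g φ)
    (hs : s ∈ timeInterval T) (hq : q ∈ (extChartAt (𝓡 m) y).source) (a C : ℝ) :
    (normSin (g s) (φ s) a q / (S (g s) (φ s) a q + C)) ^ 2
      = pinching (gram (g s) y) (inChart m (φ s) y) a C (extChartAt (𝓡 m) y q) := by
  rw [div_pow, h.normSin_eq hs hq, h.S_eq hs hq, ((h.metricFamily y).slice hs).norm2_sin_sq hm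
    ((h.jsmooth_map y).slice hs) ((extChartAt (𝓡 m) y).map_source hq), pinching]

theorem IsRicciHarmonicFlow.hasDerivAt_pinching (hm : 3 ≤ m) (h : IsRicciHarmonicFlow T α g φ)
    (hs : s ∈ openInterval T) {α' : ℝ} (hα : HasDerivAt α α' s) (ha : 0 ≤ α s) (ha' : α' ≤ 0)
    {a₀ e₀ C K : ℝ} (haa : α s ≤ a₀) (he : normGradSq (g s) (φ s) y ≤ e₀)
    (hC : 0 ≤ C) (hK : 0 ≤ K) (hX : 1 ≤ S (g s) (φ s) (α s) y + C)
    (hWH : normWeyl (g s) y + normHess (g s) (φ s) y ^ 2 ≤ K ^ 2 * (S (g s) (φ s) (α s) y + C))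
    (hbK : 7 * (2 + C) ^ 3 + 6 * (a₀ * e₀) * (2 + C) ^ 2 + 1
      + ((2 + C) ^ 2 + a₀ * (m + 1) * (2 + C)) * K
        ≤ normSin (g s) (φ s) (α s) y / (S (g s) (φ s) (α s) y + C))
    (hmax : ∀ q, (normSin (g s) (φ s) (α s) q / (S (g s) (φ s) (α s) q + C)) ^ 2
      ≤ (normSin (g s) (φ s) (α s) y / (S (g s) (φ s) (α s) y + C)) ^ 2) :
    ∃ d, d ≤ 0 ∧ HasDerivAt
      (fun r => (normSin (g r) (φ r) (α r) y / (S (g r) (φ r) (α r) y + C)) ^ 2) d s := by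
  have hm0 : m ≠ 0 := by omega
  have e : ∀ r ∈ openInterval T, ∀ q ∈ (extChartAt (𝓡 m) y).source,
      (normSin (g r) (φ r) (α r) q / (S (g r) (φ r) (α r) q + C)) ^ 2
      = pinching (gram (g r) y) (inChart m (φ r) y) (α r) C (extChartAt (𝓡 m) y q) :=
    fun r hr q hq => h.pinching_eq hm0 (openInterval_subset hr) hq _ _
  obtain ⟨d, hd, hder⟩ := (h.localFlow y).pinching_of_isLocalMax hm hs (mem_extChartAt_target y)
    hα ha ha' haa he hC hK hX hWH (e s hs y (mem_extChartAt_source y)).symm hbK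
    (isLocalMax_chart (e s hs) hmax)
  refine ⟨d, hd, hder.congr_of_eventuallyEq ?_⟩
  filter_upwards [isOpen_openInterval.mem_nhds hs] with r hr
    using e r hr y (mem_extChartAt_source y)

end Invariance

/-! ### The maximum principle and the pinching estimate -/

/-- A function on a compact space which does not increase in time at its spatial maxima above the
level `b` stays below `b`. -/
theorem le_of_hasDerivAt_nonpos {M : Type*} [TopologicalSpace M] [CompactSpace M]
    {f : ℝ → M → ℝ} {τ b : ℝ}
    (hf : ContinuousOn (fun p : M × ℝ => f p.2 p.1) (univ ×ˢ Icc 0 τ)) (h0 : ∀ x, f 0 x ≤ b)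
    (hd : ∀ s ∈ Ioc 0 τ, ∀ x, (∀ q, f s q ≤ f s x) → b < f s x →
      ∃ d, d ≤ 0 ∧ HasDerivAt (fun r => f r x) d s) {t : ℝ} (ht : t ∈ Icc 0 τ) (x : M) :
    f t x ≤ b := by
  by_contra! hlt
  have ht0 : 0 < t := lt_of_le_of_ne ht.1 fun h => absurd (h0 x) (by rw [h]; exact not_le.2 hlt)
  obtain ⟨ε, hε, hεt⟩ : ∃ ε, 0 < ε ∧ b < f t x - ε * t := by
    -- Half the excess over `b`, divided by `t`: subtracting ε·time keeps the value at (x, t) above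
    -- `b` and makes the nonstrict hypothesis strict.
    refine ⟨(f t x - b) / (2 * t), div_pos (by linarith) (by linarith), ?_⟩
    have : (f t x - b) / (2 * t) * t = (f t x - b) / 2 := by field_simp
    rw [this]; linarith
  have hc : ContinuousOn (fun p : M × ℝ => f p.2 p.1 - ε * p.2) (univ ×ˢ Icc 0 τ) :=
    hf.sub (continuousOn_const.mul continuousOn_snd)
  obtain ⟨⟨y, s⟩, ⟨-, hs⟩, hmax⟩ := (isCompact_univ.prod isCompact_Icc).exists_isMaxOn
    ⟨(x, t), mem_univ _, ht⟩ hc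
  have hmax' : ∀ q, ∀ r ∈ Icc 0 τ, f r q - ε * r ≤ f s y - ε * s := fun q r hr =>
    hmax (a := (q, r)) ⟨mem_univ _, hr⟩
  have hb : b < f s y - ε * s := hεt.trans_le (hmax' x t ht)
  have hs0 : 0 < s := lt_of_le_of_ne hs.1 fun h => by
    have := h0 y
    rw [← h] at hb
    linarith
  obtain ⟨d, hd0, hder⟩ := hd s ⟨hs0, hs.2⟩ y (fun q => by linarith [hmax' q s hs])
    (hb.trans_le (by linarith [mul_pos hε hs0]))
  -- The pair (y, s) is maximal over all earlier times, so backward slopes are nonnegative and d ≥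
  -- ε, against d ≤ 0. Only times before `s` are compared, so s = τ is harmless.
  have h1 : HasDerivWithinAt (fun r => f r y - ε * r) (d - ε * 1) (Iio s) s :=
    (hder.fun_sub ((hasDerivAt_id s).const_mul ε)).hasDerivWithinAt
  have h2 := (hasDerivWithinAt_iff_tendsto_slope' (by simp)).1 h1
  have h3 : 0 ≤ d - ε * 1 := by
    refine ge_of_tendsto h2 ?_
    filter_upwards [self_mem_nhdsWithin,
      mem_nhdsWithin_of_mem_nhds (Ioi_mem_nhds hs0)] with r hr hr0
    rw [slope_def_field]
    exact div_nonneg_of_nonpos (by linarith [hmax' y r ⟨le_of_lt hr0, (le_of_lt hr).trans hs.2⟩])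
      (sub_nonpos.2 (le_of_lt hr))
  linarith

/-! ### Global bounds from the maximum principle. -/

section Estimate

variable {m : ℕ} {M : Type*} [TopologicalSpace M] [ChartedSpace (EuclideanSpace ℝ (Fin m)) M]
  [IsManifold (𝓡 m) ∞ M] {T : EReal} {α : ℝ → ℝ} {g : ℝ → Metric m M} {φ : ℝ → M → ℝ} {t : ℝ}

theorem Ioc_subset_openInterval (ht : t ∈ timeInterval T) : Ioc 0 t ⊆ openInterval T :=
  fun _ hs => ⟨hs.1, (Icc_subset_timeInterval ht ⟨hs.1.le, hs.2⟩).2⟩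

theorem exists_le_of_continuousOn [CompactSpace M] {Φ : M × ℝ → ℝ} {I : Set ℝ}
    (hΦ : ContinuousOn Φ (univ ×ˢ I)) {s : ℝ} (hs : s ∈ I) :
    ∃ b, 0 ≤ b ∧ ∀ x, Φ (x, s) ≤ b := by
  have hc : Continuous fun x => Φ (x, s) := by
    rw [← continuousOn_univ]
    exact hΦ.comp (continuous_id.prodMk continuous_const).continuousOn
      fun x _ => ⟨mem_univ x, hs⟩
  obtain ⟨b, hb⟩ := (isCompact_range hc).bddAbove
  exact ⟨max b 0, le_max_right _ _, fun x => (hb ⟨x, rfl⟩).trans (le_max_left _ _)⟩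

theorem IsRicciHarmonicFlow.le_S [CompactSpace M] (h : IsRicciHarmonicFlow T α g φ)
    (hα : DifferentiableOn ℝ α (timeInterval T)) (hα0 : ∀ t ∈ timeInterval T, 0 ≤ α t)
    (hα' : ∀ t ∈ timeInterval T, derivWithin α (timeInterval T) t ≤ 0) {b : ℝ}
    (h0 : ∀ x, b ≤ S (g 0) (φ 0) (α 0) x) (ht : t ∈ timeInterval T) (x : M) :
    b ≤ S (g t) (φ t) (α t) x := by
  have key := le_of_hasDerivAt_nonpos (f := fun s x => -S (g s) (φ s) (α s) x) (τ := t) (b := -b)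
    ((h.continuousOn_S hα.continuousOn).mono (prod_mono_right (Icc_subset_timeInterval ht))).neg
    (fun x => neg_le_neg (h0 x)) (fun s hs x hmax _ => ?_) (right_mem_Icc.2 ht.1) x
  · exact neg_le_neg_iff.1 key
  · have hs' := Ioc_subset_openInterval ht hs
    have hsT := openInterval_subset hs'
    obtain ⟨d, hd, hder⟩ := h.hasDerivAt_S hs' (((hα s hsT).hasDerivWithinAt).hasDerivAt
      (timeInterval_mem_nhds hs')) (hα0 s hsT) (hα' s hsT) fun q => neg_le_neg_iff.1 (hmax q)
    exact ⟨-d, by linarith, hder.neg⟩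

theorem IsRicciHarmonicFlow.normGradSq_le [CompactSpace M] (h : IsRicciHarmonicFlow T α g φ)
    (hα0 : ∀ t ∈ timeInterval T, 0 ≤ α t) {b : ℝ} (h0 : ∀ x, normGradSq (g 0) (φ 0) x ≤ b)
    (ht : t ∈ timeInterval T) (x : M) : normGradSq (g t) (φ t) x ≤ b :=
  le_of_hasDerivAt_nonpos (f := fun s x => normGradSq (g s) (φ s) x) (τ := t)
    (h.continuousOn_normGradSq.mono (prod_mono_right (Icc_subset_timeInterval ht))) h0
    (fun s hs _ hmax _ => h.hasDerivAt_normGradSq (Ioc_subset_openInterval ht hs)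
      (hα0 s (openInterval_subset (Ioc_subset_openInterval ht hs))) hmax)
    (right_mem_Icc.2 ht.1) x

/-- The maximum principle on [0, t] for the squared quotient, at a level constant in time because
`K` bounds the whole slab. The summand `z₀` covers the initial time; the rest is the threshold above
which the reaction terms have a sign. -/
theorem IsRicciHarmonicFlow.normSin_div_le [CompactSpace M] (hm : 3 ≤ m)
    (h : IsRicciHarmonicFlow T α g φ)
    (hα : DifferentiableOn ℝ α (timeInterval T)) (hα0 : ∀ t ∈ timeInterval T, 0 ≤ α t)
    (hα' : ∀ t ∈ timeInterval T, derivWithin α (timeInterval T) t ≤ 0)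
    {C e₀ z₀ K : ℝ} (hC : 0 ≤ C) (hz₀ : 0 ≤ z₀) (hK : 0 ≤ K)
    (hS0 : ∀ x, 1 ≤ S (g 0) (φ 0) (α 0) x + C) (hE0 : ∀ x, normGradSq (g 0) (φ 0) x ≤ e₀)
    (he₀ : 0 ≤ e₀)
    (hZ0 : ∀ x, normSin (g 0) (φ 0) (α 0) x / (S (g 0) (φ 0) (α 0) x + C) ≤ z₀)
    (ht : t ∈ timeInterval T)
    (hWH : ∀ s ∈ Icc 0 t, ∀ x, normWeyl (g s) x + normHess (g s) (φ s) x ^ 2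
      ≤ K ^ 2 * (S (g s) (φ s) (α s) x + C)) (x : M) :
    normSin (g t) (φ t) (α t) x / (S (g t) (φ t) (α t) x + C)
      ≤ (7 * (2 + C) ^ 3 + 6 * (α 0 * e₀) * (2 + C) ^ 2 + 1 + z₀)
        + ((2 + C) ^ 2 + α 0 * (m + 1) * (2 + C)) * K := by
  have h0T := zero_mem_timeInterval h.pos
  have hsub := Icc_subset_timeInterval ht
  have hX : ∀ s ∈ timeInterval T, ∀ x, 1 ≤ S (g s) (φ s) (α s) x + C := fun s hs x => by
    have := h.le_S hα hα0 hα' (b := 1 - C) (fun x => by linarith [hS0 x]) hs x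
    linarith
  have hE : ∀ s ∈ timeInterval T, ∀ x, normGradSq (g s) (φ s) x ≤ e₀ := fun s hs x =>
    h.normGradSq_le hα0 hE0 hs x
  have hαle : ∀ s ∈ timeInterval T, α s ≤ α 0 := fun s hs =>
    antitoneOn_of_derivWithin hα hα' h0T hs hs.1
  have ha0 : 0 ≤ α 0 := hα0 0 h0T
  set B := (7 * (2 + C) ^ 3 + 6 * (α 0 * e₀) * (2 + C) ^ 2 + 1 + z₀)
        + ((2 + C) ^ 2 + α 0 * (m + 1) * (2 + C)) * K with hB
  have hB1 : 0 ≤ 7 * (2 + C) ^ 3 + 6 * (α 0 * e₀) * (2 + C) ^ 2 + 1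
      + ((2 + C) ^ 2 + α 0 * (m + 1) * (2 + C)) * K := by positivity
  have hB0 : 0 ≤ B := by linarith
  have hzB : z₀ ≤ B := by linarith
  have hq0 : ∀ s ∈ timeInterval T, ∀ x,
      0 ≤ normSin (g s) (φ s) (α s) x / (S (g s) (φ s) (α s) x + C) := fun s hs x =>
    div_nonneg (Real.sqrt_nonneg _) (by linarith [hX s hs x])
  refine (le_abs_self _).trans (abs_le_of_sq_le_sq ?_ hB0)
  refine le_of_hasDerivAt_nonpos (τ := t)
    (f := fun s x => (normSin (g s) (φ s) (α s) x / (S (g s) (φ s) (α s) x + C)) ^ 2)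
    ?_ (fun x => ?_) (fun s hs x hmax hlt => ?_) (right_mem_Icc.2 ht.1) x
  · exact (((h.continuousOn_normSin hα.continuousOn).div
      ((h.continuousOn_S hα.continuousOn).add continuousOn_const)
      fun p hp => (zero_lt_one.trans_le (hX p.2 hp.2 p.1)).ne').mono (prod_mono_right hsub)).pow 2
  · exact pow_le_pow_left₀ (hq0 0 h0T x) ((hZ0 x).trans hzB) 2
  · have hs' := Ioc_subset_openInterval ht hs
    have hsT := openInterval_subset hs'
    have hlt' := lt_of_pow_lt_pow_left₀ 2 (hq0 s hsT x) hlt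
    exact h.hasDerivAt_pinching hm hs' (((hα s hsT).hasDerivWithinAt).hasDerivAt
      (timeInterval_mem_nhds hs')) (hα0 s hsT) (hα' s hsT) (hαle s hsT) (hE s hsT x) hC hK
      (hX s hsT x) (hWH s ⟨hs.1.le, hs.2⟩ x) (by linarith) hmax

end Estimate

end RicciHarmonic

/-! ### Constants from the initial data. -/

theorem theorem2p2 {m : ℕ} (hm : 3 ≤ m)
    {M : Type*} [TopologicalSpace M] [ChartedSpace (EuclideanSpace ℝ (Fin m)) M]
    [IsManifold (𝓡 m) ∞ M] [CompactSpace M] [T2Space M] [Nonempty M]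
    (g₀ : RicciHarmonic.Metric m M) (φ₀ : M → ℝ) (α₀ : ℝ) :
    ∃ C C₁ C₂ : ℝ,
      ∀ (T : EReal) (α : ℝ → ℝ) (g : ℝ → RicciHarmonic.Metric m M) (φ : ℝ → M → ℝ),
        IsRicciHarmonicFlow T α g φ →
        DifferentiableOn ℝ α (timeInterval T) →
        (∀ t ∈ timeInterval T, 0 ≤ α t) →
        (∀ t ∈ timeInterval T, derivWithin α (timeInterval T) t ≤ 0) →
        g 0 = g₀ → φ 0 = φ₀ → α 0 = α₀ →
        ∀ t ∈ timeInterval T,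
          (∀ x : M, 0 < S (g t) (φ t) (α t) x + C) ∧
          ∃ K : ℝ,
            IsGreatest ((fun p : M × ℝ =>
                Real.sqrt ((normWeyl (g p.2) p.1 + normHess (g p.2) (φ p.2) p.1 ^ 2) /
                  (S (g p.2) (φ p.2) (α p.2) p.1 + C))) '' (univ ×ˢ Icc 0 t)) K ∧
            ∀ x : M,
              normSin (g t) (φ t) (α t) x / (S (g t) (φ t) (α t) x + C) ≤ C₁ + C₂ * K := by
  -- The constants must be chosen before any flow is given, yet regularity of the initial function
  -- is known only from a flow that starts there. One such flow supplies the bounds for all, since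
  -- they concern time 0 only; if there is none, any values do.
  obtain ⟨s₀, e₀, z₀, hs₀, he₀, hz₀, hbound⟩ : ∃ s₀ e₀ z₀ : ℝ, 0 ≤ s₀ ∧ 0 ≤ e₀ ∧ 0 ≤ z₀ ∧
      ∀ (T : EReal) (α : ℝ → ℝ) (g : ℝ → RicciHarmonic.Metric m M) (φ : ℝ → M → ℝ),
        IsRicciHarmonicFlow T α g φ → DifferentiableOn ℝ α (timeInterval T) →
        g 0 = g₀ → φ 0 = φ₀ → α 0 = α₀ →
        ∀ x : M, -s₀ ≤ S g₀ φ₀ α₀ x ∧ normGradSq g₀ φ₀ x ≤ e₀ ∧ normSin g₀ φ₀ α₀ x ≤ z₀ := by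
    by_cases hex : ∃ (T : EReal) (α : ℝ → ℝ) (g : ℝ → RicciHarmonic.Metric m M) (φ : ℝ → M → ℝ),
        IsRicciHarmonicFlow T α g φ ∧ DifferentiableOn ℝ α (timeInterval T) ∧
        g 0 = g₀ ∧ φ 0 = φ₀ ∧ α 0 = α₀
    · obtain ⟨T, α, g, φ, h, hα, rfl, rfl, rfl⟩ := hex
      have h0T := zero_mem_timeInterval h.pos
      obtain ⟨s₀, hs₀, hS⟩ := exists_le_of_continuousOn (h.continuousOn_S hα.continuousOn).neg h0T
      obtain ⟨e₀, he₀, hE⟩ := exists_le_of_continuousOn h.continuousOn_normGradSq h0T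
      obtain ⟨z₀, hz₀, hZ⟩ := exists_le_of_continuousOn (h.continuousOn_normSin hα.continuousOn) h0T
      exact ⟨s₀, e₀, z₀, hs₀, he₀, hz₀, fun _ _ _ _ _ _ _ _ _ x =>
        ⟨neg_le.1 (hS x), hE x, hZ x⟩⟩
    · exact ⟨0, 0, 0, le_rfl, le_rfl, le_rfl, fun T α g φ h hα h1 h2 h3 =>
        absurd ⟨T, α, g, φ, h, hα, h1, h2, h3⟩ hex⟩
  have hC : 0 ≤ 1 + s₀ := by linarith
  -- The extra 1 in C makes S + C ≥ 1, not merely positive. This lets quotients be bounded by their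
  -- numerators and lower powers be absorbed in the cubic estimate.
  refine ⟨1 + s₀, 7 * (2 + (1 + s₀)) ^ 3 + 6 * (α₀ * e₀) * (2 + (1 + s₀)) ^ 2 + 1 + z₀,
    (2 + (1 + s₀)) ^ 2 + α₀ * (m + 1) * (2 + (1 + s₀)), ?_⟩
  intro T α g φ h hα hα0 hα' hg hφ hαz t ht
  have hb := hbound T α g φ h hα hg hφ hαz
  subst hg hφ hαz
  have hS0 : ∀ x, 1 ≤ S (g 0) (φ 0) (α 0) x + (1 + s₀) := fun x => by linarith [(hb x).1]
  have hX : ∀ s ∈ timeInterval T, ∀ x, 1 ≤ S (g s) (φ s) (α s) x + (1 + s₀) := fun s hs x => by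
    linarith [h.le_S hα hα0 hα' (fun x => (hb x).1) hs x]
  have hsub := Icc_subset_timeInterval ht
  refine ⟨fun x => by linarith [hX t ht x], ?_⟩
  have hcont : ContinuousOn (fun p : M × ℝ =>
      Real.sqrt ((normWeyl (g p.2) p.1 + normHess (g p.2) (φ p.2) p.1 ^ 2) /
        (S (g p.2) (φ p.2) (α p.2) p.1 + (1 + s₀)))) (univ ×ˢ Icc 0 t) :=
    ((((h.continuousOn_normWeyl).add (h.continuousOn_normHess.pow 2)).div
      ((h.continuousOn_S hα.continuousOn).add continuousOn_const)
      fun p hp => (zero_lt_one.trans_le (hX p.2 hp.2 p.1)).ne').sqrt).mono (prod_mono_right hsub)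
  obtain ⟨x₀⟩ := ‹Nonempty M›
  have hne : (univ ×ˢ Icc 0 t : Set (M × ℝ)).Nonempty :=
    ⟨(x₀, 0), mem_univ _, left_mem_Icc.2 ht.1⟩
  obtain ⟨K, hK⟩ := ((isCompact_univ.prod isCompact_Icc).image_of_continuousOn
    hcont).exists_isGreatest (hne.image _)
  refine ⟨K, hK, ?_⟩
  have hKle : ∀ s ∈ Icc 0 t, ∀ x, Real.sqrt ((normWeyl (g s) x + normHess (g s) (φ s) x ^ 2) /
      (S (g s) (φ s) (α s) x + (1 + s₀))) ≤ K := fun s hs x =>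
    hK.2 ⟨(x, s), ⟨mem_univ _, hs⟩, rfl⟩
  have hK0 : 0 ≤ K := (Real.sqrt_nonneg _).trans (hKle t (right_mem_Icc.2 ht.1) x₀)
  refine h.normSin_div_le hm hα hα0 hα' hC hz₀ hK0 hS0 (fun x => (hb x).2.1) he₀ (fun x => ?_) ht
    fun s hs x => ?_
  -- At time 0 the denominator is at least 1, so the bound on |Sin| also bounds the quotient.
  · exact (div_le_self (Real.sqrt_nonneg _) (hS0 x)).trans (hb x).2.2
  · have h1 := hX s (hsub hs) x
    have h2 := (Real.sqrt_le_left hK0).1 (hKle s hs x)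
    rwa [div_le_iff₀ (by linarith)] at h2
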